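/- **Setting.** Let $\mathfrak L=\mathfrak L_-\sqcup\mathfrak L_+$ be a finite set of noise and kernel types with homogeneities $|\mathfrak t|_{\mathfrak s}\in\mathbb R$, let $\mathfrak s\in\mathbb N_{\ge1}^{d+1}$ be a scaling, $|k|_{\mathfrak s}=\sum_i\mathfrak s_ik_i$. Let $R$ be a normal subcritical rule: it assigns to each $\mathfrak t\in\mathfrak L$ a non-empty set $R(\mathfrak t)$ of finite multisets over $\mathfrak L\times\mathbb N^{d+1}$, closed under sub-multisets, with $R(\Xi)=\{\emptyset\}$ for $\Xi\in\mathfrak L_-$, and there is $\mathrm{reg}:\mathfrak L\to\mathbb R$ with $\mathrm{reg}(\mathfrak t)<|\mathfrak t|_{\mathfrak s}+\inf_{N\in R(\mathfrak t)}\sum_{(\mathfrak t',k)\in N}(\mathrm{reg}(\mathfrak t')-|k|_{\mathfrak s})$ for every $\mathfrak t$ (in particular $R$ may be a complete subcritical rule). The one-fold extension has the types $\bar{\mathfrak L}=\mathfrak L\sqcup\{\hat\Xi:\Xi\in\mathfrak L_-\}$; $q:\bar{\mathfrak L}\to\mathfrak L$ forgets hats, $|\hat\Xi|_{\mathfrak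 s}=|\Xi|_{\mathfrak s}$, and the extended rule is $\bar R(\mathfrak t)=\{N: qN\in R(\mathfrak t)\}$ for $\mathfrak t\in\mathfrak L_+$, $\bar R(\Xi)=\bar R(\hat\Xi)=\{\emptyset\}$. **Trees.** We consider isomorphism classes of finite rooted trees $\tau=(T^{\mathfrak n,\mathfrak o}_{\mathfrak e},\mathfrak t)$ with edge types $\mathfrak t$ in $\mathfrak L$ (or $\bar{\mathfrak L}$) and decorations $\mathfrak n:V\to\mathbb N^{d+1}$, $\mathfrak e:E\to\mathbb N^{d+1}$, $\mathfrak o:V\to\mathbb Z^{d+1}\oplus\mathbb Z(\mathfrak L)$; in both structures $\mathfrak o$ takes values in $\mathbb Z^{d+1}\oplus\mathbb Z(\mathfrak L)$. Put $|\tau|_-=\sum_e(|\mathfrak t(e)|_{\mathfrak s}-|\mathfrak e(e)|_{\mathfrak s})+\sum_v|\mathfrak n(v)|_{\mathfrak s}$ and $|\tau|_+=|\tau|_-+\sum_v|\mathfrak o(v)|_{\mathfrak s}$. For a subforest $A$ with vertices $N_A$ and edges $E_A$, let $\mathfrak n_A\le\mathfrak n$ be supported on $N_A$, let $\varepsilon_A:E\to\mathbb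 N^{d+1}$ be supported on the edges outside $A$ whose lower vertex is in $N_A$, and let $(\pi\varepsilon_A)(v)$ be the sum of $\varepsilon_A$ over the edges going up from $v$. * $\Delta_-^{ex}\tau=\sum_{A,\mathfrak n_A,\varepsilon_A}\frac1{\varepsilon_A!}\binom{\mathfrak n}{\mathfrak n_A}\prod_S S\otimes\tau/A$, over subforests $A$ without isolated vertices. Here $S$ runs over the components of $A$, with node decoration $\mathfrak n_A+\pi\varepsilon_A$ and the other decorations inherited, and $S$ is set to $0$ if $|S|_-\ge0$; $\tau/A$ is obtained by contracting each component to a vertex, with edge decoration $\mathfrak e+\varepsilon_A$, with $\mathfrak n-\mathfrak n_A$ summed over components, and with $\mathfrak o$ at a vertex equal to the sum of $\mathfrak o+\mathfrak n_A+\pi\varepsilon_A$ over the vertices and of $q\,\mathfrak t(e)-\mathfrak e(e)$ over the edges of the contracted component. * $\Delta_+^{ex}\tau=\sum_{A,\mathfrak n_A,\varepsilon_A}\frac1{\varepsilon_A!}\binom{\mathfrak n}{\mathfrak n_A}A\otimes X^m\prod_e\mathcal J_{\mathfrak t(e)}^{\mathfrak e(e)+\varepsilon_A(e)}(\tau_{\ge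 e})$, over subtrees $A$ containing the root, with node decoration $\mathfrak n_A+\pi\varepsilon_A$ on $A$. Here $m=\sum_{v\in N_A}(\mathfrak n-\mathfrak n_A)(v)$, $e$ runs over the edges leaving $A$, $\tau_{\ge e}$ is the subtree above $e$, and $\mathcal J_{\mathfrak t}^k(\sigma)$ is set to $0$ unless $|\mathfrak t|_{\mathfrak s}-|k|_{\mathfrak s}+|\sigma|_+>0$. $\mathcal T^{ex}$ is the span of the trees that strongly conform to $R$: those of the form $\tau/A$, as in $\Delta_-^{ex}$ with every component satisfying $|S|_-<0$, for a tree $\tau$ with $\mathfrak o=0$ for which the multiset of $(\mathfrak t(e),\mathfrak e(e))$ over the edges going up from a vertex $v$ belongs to $R(\mathfrak t)$, where $\mathfrak t$ is the type of the edge below $v$, or some element of $\mathfrak L$ if $v$ is the root. $\mathcal T\subseteq\mathcal T^{ex}$ is spanned by the trees with $\mathfrak o=0$. $\mathcal T_-^{ex}$ is the free commutative algebra on the trees of $\mathcal T^{ex}$ with $|\tau|_-<0$; $\mathcal T_+^{ex}$ is the free commutative algebra on $X_0,\dots,X_d$ and the symbols $\mathcal J_{\mathfrak t}^k(\tau)$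 of positive homogeneity with $\tau$ as above, conforming to $R(\mathfrak t)$ at the root. $\mathcal G_\pm^{ex}$ are their sets of characters; $M^g=(g\otimes\mathrm{id})\Delta_-^{ex}$ for $g\in\mathcal G_-^{ex}$, and $\Gamma_\gamma=(\mathrm{id}\otimes\gamma)\Delta_+^{ex}$ for $\gamma\in\mathcal G_+^{ex}$. The same objects built from $\bar R$ carry a bar. A character $g\in\mathcal G_-^{ex}$ is regarded as an element of $\bar{\mathcal G}_-^{ex}$ by letting it vanish on trees not in $\mathcal T_-^{ex}$. A sector of $\bar{\mathcal T}^{ex}$ is a subspace graded by $|\cdot|_+$, with homogeneities bounded below, and invariant under all $\bar\Gamma_\gamma$. **Shift operator.** For $r\in\mathbb R$ let $\mathcal S_r(\tau,\mathfrak t)=\sum_{\tilde{\mathfrak t}}r^{m(\tilde{\mathfrak t})}(\tau,\tilde{\mathfrak t})$, the sum being over all type maps $\tilde{\mathfrak t}:E(\tau)\to\bar{\mathfrak L}$ with $q\tilde{\mathfrak t}=\mathfrak t$, where $m(\tilde{\mathfrak t})$ is the number of edges with hatted type; extend $\mathcal S_r$ linearly, and multiplicatively to $\mathcal T_\pm^{ex}$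 (with $\mathcal S_rX_i=X_i$). **Lemma.** For every $r\in\mathbb R$: 1. $\Delta_-^{ex}\mathcal S_r=(\mathcal S_r\otimes\mathcal S_r)\Delta_-^{ex}$ and $\Delta_+^{ex}\mathcal S_r=(\mathcal S_r\otimes\mathcal S_r)\Delta_+^{ex}$ on $\mathcal T^{ex}$. 2. $\mathcal S_r[\mathcal T^{ex}]$ is a sector of $\bar{\mathcal T}^{ex}$. 3. $\mathcal S_rM^g=M^g\mathcal S_r$ on $\mathcal T^{ex}$ for every $g\in\mathcal G_-^{ex}$. 4. $\mathcal S_r$ maps $\mathcal T$ into $\bar{\mathcal T}$. 5. $\mathcal S_r(xy)=\mathcal S_r(x)\,\mathcal S_r(y)$ for the tree product (joining of roots, adding their decorations). 6. $\mathcal S_r$ commutes with composition with smooth functions: for smooth $F:\mathbb R^m\to\mathbb R$, $\gamma\in\mathbb R$ and $x_1,\dots,x_m$ that are combinations of $\mathbf 1$ and of trees with $|\tau|_+>0$, $\mathcal S_r\hat F_\gamma(x)=\hat F_\gamma(\mathcal S_rx)$, where $\hat F_\gamma(x)=\mathcal Q_{<\gamma}\sum_k\frac1{k!}D^kF(\bar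 x)\,(x-\bar x\mathbf 1)^k$, $\bar x$ is the coefficient of $\mathbf 1$, and $\mathcal Q_{<\gamma}$ projects onto trees with $|\tau|_+<\gamma$. 7. $\mathcal S_r$ commutes with integration $\mathcal I_{\mathfrak t}^k$ (planting on an edge of type $\mathfrak t\in\mathfrak L_+$ and decoration $k$) and with the derivatives $\mathcal D_i$ (determined by the Leibniz rule, $\mathcal D_iX^k=k_iX^{k-e_i}$, $\mathcal D_i\mathcal I_{\mathfrak t}^k(\tau)=\mathcal I_{\mathfrak t}^{k+e_i}(\tau)$; the decoration $\mathfrak o$ of the root is unaffected). -/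

import Mathlib

open scoped Classical TensorProduct

noncomputable section

/-- Multi-indices in `ℕ^{d+1}`. -/
abbrev MIdx (d : ℕ) : Type := Fin (d + 1) → ℕ

/-- The group `ℤ^{d+1} ⊕ ℤ(L)` in which the extended decoration `𝔬` takes values. -/
abbrev ODec (d : ℕ) (L : Type*) : Type _ := (Fin (d + 1) → ℤ) × (L →₀ ℤ)

/-! ### Typed decorated trees

Edges carry types in `𝔱`; the extended decoration `𝔬` has labels in the set of original types `L`.
For the original structure `𝔱 = L`. -/

/-- A finite rooted tree, given by its parent map, with edge types and decorations `𝔫, 𝔬, 𝔢`.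
The edges are the non-root vertices: `v` stands for the edge from `par v` to `v`. -/
structure PreTree (d : ℕ) (𝔱 L : Type*) where
  V : Type
  fin : Fintype V
  root : V
  par : V → V
  par_root : par root = root
  reach : ∀ v, ∃ k, par^[k] v = root
  typ : {v : V // v ≠ root} → 𝔱
  e : {v : V // v ≠ root} → MIdx d
  n : V → MIdx d
  o : V → ODec d L

namespace PreTree

variable {d : ℕ} {𝔱 L : Type*}

instance (T : PreTree d 𝔱 L) : Fintype T.V := T.fin

/-- The edges of the tree. -/
abbrev Edge (T : PreTree d 𝔱 L) : Type := {v : T.V // v ≠ T.root}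

/-- The lower vertex of an edge (the one closer to the root). -/
def low (T : PreTree d 𝔱 L) (a : T.Edge) : T.V := T.par a.1

/-- Isomorphism of typed decorated trees. -/
structure Iso (S T : PreTree d 𝔱 L) where
  toEquiv : S.V ≃ T.V
  map_root : toEquiv S.root = T.root
  map_par : ∀ v, toEquiv (S.par v) = T.par (toEquiv v)
  map_typ : ∀ (v : S.Edge) (w : T.Edge), toEquiv v.1 = w.1 → S.typ v = T.typ w
  map_e : ∀ (v : S.Edge) (w : T.Edge), toEquiv v.1 = w.1 → S.e v = T.e w
  map_n : ∀ v, S.n v = T.n (toEquiv v)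
  map_o : ∀ v, S.o v = T.o (toEquiv v)

/-- The relation of being isomorphic. -/
instance setoid (d : ℕ) (𝔱 L : Type*) : Setoid (PreTree d 𝔱 L) where
  r S T := Nonempty (Iso S T)
  iseqv :=
    { refl := fun S => ⟨⟨Equiv.refl _, rfl, fun _ => rfl,
        fun v w h => by rw [show v = w from Subtype.ext h],
        fun v w h => by rw [show v = w from Subtype.ext h], fun _ => rfl, fun _ => rfl⟩⟩
      symm := by
        rintro S T ⟨f⟩
        refine ⟨⟨f.toEquiv.symm, ?_, ?_, ?_, ?_, ?_, ?_⟩⟩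
        · rw [← f.map_root]; simp
        · intro v; rw [Equiv.symm_apply_eq, f.map_par]; simp
        · intro v w h; exact (f.map_typ w v (by rw [← h]; simp)).symm
        · intro v w h; exact (f.map_e w v (by rw [← h]; simp)).symm
        · intro v; rw [f.map_n]; simp
        · intro v; rw [f.map_o]; simp
      trans := by
        rintro S T U ⟨f⟩ ⟨g⟩
        have key : ∀ v : S.Edge, f.toEquiv v.1 ≠ T.root := fun v h =>
          v.2 (f.toEquiv.injective (h.trans f.map_root.symm))
        refine ⟨⟨f.toEquiv.trans g.toEquiv, ?_, ?_, ?_, ?_, ?_, ?_⟩⟩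
        · simp [f.map_root, g.map_root]
        · intro v; simp [f.map_par, g.map_par]
        · intro v w h
          exact (f.map_typ v ⟨_, key v⟩ rfl).trans (g.map_typ ⟨_, key v⟩ w h)
        · intro v w h
          exact (f.map_e v ⟨_, key v⟩ rfl).trans (g.map_e ⟨_, key v⟩ w h)
        · intro v; rw [f.map_n, g.map_n]; rfl
        · intro v; rw [f.map_o, g.map_o]; rfl }

/-- The same decorated tree with another type map. -/
def retype {𝔱' : Type*} (T : PreTree d 𝔱 L) (f : T.Edge → 𝔱') : PreTree d 𝔱' L where
  V := T.V
  fin := T.fin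
  root := T.root
  par := T.par
  par_root := T.par_root
  reach := T.reach
  typ := f
  e := T.e
  n := T.n
  o := T.o

/-! ### Extraction and contraction -/

/-- The vertex `v` is the upper end of an edge in `A`. -/
def InEdges (T : PreTree d 𝔱 L) (A : Finset T.Edge) (v : T.V) : Prop :=
  ∃ a ∈ A, a.1 = v

/-- One step towards the root along an edge in `A`, if there is one. -/
def stepDown (T : PreTree d 𝔱 L) (A : Finset T.Edge) (v : T.V) : T.V :=
  if T.InEdges A v then T.par v else v

/-- The depth of a vertex. -/
def depth (T : PreTree d 𝔱 L) (v : T.V) : ℕ := Nat.find (T.reach v)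

/-- The root of the connected component of `v` in the subforest with edge set `A`. -/
def top (T : PreTree d 𝔱 L) (A : Finset T.Edge) (v : T.V) : T.V :=
  (T.stepDown A)^[T.depth v] v

theorem root_notIn (T : PreTree d 𝔱 L) (A : Finset T.Edge) : ¬ T.InEdges A T.root := by
  rintro ⟨a, -, h⟩
  exact a.2 h

theorem depth_par (T : PreTree d 𝔱 L) {v : T.V} (h : v ≠ T.root) :
    T.depth v = T.depth (T.par v) + 1 := by
  unfold depth
  rw [Nat.find_eq_iff]
  refine ⟨?_, ?_⟩
  · rw [Function.iterate_succ_apply]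
    exact Nat.find_spec (T.reach (T.par v))
  · intro k hk
    cases k with
    | zero => exact h
    | succ k =>
      rw [Function.iterate_succ_apply]
      exact Nat.find_min (T.reach (T.par v)) (by omega)

theorem top_of_notIn (T : PreTree d 𝔱 L) {A : Finset T.Edge} {v : T.V}
    (h : ¬ T.InEdges A v) : T.top A v = v :=
  Function.iterate_fixed (by simp [stepDown, h]) _

theorem top_of_in (T : PreTree d 𝔱 L) {A : Finset T.Edge} {v : T.V}
    (h : T.InEdges A v) : T.top A v = T.top A (T.par v) := by
  have hv : v ≠ T.root := fun hv => T.root_notIn A (hv ▸ h)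
  unfold top
  rw [T.depth_par hv, Function.iterate_succ_apply]
  congr 1
  simp [stepDown, h]

theorem induct (T : PreTree d 𝔱 L) {P : T.V → Prop} (h0 : P T.root)
    (h1 : ∀ v, v ≠ T.root → P (T.par v) → P v) (v : T.V) : P v := by
  induction hk : T.depth v generalizing v with
  | zero =>
    by_cases hv : v = T.root
    · exact hv ▸ h0
    · rw [T.depth_par hv] at hk; omega
  | succ k ih =>
    by_cases hv : v = T.root
    · exact hv ▸ h0
    · rw [T.depth_par hv] at hk
      exact h1 v hv (ih _ (by omega))

theorem top_notIn (T : PreTree d 𝔱 L) (A : Finset T.Edge) (v : T.V) :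
    ¬ T.InEdges A (T.top A v) := by
  induction v using T.induct with
  | h0 => rw [T.top_of_notIn (T.root_notIn A)]; exact T.root_notIn A
  | h1 v hv ih =>
    by_cases h : T.InEdges A v
    · rwa [T.top_of_in h]
    · rwa [T.top_of_notIn h]

theorem top_root (T : PreTree d 𝔱 L) (A : Finset T.Edge) : T.top A T.root = T.root :=
  T.top_of_notIn (T.root_notIn A)

theorem ne_root_of_comp (T : PreTree d 𝔱 L) {A : Finset T.Edge} {ρ v : T.V}
    (h : T.top A v = ρ) (hv : v ≠ ρ) : v ≠ T.root := by
  rintro rfl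
  exact hv ((T.top_root A).symm.trans h)

/-- The connected component with root `ρ` of the subforest with edge set `A`, with node decoration
given by (the restriction of) `m` and all other decorations inherited from the tree. -/
def comp (T : PreTree d 𝔱 L) (A : Finset T.Edge) (ρ : T.V) (hρ : ¬ T.InEdges A ρ)
    (m : T.V → MIdx d) : PreTree d 𝔱 L where
  V := {v : T.V // T.top A v = ρ}
  fin := inferInstance
  root := ⟨ρ, T.top_of_notIn hρ⟩
  par v := if h : T.InEdges A v.1 then ⟨T.par v.1, by rw [← T.top_of_in h]; exact v.2⟩ else v
  par_root := by simp [hρ]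
  reach := by
    rintro ⟨v, hv⟩
    induction v using T.induct with
    | h0 =>
      refine ⟨0, Subtype.ext ?_⟩
      rw [T.top_root] at hv
      exact hv
    | h1 v _ ih =>
      by_cases h : T.InEdges A v
      · obtain ⟨k, hk⟩ := ih (by rw [← T.top_of_in h]; exact hv)
        refine ⟨k + 1, ?_⟩
        rw [Function.iterate_succ_apply]
        simpa [h] using hk
      · refine ⟨0, Subtype.ext ?_⟩
        rw [T.top_of_notIn h] at hv
        exact hv
  typ v := T.typ ⟨v.1.1, T.ne_root_of_comp v.1.2 fun h => v.2 (Subtype.ext h)⟩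
  e v := T.e ⟨v.1.1, T.ne_root_of_comp v.1.2 fun h => v.2 (Subtype.ext h)⟩
  n v := m v.1
  o v := T.o v.1

/-- The vertices of the subforest formed by the edges in `A` and their end points. -/
def verts (T : PreTree d 𝔱 L) (A : Finset T.Edge) : Set T.V :=
  {v | T.InEdges A v ∨ ∃ a ∈ A, T.low a = v}

/-- `ρ` is the root of a connected component (with at least one edge) of the subforest `A`. -/
def IsCompRoot (T : PreTree d 𝔱 L) (A : Finset T.Edge) (ρ : T.V) : Prop :=
  ¬ T.InEdges A ρ ∧ ρ ∈ T.verts A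

/-- The decorations `𝔫_A`, `ε_A` over which the coproducts sum: `A` is the edge set and `N` the
vertex set of a subforest; `𝔫_A ≤ 𝔫` is supported on `N`, and `ε_A` is supported on the edges that
are not in `A` but whose lower vertex is in `N`. -/
structure Deco (T : PreTree d 𝔱 L) (A : Finset T.Edge) (N : Set T.V) where
  nA : T.V → MIdx d
  ε : T.Edge → MIdx d
  nA_le : nA ≤ T.n
  nA_supp : ∀ v, v ∉ N → nA v = 0
  ε_supp : ∀ a, a ∈ A ∨ T.low a ∉ N → ε a = 0

/-- `(π f)(v)` is the sum of `f` over the edges going up from `v`. -/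
def out (T : PreTree d 𝔱 L) (f : T.Edge → MIdx d) (v : T.V) : MIdx d :=
  ∑ a with T.low a = v, f a

namespace Deco

variable {T : PreTree d 𝔱 L} {A : Finset T.Edge} {N : Set T.V}

/-- The node decoration `𝔫_A + π ε_A` of the extracted subforest. -/
def extracted (c : Deco T A N) (v : T.V) : MIdx d := c.nA v + T.out c.ε v

/-- The combinatorial factor `binom(𝔫, 𝔫_A) / ε_A!`. -/
def coef (c : Deco T A N) : ℝ :=
  (∏ v, ∏ i, ((T.n v i).choose (c.nA v i) : ℝ)) / ∏ a, ∏ i, ((c.ε a i).factorial : ℝ)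

/-- The tree obtained by contracting every connected component of `A` to a vertex, with
decorations `𝔫 - 𝔫_A` (summed over the component), `𝔢 + ε_A`, and with `𝔬` recording the type and
the decorations of the contracted component. Types enter `𝔬` through the map `q`. -/
def contract (q : 𝔱 → L) (c : Deco T A N) : PreTree d 𝔱 L where
  V := {v : T.V // ¬ T.InEdges A v}
  fin := inferInstance
  root := ⟨T.root, T.root_notIn A⟩
  par v := ⟨T.top A (T.par v.1), T.top_notIn A _⟩
  par_root := Subtype.ext (by simp [T.par_root, T.top_root])
  reach := by
    have key : ∀ v : T.V, ∃ k, (fun w : {v : T.V // ¬ T.InEdges A v} =>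
        (⟨T.top A (T.par w.1), T.top_notIn A _⟩ : {v : T.V // ¬ T.InEdges A v}))^[k]
          ⟨T.top A v, T.top_notIn A v⟩ = ⟨T.root, T.root_notIn A⟩ := by
      intro v
      induction v using T.induct with
      | h0 => exact ⟨0, Subtype.ext (T.top_root A)⟩
      | h1 v hv ih =>
        obtain ⟨k, hk⟩ := ih
        by_cases h : T.InEdges A v
        · refine ⟨k, ?_⟩
          simp only [T.top_of_in h]
          exact hk
        · refine ⟨k + 1, ?_⟩
          rw [Function.iterate_succ_apply]
          simp only [T.top_of_notIn h]
          exact hk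
    rintro ⟨v, hv⟩
    have := key v
    simp only [T.top_of_notIn hv] at this
    exact this
  typ v := T.typ ⟨v.1.1, fun h => v.2 (Subtype.ext h)⟩
  e v := T.e ⟨v.1.1, fun h => v.2 (Subtype.ext h)⟩ + c.ε ⟨v.1.1, fun h => v.2 (Subtype.ext h)⟩
  n v := ∑ u with T.top A u = v.1, (T.n u - c.nA u)
  o v := (∑ u with T.top A u = v.1, (T.o u + (fun i => (c.extracted u i : ℤ), 0))) +
    ∑ a ∈ A with T.top A a.1 = v.1,
      ((fun i => -(T.e a i : ℤ), Finsupp.single (q (T.typ a)) 1) : ODec d L)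

end Deco

/-! ### Product, planting and differentiation at the root -/

/-- The tree product: the two roots are identified and their decorations are added. -/
def mul (S T : PreTree d 𝔱 L) : PreTree d 𝔱 L where
  V := S.V ⊕ T.Edge
  fin := inferInstance
  root := Sum.inl S.root
  par := Sum.elim (fun v => Sum.inl (S.par v))
    (fun a => if h : T.low a = T.root then Sum.inl S.root else Sum.inr ⟨T.low a, h⟩)
  par_root := by simp [S.par_root]
  reach := by
    rintro (v | ⟨v, hv⟩)
    · induction v using S.induct with
      | h0 => exact ⟨0, rfl⟩
      | h1 v _ ih =>
        obtain ⟨k, hk⟩ := ih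
        exact ⟨k + 1, by rw [Function.iterate_succ_apply]; exact hk⟩
    · induction v using T.induct with
      | h0 => exact absurd rfl hv
      | h1 v _ ih =>
        by_cases h : T.par v = T.root
        · refine ⟨1, ?_⟩
          simp [low, h]
        · obtain ⟨k, hk⟩ := ih h
          refine ⟨k + 1, ?_⟩
          rw [Function.iterate_succ_apply]
          simpa [low, h] using hk
  typ := fun
    | ⟨Sum.inl v, h⟩ => S.typ ⟨v, fun h' => h (by rw [h'])⟩
    | ⟨Sum.inr a, _⟩ => T.typ a
  e := fun
    | ⟨Sum.inl v, h⟩ => S.e ⟨v, fun h' => h (by rw [h'])⟩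
    | ⟨Sum.inr a, _⟩ => T.e a
  n := Sum.elim (fun v => S.n v + if v = S.root then T.n T.root else 0) (fun a => T.n a.1)
  o := Sum.elim (fun v => S.o v + if v = S.root then T.o T.root else 0) (fun a => T.o a.1)

/-- The one-vertex tree without decorations. -/
def one (d : ℕ) (𝔱 L : Type*) : PreTree d 𝔱 L where
  V := Unit
  fin := inferInstance
  root := ()
  par := id
  par_root := rfl
  reach _ := ⟨0, rfl⟩
  typ v := absurd rfl v.2
  e _ := 0
  n _ := 0
  o _ := 0

/-- The planted tree `𝓘_t^k(T)`: a new root is joined to the root of `T` by an edge of type `t`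
with decoration `k`. -/
def plant (t : 𝔱) (k : MIdx d) (T : PreTree d 𝔱 L) : PreTree d 𝔱 L where
  V := Option T.V
  fin := inferInstance
  root := none
  par v := v.bind fun v => if v = T.root then none else some (T.par v)
  par_root := rfl
  reach := by
    rintro (_ | v)
    · exact ⟨0, rfl⟩
    · induction v using T.induct with
      | h0 => exact ⟨1, by simp⟩
      | h1 v hv ih =>
        obtain ⟨k, hk⟩ := ih
        refine ⟨k + 1, ?_⟩
        rw [Function.iterate_succ_apply]
        simpa [hv] using hk
  typ := fun
    | ⟨none, h⟩ => absurd rfl h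
    | ⟨some v, _⟩ => if h : v = T.root then t else T.typ ⟨v, h⟩
  e := fun
    | ⟨none, h⟩ => absurd rfl h
    | ⟨some v, _⟩ => if h : v = T.root then k else T.e ⟨v, h⟩
  n := fun v => v.elim 0 T.n
  o := fun v => v.elim 0 T.o

end PreTree

/-- Typed decorated trees up to isomorphism. All operations on `DTree` below are defined through a
representative, by formulas that are invariant under isomorphism. -/
abbrev DTree (d : ℕ) (𝔱 L : Type*) : Type _ := Quotient (PreTree.setoid d 𝔱 L)

/-- The vector space spanned by all typed decorated trees. -/
abbrev TreeSpace (d : ℕ) (𝔱 L : Type*) : Type _ := DTree d 𝔱 L →₀ ℝ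

section General

variable {d : ℕ} {𝔱 L : Type*}

/-- The class of a tree, as a basis vector. -/
def PreTree.vec (T : PreTree d 𝔱 L) : TreeSpace d 𝔱 L :=
  Finsupp.single (Quotient.mk _ T) 1

/-- The unit for the tree product. -/
def unitTree (d : ℕ) (𝔱 L : Type*) : DTree d 𝔱 L := Quotient.mk _ (PreTree.one d 𝔱 L)

/-- The tree product, extended bilinearly. -/
def treeMul (x y : TreeSpace d 𝔱 L) : TreeSpace d 𝔱 L :=
  x.sum fun σ a => y.sum fun τ b => (a * b) • (PreTree.mul σ.out τ.out).vec

/-- The product of finitely many elements. -/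
def treeProd {k : ℕ} (x : Fin k → TreeSpace d 𝔱 L) : TreeSpace d 𝔱 L :=
  (List.ofFn x).foldr treeMul (Finsupp.single (unitTree d 𝔱 L) 1)

/-- Integration `𝓘_t^k`. -/
def integ (t : 𝔱) (k : MIdx d) : TreeSpace d 𝔱 L →ₗ[ℝ] TreeSpace d 𝔱 L :=
  Finsupp.linearCombination ℝ fun τ => (PreTree.plant t k τ.out).vec

/-- The derivative in direction `i` of a tree `X^k ∏_j 𝓘_{t_j}^{k_j}(τ_j)`, by the Leibniz rule from
`X^k ↦ k_i X^{k-e_i}` and `𝓘_t^k(τ) ↦ 𝓘_t^{k+e_i}(τ)`. -/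
def PreTree.grad (i : Fin (d + 1)) (T : PreTree d 𝔱 L) : TreeSpace d 𝔱 L :=
  (T.n T.root i : ℝ) •
      PreTree.vec { T with n := Function.update T.n T.root (T.n T.root - Pi.single i 1) } +
    ∑ a : {a : T.Edge // T.low a = T.root},
      PreTree.vec { T with e := Function.update T.e a.1 (T.e a.1 + Pi.single i 1) }

/-- Differentiation. -/
def grad (i : Fin (d + 1)) : TreeSpace d 𝔱 L →ₗ[ℝ] TreeSpace d 𝔱 L :=
  Finsupp.linearCombination ℝ fun τ => τ.out.grad i

/-! ### Homogeneities -/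

/-- A scaling `s`, homogeneities of the original types, and the map `q` from the set of types `𝔱` to
the set `L` of original types. A type `t` has homogeneity `hom (q t)`. -/
structure TypeSystem (d : ℕ) (𝔱 L : Type*) where
  s : Fin (d + 1) → ℕ
  hom : L → ℝ
  q : 𝔱 → L

namespace TypeSystem

variable (𝔖 : TypeSystem d 𝔱 L)

/-- The scaled degree `|k|_s` of a multi-index. -/
def mdeg (k : MIdx d) : ℝ := ∑ i, (𝔖.s i : ℝ) * k i

/-- The scaled degree of an element of `ℤ^{d+1} ⊕ ℤ(L)`. -/
def odeg (α : ODec d L) : ℝ :=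
  (∑ i, (𝔖.s i : ℝ) * α.1 i) + α.2.sum fun l c => (c : ℝ) * 𝔖.hom l

/-- The homogeneity `|·|_-`, which ignores the extended decoration. -/
def preDegMinus (T : PreTree d 𝔱 L) : ℝ :=
  (∑ a : T.Edge, (𝔖.hom (𝔖.q (T.typ a)) - 𝔖.mdeg (T.e a))) + ∑ v, 𝔖.mdeg (T.n v)

/-- The homogeneity `|·|_+`, which takes the extended decoration into account. -/
def preDegPlus (T : PreTree d 𝔱 L) : ℝ := 𝔖.preDegMinus T + ∑ v, 𝔖.odeg (T.o v)

/-- The homogeneity `|·|_-` of a tree. -/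
def degMinus (τ : DTree d 𝔱 L) : ℝ := 𝔖.preDegMinus τ.out

/-- The homogeneity `|·|_+` of a tree. -/
def degPlus (τ : DTree d 𝔱 L) : ℝ := 𝔖.preDegPlus τ.out

/-- The homogeneity of the planted tree `𝓙_t^k(τ)`, for `p = (t, k, τ)`. -/
def degPlanted (p : 𝔱 × MIdx d × DTree d 𝔱 L) : ℝ :=
  𝔖.hom (𝔖.q p.1) - 𝔖.mdeg p.2.1 + 𝔖.degPlus p.2.2

/-! ### The algebras of the negative and the positive renormalisation -/

/-- The free commutative algebra generated by the trees with `|τ|_- < 0`. -/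
abbrev NegAlg : Type _ := MvPolynomial {τ : DTree d 𝔱 L // 𝔖.degMinus τ < 0} ℝ

/-- The free commutative algebra generated by `X_0, …, X_d` and the symbols `𝓙_t^k(τ)` of positive
homogeneity. -/
abbrev PosAlg : Type _ :=
  MvPolynomial (Fin (d + 1) ⊕ {p : 𝔱 × MIdx d × DTree d 𝔱 L // 0 < 𝔖.degPlanted p}) ℝ

/-- The projection of a tree to the negative algebra. -/
def negGen (τ : DTree d 𝔱 L) : 𝔖.NegAlg :=
  if h : 𝔖.degMinus τ < 0 then MvPolynomial.X ⟨τ, h⟩ else 0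

/-- The projection of a planted tree to the positive algebra. -/
def posGen (p : 𝔱 × MIdx d × DTree d 𝔱 L) : 𝔖.PosAlg :=
  if h : 0 < 𝔖.degPlanted p then MvPolynomial.X (Sum.inr ⟨p, h⟩) else 0

/-- The generator `X_i` of the positive algebra. -/
def posX (i : Fin (d + 1)) : 𝔖.PosAlg := MvPolynomial.X (Sum.inl i)

/-! ### The coproducts -/

/-- `Δ_-^ex` on a tree: sum over all subforests `A` without isolated vertices; the connected
components of `A` are extracted, and contracted in the remaining tree. -/
def preDeltaMinus (T : PreTree d 𝔱 L) : 𝔖.NegAlg ⊗[ℝ] TreeSpace d 𝔱 L :=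
  ∑ A : Finset T.Edge, ∑ᶠ c : PreTree.Deco T A (T.verts A),
    c.coef • ((∏ ρ : {ρ : T.V // T.IsCompRoot A ρ},
      𝔖.negGen (Quotient.mk _ (T.comp A ρ.1 ρ.2.1 c.extracted))) ⊗ₜ[ℝ] (c.contract 𝔖.q).vec)

/-- `A` is the edge set of a subtree that contains the root. -/
def _root_.PreTree.IsTrunk (T : PreTree d 𝔱 L) (A : Finset T.Edge) : Prop :=
  ∀ a ∈ A, T.low a = T.root ∨ T.InEdges A (T.low a)

/-- The subtree above the edge `a`. -/
def _root_.PreTree.above (T : PreTree d 𝔱 L) (a : T.Edge) : PreTree d 𝔱 L :=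
  T.comp (Finset.univ.erase a) a.1
    (by rintro ⟨b, hb, h⟩; exact (Finset.mem_erase.1 hb).1 (Subtype.ext h)) T.n

/-- `Δ_+^ex` on a tree: sum over all subtrees `A` that contain the root; the left factor is `A`, the
right factor is `X^m ∏_a 𝓙_{t(a)}^{𝔢(a)+ε(a)}(T_{≥ a})`, where `a` runs over the edges that
leave `A` and `m` is the sum of `𝔫 - 𝔫_A` over `A`. -/
def preDeltaPlus (T : PreTree d 𝔱 L) : TreeSpace d 𝔱 L ⊗[ℝ] 𝔖.PosAlg :=
  ∑ A : {A : Finset T.Edge // T.IsTrunk A},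
    ∑ᶠ c : PreTree.Deco T A.1 (insert T.root (T.verts A.1)),
      c.coef • ((T.comp A.1 T.root (T.root_notIn A.1) c.extracted).vec ⊗ₜ[ℝ]
        ((∏ v with v ∈ insert T.root (T.verts A.1), ∏ i, 𝔖.posX i ^ (T.n v i - c.nA v i)) *
          ∏ a with a ∉ A.1 ∧ T.low a ∈ insert T.root (T.verts A.1),
            𝔖.posGen (T.typ a, T.e a + c.ε a, Quotient.mk _ (T.above a))))

/-- The coproduct `Δ_-^ex`. -/
def deltaMinus : TreeSpace d 𝔱 L →ₗ[ℝ] 𝔖.NegAlg ⊗[ℝ] TreeSpace d 𝔱 L :=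
  Finsupp.linearCombination ℝ fun τ => 𝔖.preDeltaMinus τ.out

/-- The coproduct `Δ_+^ex`. -/
def deltaPlus : TreeSpace d 𝔱 L →ₗ[ℝ] TreeSpace d 𝔱 L ⊗[ℝ] 𝔖.PosAlg :=
  Finsupp.linearCombination ℝ fun τ => 𝔖.preDeltaPlus τ.out

end TypeSystem

/-! ### Rules and the spaces they generate -/

/-- A rule assigns to every type a non-empty set of (finitely supported) multi-indices over
`𝔱 × ℕ^{d+1}`, that is, of multisets. -/
structure Rule (d : ℕ) (𝔱 : Type*) where
  R : 𝔱 → Set (Multiset (𝔱 × MIdx d))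
  nonempty : ∀ t, (R t).Nonempty

/-- A rule is normal if it is closed under passing to sub-multisets. -/
def Rule.Normal (R : Rule d 𝔱) : Prop := ∀ t, ∀ N ∈ R.R t, ∀ M ≤ N, M ∈ R.R t

/-- A rule is subcritical if there is `reg` with `reg t < |t|_s + inf_{N ∈ R(t)} reg N` for all `t`,
where `reg N` is the sum of `reg t' - |k|_s` over `(t', k) ∈ N`. -/
def Rule.Subcritical (𝔖 : TypeSystem d 𝔱 L) (R : Rule d 𝔱) : Prop :=
  ∃ reg : 𝔱 → ℝ, ∀ t, ∃ c : ℝ, reg t < 𝔖.hom (𝔖.q t) + c ∧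
    ∀ N ∈ R.R t, c ≤ (N.map fun p => reg p.1 - 𝔖.mdeg p.2).sum

/-- The multiset of types and decorations of the edges going up from `v`. -/
def PreTree.nodeType (T : PreTree d 𝔱 L) (v : T.V) : Multiset (𝔱 × MIdx d) :=
  ((Finset.univ : Finset T.Edge).filter fun a => T.low a = v).val.map fun a => (T.typ a, T.e a)

/-- The tree conforms to the rule at every vertex other than the root, and at the root it conforms
to the rule as if sitting on top of an edge of type `t`. -/
def PreTree.ConformsAt (T : PreTree d 𝔱 L) (R : Rule d 𝔱) (t : 𝔱) : Prop :=
  (∀ a : T.Edge, T.nodeType a.1 ∈ R.R (T.typ a)) ∧ T.nodeType T.root ∈ R.R t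

variable (𝔖 : TypeSystem d 𝔱 L)

/-- Trees obtained from a conforming tree without extended decoration (with type `t` below the
root) by contracting a family of disjoint subtrees of negative homogeneity, as in the right factor
of `Δ_-^ex`. -/
def treesExAt (R : Rule d 𝔱) (t : 𝔱) : Set (DTree d 𝔱 L) :=
  {τ | ∃ T : PreTree d 𝔱 L, (∀ v, T.o v = 0) ∧ T.ConformsAt R t ∧
    ∃ (A : Finset T.Edge) (c : PreTree.Deco T A (T.verts A)),
      (∀ ρ : {ρ : T.V // T.IsCompRoot A ρ},
        𝔖.preDegMinus (T.comp A ρ.1 ρ.2.1 c.extracted) < 0) ∧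
      τ = Quotient.mk _ (c.contract 𝔖.q)}

/-- The set of trees that span `𝒯^ex`: those that strongly conform to the rule. -/
def treesEx (R : Rule d 𝔱) : Set (DTree d 𝔱 L) := ⋃ t, treesExAt 𝔖 R t

/-- The space `𝒯^ex`. -/
def TEx (R : Rule d 𝔱) : Submodule ℝ (TreeSpace d 𝔱 L) :=
  Submodule.span ℝ ((fun τ => Finsupp.single τ 1) '' treesEx 𝔖 R)

/-- The reduced space `𝒯`, spanned by the trees in `𝒯^ex` without extended decoration. -/
def TReduced (R : Rule d 𝔱) : Submodule ℝ (TreeSpace d 𝔱 L) :=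
  Submodule.span ℝ ((fun τ => Finsupp.single τ 1) ''
    {τ ∈ treesEx 𝔖 R | ∀ v, τ.out.o v = 0})

/-- The algebra `𝒯_-^ex`, generated by the trees in `𝒯^ex` with `|τ|_- < 0`. -/
def TMinus (R : Rule d 𝔱) : Subalgebra ℝ 𝔖.NegAlg :=
  Algebra.adjoin ℝ (MvPolynomial.X '' {τ | τ.1 ∈ treesEx 𝔖 R})

/-- The algebra `𝒯_+^ex`, generated by `X_0, …, X_d` and the conforming planted trees `𝓙_t^k(τ)` of
positive homogeneity. -/
def TPlus (R : Rule d 𝔱) : Subalgebra ℝ 𝔖.PosAlg :=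
  Algebra.adjoin ℝ (Set.range 𝔖.posX ∪
    (fun p => MvPolynomial.X (Sum.inr p)) '' {p | p.1.2.2 ∈ treesExAt 𝔖 R p.1.1})

/-- A character of `𝒯_-^ex` as a functional on all products of negative trees: trees outside `𝒯^ex`
(which do not occur in `Δ_-^ex τ` for `τ ∈ 𝒯^ex`) are sent to zero. -/
def negEval (R : Rule d 𝔱) (g : TMinus 𝔖 R →ₐ[ℝ] ℝ) : 𝔖.NegAlg →ₐ[ℝ] ℝ :=
  MvPolynomial.aeval fun τ =>
    if h : τ.1 ∈ treesEx 𝔖 R then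
      g ⟨MvPolynomial.X τ, Algebra.subset_adjoin (Set.mem_image_of_mem _ h)⟩ else 0

/-- A character of `𝒯_+^ex` as a functional on the positive algebra; planted trees outside `𝒯_+^ex`
(which do not occur in `Δ_+^ex τ` for `τ ∈ 𝒯^ex`) are sent to zero. -/
def posEval (R : Rule d 𝔱) (γ : TPlus 𝔖 R →ₐ[ℝ] ℝ) : 𝔖.PosAlg →ₐ[ℝ] ℝ :=
  MvPolynomial.aeval (Sum.elim
    (fun i => γ ⟨𝔖.posX i, Algebra.subset_adjoin (Or.inl ⟨i, rfl⟩)⟩)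
    fun p => if h : p.1.2.2 ∈ treesExAt 𝔖 R p.1.1 then
      γ ⟨MvPolynomial.X (Sum.inr p), Algebra.subset_adjoin (Or.inr (Set.mem_image_of_mem _ h))⟩
      else 0)

/-- The renormalisation operator `M^g = (g ⊗ id) Δ_-^ex`. -/
def renorm (R : Rule d 𝔱) (g : TMinus 𝔖 R →ₐ[ℝ] ℝ) :
    TreeSpace d 𝔱 L →ₗ[ℝ] TreeSpace d 𝔱 L :=
  (TensorProduct.lid ℝ _).toLinearMap ∘ₗ
    TensorProduct.map (negEval 𝔖 R g).toLinearMap LinearMap.id ∘ₗ 𝔖.deltaMinus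

/-- The element `Γ_γ = (id ⊗ γ) Δ_+^ex` of the structure group. -/
def structGroup (R : Rule d 𝔱) (γ : TPlus 𝔖 R →ₐ[ℝ] ℝ) :
    TreeSpace d 𝔱 L →ₗ[ℝ] TreeSpace d 𝔱 L :=
  (TensorProduct.rid ℝ _).toLinearMap ∘ₗ
    TensorProduct.map LinearMap.id (posEval 𝔖 R γ).toLinearMap ∘ₗ 𝔖.deltaPlus

/-- A sector of `𝒯^ex`: a subspace that is graded by the homogeneity `|·|_+`, with homogeneities
bounded from below, and invariant under the structure group. -/
structure IsSector (R : Rule d 𝔱) (W : Submodule ℝ (TreeSpace d 𝔱 L)) : Prop where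
  le : W ≤ TEx 𝔖 R
  graded : ∀ x ∈ W, ∀ β : ℝ, x.filter (fun τ => 𝔖.degPlus τ = β) ∈ W
  bounded_below : ∃ α ≤ (0 : ℝ), ∀ x ∈ W, ∀ τ ∈ x.support, α ≤ 𝔖.degPlus τ
  invariant : ∀ γ : TPlus 𝔖 R →ₐ[ℝ] ℝ, ∀ x ∈ W, structGroup 𝔖 R γ x ∈ W

/-! ### Composition with smooth functions -/

/-- An element is function-like if it is a combination of `1` and of trees of positive
homogeneity. -/
def FunctionLike (x : TreeSpace d 𝔱 L) : Prop :=
  ∀ τ ∈ x.support, τ = unitTree d 𝔱 L ∨ 0 < 𝔖.degPlus τ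

/-- The composition of function-like `x_1, …, x_m` with a smooth `F : ℝ^m → ℝ`, truncated at
homogeneity `γ`: the Taylor expansion `∑_k (D^k F(x̄) / k!) [x - x̄, …, x - x̄]`, where `x̄` are the
coefficients of `1`. -/
def compSmooth (γ : ℝ) {m : ℕ} (F : (Fin m → ℝ) → ℝ) (x : Fin m → TreeSpace d 𝔱 L) :
    TreeSpace d 𝔱 L :=
  ∑ᶠ k : ℕ, Finsupp.filter (fun τ => 𝔖.degPlus τ < γ)
    (((k.factorial : ℝ)⁻¹) • ∑ j : Fin k → Fin m,
      (iteratedFDeriv ℝ k F (fun l => x l (unitTree d 𝔱 L)) fun l => Pi.single (j l) 1) •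
        treeProd fun l => x (j l) - Finsupp.single (unitTree d 𝔱 L) (x (j l) (unitTree d 𝔱 L)))

end General

/-! ### The one-fold extension and the shift operator -/

/-- The extended types: noise types `Ξ`, their copies `Ξ̂`, and kernel types. -/
abbrev ExtTypes (Lm Lp : Type*) : Type _ := (Lm ⊕ Lm) ⊕ Lp

section Shift

variable {d : ℕ} {Lm Lp : Type*}

/-- The map that forgets hats. -/
def forgetHat : ExtTypes Lm Lp → Lm ⊕ Lp := Sum.map (Sum.elim id id) id

/-- The inclusion of the original types in the extended types. -/
def noHat : Lm ⊕ Lp → ExtTypes Lm Lp := Sum.map Sum.inl id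

/-- The type is of the form `Ξ̂`. -/
def IsHat : ExtTypes Lm Lp → Prop := Sum.elim (Sum.elim (fun _ => False) fun _ => True) fun _ => False

/-- The original types. -/
def baseSystem (s : Fin (d + 1) → ℕ) (hom : Lm ⊕ Lp → ℝ) : TypeSystem d (Lm ⊕ Lp) (Lm ⊕ Lp) :=
  ⟨s, hom, id⟩

/-- The extended types, with `|Ξ̂|_s = |Ξ|_s`. -/
def extSystem (s : Fin (d + 1) → ℕ) (hom : Lm ⊕ Lp → ℝ) :
    TypeSystem d (ExtTypes Lm Lp) (Lm ⊕ Lp) :=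
  ⟨s, hom, forgetHat⟩

theorem forgetHat_noHat (t : Lm ⊕ Lp) : forgetHat (noHat t) = t := by
  rcases t with t | t <;> rfl

/-- The extended rule: any noise type may be replaced by its hatted copy. -/
def extRule (R : Rule d (Lm ⊕ Lp)) : Rule d (ExtTypes Lm Lp) where
  R := Sum.elim (fun _ => {0}) fun t =>
    {N | N.map (fun p => (forgetHat p.1, p.2)) ∈ R.R (Sum.inr t)}
  nonempty := by
    rintro (t | t)
    · exact ⟨0, rfl⟩
    · obtain ⟨N, hN⟩ := R.nonempty (Sum.inr t)
      refine ⟨N.map fun p => (noHat p.1, p.2), ?_⟩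
      change Multiset.map (fun p : ExtTypes Lm Lp × MIdx d => (forgetHat p.1, p.2))
        (Multiset.map (fun p => (noHat p.1, p.2)) N) ∈ R.R (Sum.inr t)
      simpa [Multiset.map_map, Function.comp_def, forgetHat_noHat] using hN

variable [Fintype Lm] [Fintype Lp]

/-- `∑ r^{m(σ)} f(σ)` over the trees `σ = (τ, t̃)`, where `t̃` runs over all extended type maps on the
edges of `τ` that become the type map of `τ` when hats are forgotten, and `m(σ)` is the number of
hatted edges of `σ`. -/
def liftSum {M : Type*} [AddCommMonoid M] [Module ℝ M] (r : ℝ)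
    (f : DTree d (ExtTypes Lm Lp) (Lm ⊕ Lp) → M) (τ : DTree d (Lm ⊕ Lp) (Lm ⊕ Lp)) : M :=
  ∑ t : {t : τ.out.Edge → ExtTypes Lm Lp // ∀ a, forgetHat (t a) = τ.out.typ a},
    r ^ (Fintype.card {a // IsHat (t.1 a)}) • f (Quotient.mk _ (τ.out.retype t.1))

/-- The shift operator `𝒮_r` on trees. -/
def shift (r : ℝ) :
    TreeSpace d (Lm ⊕ Lp) (Lm ⊕ Lp) →ₗ[ℝ] TreeSpace d (ExtTypes Lm Lp) (Lm ⊕ Lp) :=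
  Finsupp.linearCombination ℝ (liftSum r fun σ => Finsupp.single σ 1)

/-- The multiplicative extension of `𝒮_r` to the negative algebra. -/
def shiftMinus (r : ℝ) (s : Fin (d + 1) → ℕ) (hom : Lm ⊕ Lp → ℝ) :
    (baseSystem s hom).NegAlg →ₐ[ℝ] (extSystem s hom).NegAlg :=
  MvPolynomial.aeval fun τ => liftSum r (extSystem s hom).negGen τ.1

/-- The multiplicative extension of `𝒮_r` to the positive algebra. The edge of the planted tree
`𝓙_t^k(τ)` at the root takes part in the sum over extended type maps. -/
def shiftPlus (r : ℝ) (s : Fin (d + 1) → ℕ) (hom : Lm ⊕ Lp → ℝ) :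
    (baseSystem s hom).PosAlg →ₐ[ℝ] (extSystem s hom).PosAlg :=
  MvPolynomial.aeval (Sum.elim (fun i => (extSystem s hom).posX i) fun p =>
    ∑ t : {t : ExtTypes Lm Lp // forgetHat t = p.1.1},
      (if IsHat t.1 then r else 1) •
        liftSum r (fun σ => (extSystem s hom).posGen (t.1, p.1.2.1, σ)) p.1.2.2)

/-- The embedding of characters of `𝒯_-^ex` into those of the extended algebra: trees that do not
come from the original `𝒯_-^ex` are sent to zero. -/
def extendChar (s : Fin (d + 1) → ℕ) (hom : Lm ⊕ Lp → ℝ) (R : Rule d (Lm ⊕ Lp))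
    (g : TMinus (baseSystem s hom) R →ₐ[ℝ] ℝ) :
    TMinus (extSystem s hom) (extRule R) →ₐ[ℝ] ℝ :=
  (MvPolynomial.aeval (R := ℝ) fun σ : {σ // (extSystem s hom).degMinus σ < 0} =>
    if h : ∃ τ : {τ // (baseSystem s hom).degMinus τ < 0}, τ.1 ∈ treesEx (baseSystem s hom) R ∧
        σ.1 = Quotient.mk _ (τ.1.out.retype fun a => noHat (τ.1.out.typ a)) then
      negEval (baseSystem s hom) R g (MvPolynomial.X h.choose) else 0).comp
    (TMinus (extSystem s hom) (extRule R)).val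

end Shift

end

noncomputable section

namespace PreTree

variable {d : ℕ} {𝔱 L : Type*}

/-! ### Invariance under isomorphism -/

/-! The weight $r^{m(\tilde{\mathfrak t})}$ is a product over edges. With the factor at an edge set
to zero when the new type does not lift the old one, $\mathcal S_r\tau$ becomes a sum over all maps
from the edges to the extended types (`liftSum_mk`, `shift_vec`). A sum of product weights over
functions on a disjoint union factors into sums over the pieces (`sum_weight_split`,
`sum_weight_sigma`, `sum_weight_unit`). So $\mathcal S_r$ respects every operation that merely
partitions the edges of a tree.

For $\Delta_-^{ex}$ the pieces are the edges of the extracted components and those of the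
contraction (`edgeSplitMinus`). For $\Delta_+^{ex}$ they are the edges of the subtree at the root,
the edges leaving it and the edges above these (`edgeSplitPlus`). Homogeneities and $\mathfrak o$
see types only through $q$, so the index sets, coefficients and truncations are the same for a tree
and all its lifts. This gives both coproduct identities summand by summand. The decorations
$\varepsilon_A$ range over an infinite set, but as the scaling is positive the truncations leave
finitely many of them (`finite_neg`, `finite_pos`), uniformly in the lift, and the sums may be
exchanged.

The sector property has three ingredients. Invariance follows from $\Gamma_\gamma\mathcal
S_r=\mathcal S_r(\mathrm{id}\otimes\gamma\mathcal S_r)\Delta_+^{ex}$ once $\mathcal T^{ex}$ is known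
to be stable under the left factors of $\Delta_+^{ex}$: a subtree at the root of a contraction is
again a contraction, of a subtree of the original tree (`rootComp_mem_treesExAt`). The grading is
respected because $|\cdot|_+$ does not see hats. The lower bound comes from $|\tau/A|_+=|\tau|_-$
and from summing the subcriticality inequality over the vertices of $\tau$.

Renormalisation commutes with $\mathcal S_r$ because the embedded character kills all trees with
hats, so that $g\circ\mathcal S_r=g$. Products and planting again split the edges, differentiation
does not touch them, and composition with smooth functions reduces to products, truncation and the
coefficient of $\mathbf 1$.

All operations on classes are defined through a chosen representative, hence the invariance
statements that come before everything else. -/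

theorem Deco.ext_of {T : PreTree d 𝔱 L} {A : Finset T.Edge} {N : Set T.V} {c c' : Deco T A N}
    (h : c.nA = c'.nA) (h' : c.ε = c'.ε) : c = c' := by
  cases c; cases c'; cases h; cases h'; rfl

theorem exists_iso_out (T : PreTree d 𝔱 L) :
    Nonempty (Iso (Quotient.out (Quotient.mk (setoid d 𝔱 L) T)) T) :=
  Quotient.exact (Quotient.out_eq (Quotient.mk (setoid d 𝔱 L) T))

theorem mk_eq_of_iso {S T : PreTree d 𝔱 L} (f : Iso S T) :
    (Quotient.mk (setoid d 𝔱 L) S : DTree d 𝔱 L) = Quotient.mk _ T :=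
  Quotient.sound ⟨f⟩

theorem vec_eq_of_iso {S T : PreTree d 𝔱 L} (f : Iso S T) : S.vec = T.vec := by
  unfold vec
  rw [mk_eq_of_iso f]

theorem vec_eq_single (T : PreTree d 𝔱 L) : T.vec = Finsupp.single (Quotient.mk _ T) 1 := rfl

theorem comp_par_val (T : PreTree d 𝔱 L) (A : Finset T.Edge) (ρ : T.V) (hρ : ¬ T.InEdges A ρ)
    (m : T.V → MIdx d) (v : (T.comp A ρ hρ m).V) :
    ((T.comp A ρ hρ m).par v).1 = T.stepDown A v.1 := by
  unfold stepDown
  by_cases h : T.InEdges A v.1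
  · rw [if_pos h]
    exact congrArg Subtype.val (dif_pos h)
  · rw [if_neg h]
    exact congrArg Subtype.val (dif_neg h)

namespace Iso

variable {S T : PreTree d 𝔱 L} (f : Iso S T)

theorem ne_root_iff (v : S.V) : v ≠ S.root ↔ f.toEquiv v ≠ T.root := by
  rw [← f.map_root, Ne, Ne, f.toEquiv.injective.eq_iff]

/-- The bijection between edges. -/
def edge : S.Edge ≃ T.Edge := f.toEquiv.subtypeEquiv f.ne_root_iff

@[simp] theorem edge_val (a : S.Edge) : (f.edge a).1 = f.toEquiv a.1 := rfl

@[simp] theorem typ_edge (a : S.Edge) : T.typ (f.edge a) = S.typ a := (f.map_typ a _ rfl).symm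

@[simp] theorem e_edge (a : S.Edge) : T.e (f.edge a) = S.e a := (f.map_e a _ rfl).symm

@[simp] theorem low_edge (a : S.Edge) : T.low (f.edge a) = f.toEquiv (S.low a) :=
  (f.map_par a.1).symm

variable {A : Finset S.Edge} {B : Finset T.Edge} (hB : ∀ a, f.edge a ∈ B ↔ a ∈ A)

include hB in
theorem inEdges_iff (v : S.V) : T.InEdges B (f.toEquiv v) ↔ S.InEdges A v := by
  constructor
  · rintro ⟨b, hb, h⟩
    obtain ⟨a, rfl⟩ := f.edge.surjective b
    exact ⟨a, (hB a).1 hb, f.toEquiv.injective h⟩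
  · rintro ⟨a, ha, rfl⟩
    exact ⟨f.edge a, (hB a).2 ha, rfl⟩

include hB in
theorem top_map (v : S.V) : T.top B (f.toEquiv v) = f.toEquiv (S.top A v) := by
  induction v using S.induct with
  | h0 => rw [S.top_root, f.map_root, T.top_root]
  | h1 v hv ih =>
    by_cases h : S.InEdges A v
    · rw [S.top_of_in h, T.top_of_in ((f.inEdges_iff hB v).2 h), ← f.map_par, ih]
    · rw [S.top_of_notIn h, T.top_of_notIn (fun h' => h ((f.inEdges_iff hB v).1 h'))]

include hB in
theorem verts_iff (v : S.V) : f.toEquiv v ∈ T.verts B ↔ v ∈ S.verts A := by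
  unfold verts
  simp only [Set.mem_ofPred_eq, f.inEdges_iff hB]
  refine or_congr Iff.rfl ?_
  constructor
  · rintro ⟨b, hb, h⟩
    obtain ⟨a, rfl⟩ := f.edge.surjective b
    rw [f.low_edge] at h
    exact ⟨a, (hB a).1 hb, f.toEquiv.injective h⟩
  · rintro ⟨a, ha, rfl⟩
    exact ⟨f.edge a, (hB a).2 ha, f.low_edge a⟩

include hB in
theorem isCompRoot_iff (v : S.V) : T.IsCompRoot B (f.toEquiv v) ↔ S.IsCompRoot A v := by
  unfold IsCompRoot
  rw [f.inEdges_iff hB, f.verts_iff hB]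

include hB in
theorem stepDown_map (v : S.V) : T.stepDown B (f.toEquiv v) = f.toEquiv (S.stepDown A v) := by
  unfold stepDown
  rw [f.inEdges_iff hB, apply_ite f.toEquiv, f.map_par]

/-- Connected components of corresponding subforests are isomorphic. -/
def comp {ρ : S.V} {σ : T.V} (hσ : f.toEquiv ρ = σ) (hρ : ¬ S.InEdges A ρ) (hσ' : ¬ T.InEdges B σ)
    {m : S.V → MIdx d} {m' : T.V → MIdx d} (hm : ∀ v, m' (f.toEquiv v) = m v) :
    Iso (S.comp A ρ hρ m) (T.comp B σ hσ' m') where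
  toEquiv := f.toEquiv.subtypeEquiv fun v => by
    rw [f.top_map hB, ← hσ, f.toEquiv.injective.eq_iff]
  map_root := Subtype.ext hσ
  map_par v := by
    apply Subtype.ext
    rw [comp_par_val]
    change f.toEquiv ((S.comp A ρ hρ m).par v).1 = _
    rw [comp_par_val]
    exact (f.stepDown_map hB v.1).symm
  map_typ v w h := f.map_typ _ _ (congrArg Subtype.val h)
  map_e v w h := f.map_e _ _ (congrArg Subtype.val h)
  map_n v := (hm v.1).symm
  map_o v := f.map_o v.1

/-- Transport of the decorations of a subforest. -/
def deco {N : Set S.V} {M : Set T.V} (hM : ∀ v, f.toEquiv v ∈ M ↔ v ∈ N) :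
    Deco S A N ≃ Deco T B M where
  toFun c :=
    { nA := fun v => c.nA (f.toEquiv.symm v)
      ε := fun a => c.ε (f.edge.symm a)
      nA_le := fun v => by
        have := c.nA_le (f.toEquiv.symm v)
        rwa [f.map_n, Equiv.apply_symm_apply] at this
      nA_supp := fun v hv => c.nA_supp _ (by rwa [← hM, Equiv.apply_symm_apply])
      ε_supp := fun a ha => c.ε_supp _ (by
        obtain ⟨a, rfl⟩ := f.edge.surjective a
        rw [hB, f.low_edge, hM] at ha
        rwa [Equiv.symm_apply_apply]) }
  invFun c :=
    { nA := fun v => c.nA (f.toEquiv v)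
      ε := fun a => c.ε (f.edge a)
      nA_le := fun v => by
        rw [f.map_n]
        exact c.nA_le _
      nA_supp := fun v hv => c.nA_supp _ (by rwa [hM])
      ε_supp := fun a ha => c.ε_supp _ (by rwa [hB, f.low_edge, hM]) }
  left_inv c := Deco.ext_of (by simp) (by simp)
  right_inv c := Deco.ext_of (by simp) (by simp)

section Deco

variable {N : Set S.V} {M : Set T.V} (hM : ∀ v, f.toEquiv v ∈ M ↔ v ∈ N)

@[simp] theorem deco_nA (c : Deco S A N) (v : S.V) : (f.deco hB hM c).nA (f.toEquiv v) = c.nA v := by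
  simp [deco]

@[simp] theorem deco_ε (c : Deco S A N) (a : S.Edge) : (f.deco hB hM c).ε (f.edge a) = c.ε a := by
  simp [deco]

theorem out_map {g : S.Edge → MIdx d} {h : T.Edge → MIdx d} (hg : ∀ a, h (f.edge a) = g a)
    (v : S.V) : T.out h (f.toEquiv v) = S.out g v := by
  unfold PreTree.out
  refine (Finset.sum_equiv f.edge (fun a => ?_) fun a _ => (hg a).symm).symm
  simp [f.low_edge]

theorem deco_extracted (c : Deco S A N) (v : S.V) :
    (f.deco hB hM c).extracted (f.toEquiv v) = c.extracted v := by
  unfold Deco.extracted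
  rw [f.deco_nA, f.out_map (f.deco_ε hB hM c)]

theorem deco_coef (c : Deco S A N) : (f.deco hB hM c).coef = c.coef := by
  unfold Deco.coef
  rw [← f.toEquiv.prod_comp, ← f.edge.prod_comp]
  simp [f.map_n]

/-- Contractions of corresponding subforests are isomorphic. -/
def contract (q : 𝔱 → L) (c : Deco S A N) :
    Iso (c.contract q) ((f.deco hB hM c).contract q) where
  toEquiv := f.toEquiv.subtypeEquiv fun v => by rw [f.inEdges_iff hB]
  map_root := Subtype.ext f.map_root
  map_par v := Subtype.ext <| by
    change f.toEquiv (S.top A (S.par v.1)) = T.top B (T.par (f.toEquiv v.1))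
    rw [← f.map_par, f.top_map hB]
  map_typ v w h := f.map_typ _ _ (congrArg Subtype.val h)
  map_e v w h := by
    have h' : f.edge ⟨v.1.1, fun h => v.2 (Subtype.ext h)⟩ =
      ⟨w.1.1, fun h => w.2 (Subtype.ext h)⟩ := Subtype.ext (congrArg Subtype.val h :)
    change S.e _ + c.ε _ = T.e _ + (f.deco hB hM c).ε _
    rw [← h', f.deco_ε, f.e_edge]
  map_n v := by
    refine Finset.sum_equiv f.toEquiv (fun u => ?_) fun u _ => ?_
    · rw [Finset.mem_filter_univ, Finset.mem_filter_univ, f.top_map hB]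
      exact f.toEquiv.injective.eq_iff.symm
    · rw [f.deco_nA, f.map_n]
  map_o v := by
    refine congrArg₂ (· + ·) (Finset.sum_equiv f.toEquiv (fun u => ?_) fun u _ => ?_)
      (Finset.sum_equiv f.edge (fun u => ?_) fun u _ => ?_)
    · rw [Finset.mem_filter_univ, Finset.mem_filter_univ, f.top_map hB]
      exact f.toEquiv.injective.eq_iff.symm
    · rw [f.deco_extracted, f.map_o]
    · rw [Finset.mem_filter, Finset.mem_filter, hB, f.edge_val, f.top_map hB]
      exact and_congr_right fun _ => f.toEquiv.injective.eq_iff.symm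
    · rw [f.typ_edge, f.e_edge]

end Deco

/-- The subtrees above corresponding edges are isomorphic. -/
def above (a : S.Edge) : Iso (S.above a) (T.above (f.edge a)) :=
  f.comp (A := Finset.univ.erase a) (B := Finset.univ.erase (f.edge a)) (by simp) rfl _ _
    fun v => (f.map_n v).symm

end Iso

end PreTree

namespace TypeSystem

open PreTree

variable {d : ℕ} {𝔱 L : Type*} (𝔖 : TypeSystem d 𝔱 L)

theorem preDegMinus_iso {S T : PreTree d 𝔱 L} (f : Iso S T) :
    𝔖.preDegMinus S = 𝔖.preDegMinus T := by
  unfold preDegMinus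
  rw [← f.edge.sum_comp, ← f.toEquiv.sum_comp]
  simp [f.map_n]

theorem preDegPlus_iso {S T : PreTree d 𝔱 L} (f : Iso S T) :
    𝔖.preDegPlus S = 𝔖.preDegPlus T := by
  unfold preDegPlus
  rw [𝔖.preDegMinus_iso f, ← f.toEquiv.sum_comp (fun v => 𝔖.odeg (T.o v))]
  simp [f.map_o]

theorem degMinus_mk (T : PreTree d 𝔱 L) : 𝔖.degMinus (Quotient.mk _ T) = 𝔖.preDegMinus T :=
  𝔖.preDegMinus_iso (exists_iso_out T).some

theorem degPlus_mk (T : PreTree d 𝔱 L) : 𝔖.degPlus (Quotient.mk _ T) = 𝔖.preDegPlus T :=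
  𝔖.preDegPlus_iso (exists_iso_out T).some

/-- The left factor of `Δ_-^ex`: the product of the extracted trees. -/
def negFactor {T : PreTree d 𝔱 L} {A : Finset T.Edge} (c : Deco T A (T.verts A)) : 𝔖.NegAlg :=
  ∏ ρ : {ρ : T.V // T.IsCompRoot A ρ}, 𝔖.negGen (Quotient.mk _ (T.comp A ρ.1 ρ.2.1 c.extracted))

/-- The left factor of `Δ_+^ex`: the subtree at the root. -/
def _root_.PreTree.Deco.trunk {T : PreTree d 𝔱 L} {A : Finset T.Edge} {N : Set T.V}
    (c : Deco T A N) : PreTree d 𝔱 L :=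
  T.comp A T.root (T.root_notIn A) c.extracted

/-- The right factor of `Δ_+^ex`. -/
def posFactor {T : PreTree d 𝔱 L} {A : Finset T.Edge} {N : Set T.V} (c : Deco T A N) : 𝔖.PosAlg :=
  (∏ v with v ∈ N, ∏ i, 𝔖.posX i ^ (T.n v i - c.nA v i)) *
    ∏ a with a ∉ A ∧ T.low a ∈ N,
      𝔖.posGen (T.typ a, T.e a + c.ε a, Quotient.mk _ (T.above a))

theorem preDeltaMinus_eq (T : PreTree d 𝔱 L) :
    𝔖.preDeltaMinus T = ∑ A : Finset T.Edge, ∑ᶠ c : Deco T A (T.verts A),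
      c.coef • (𝔖.negFactor c ⊗ₜ[ℝ] (c.contract 𝔖.q).vec) := rfl

/-- The vertices of the subtree at the root with edge set `A`. -/
def _root_.PreTree.rverts (T : PreTree d 𝔱 L) (A : Finset T.Edge) : Set T.V :=
  insert T.root (T.verts A)

theorem preDeltaPlus_eq (T : PreTree d 𝔱 L) :
    𝔖.preDeltaPlus T = ∑ A : {A : Finset T.Edge // T.IsTrunk A},
      ∑ᶠ c : Deco T A.1 (T.rverts A.1), c.coef • (c.trunk.vec ⊗ₜ[ℝ] 𝔖.posFactor c) := by
  unfold preDeltaPlus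
  refine Finset.sum_congr rfl fun A _ => finsum_congr fun c => ?_
  unfold posFactor rverts
  congr!

/-- An isomorphism induces bijections of edge sets, of decorations and of component roots, and
reindexing along the three matches the summands. This frees `deltaMinus` from its representative. -/
theorem preDeltaMinus_iso {S T : PreTree d 𝔱 L} (f : Iso S T) :
    𝔖.preDeltaMinus S = 𝔖.preDeltaMinus T := by
  rw [preDeltaMinus_eq, preDeltaMinus_eq, ← f.edge.finsetCongr.sum_comp]
  refine Finset.sum_congr rfl fun A _ => ?_
  have hB : ∀ a, f.edge a ∈ f.edge.finsetCongr A ↔ a ∈ A := by simp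
  have hM := f.verts_iff hB
  rw [← finsum_comp_equiv (f.deco hB hM)]
  refine finsum_congr fun c => ?_
  rw [f.deco_coef, vec_eq_of_iso (f.contract hB hM 𝔖.q c)]
  congr 2
  refine Fintype.prod_equiv (f.toEquiv.subtypeEquiv fun v => (f.isCompRoot_iff hB v).symm) _ _
    fun ρ => congrArg _ (mk_eq_of_iso (f.comp hB rfl _ _ (f.deco_extracted hB hM c)))

theorem posFactor_deco {S T : PreTree d 𝔱 L} (f : Iso S T) {A : Finset S.Edge} {B : Finset T.Edge}
    (hB : ∀ a, f.edge a ∈ B ↔ a ∈ A) {N : Set S.V} {M : Set T.V}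
    (hM : ∀ v, f.toEquiv v ∈ M ↔ v ∈ N) (c : Deco S A N) :
    𝔖.posFactor (f.deco hB hM c) = 𝔖.posFactor c := by
  refine congrArg₂ _ (Eq.symm ?_) (Eq.symm ?_)
  · refine Finset.prod_equiv f.toEquiv (fun v => ?_) fun v _ => ?_
    · rw [Finset.mem_filter_univ, Finset.mem_filter_univ, hM]
    · rw [f.deco_nA, f.map_n]
  · refine Finset.prod_equiv f.edge (fun a => ?_) fun a _ => ?_
    · rw [Finset.mem_filter_univ, Finset.mem_filter_univ, f.low_edge, hM, hB]
    · rw [f.deco_ε, f.typ_edge, f.e_edge, mk_eq_of_iso (f.above a)]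

theorem _root_.PreTree.Iso.rverts_iff {S T : PreTree d 𝔱 L} (f : Iso S T) {A : Finset S.Edge}
    {B : Finset T.Edge} (hB : ∀ a, f.edge a ∈ B ↔ a ∈ A) (v : S.V) :
    f.toEquiv v ∈ T.rverts B ↔ v ∈ S.rverts A := by
  unfold rverts
  rw [Set.mem_insert_iff, Set.mem_insert_iff, f.verts_iff hB, ← f.map_root,
    f.toEquiv.injective.eq_iff]

theorem preDeltaPlus_iso {S T : PreTree d 𝔱 L} (f : Iso S T) :
    𝔖.preDeltaPlus S = 𝔖.preDeltaPlus T := by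
  rw [preDeltaPlus_eq, preDeltaPlus_eq]
  have ht : ∀ A : Finset S.Edge, S.IsTrunk A ↔ T.IsTrunk (f.edge.finsetCongr A) := by
    intro A
    have hB : ∀ a, f.edge a ∈ f.edge.finsetCongr A ↔ a ∈ A := by simp
    unfold IsTrunk
    rw [← f.edge.forall_congr_right]
    simp only [hB, f.low_edge, f.inEdges_iff hB, ← f.map_root, f.toEquiv.injective.eq_iff]
  rw [← (f.edge.finsetCongr.subtypeEquiv ht).sum_comp]
  -- The inner sums agree for every edge set; being a trunk only selects the outer summands.
  suffices h : ∀ A : Finset S.Edge, ∑ᶠ c : Deco S A (S.rverts A),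
      c.coef • (c.trunk.vec ⊗ₜ[ℝ] 𝔖.posFactor c) =
      ∑ᶠ c : Deco T (f.edge.finsetCongr A) (T.rverts (f.edge.finsetCongr A)),
        c.coef • (c.trunk.vec ⊗ₜ[ℝ] 𝔖.posFactor c) from
    Finset.sum_congr rfl fun A _ => h A.1
  intro A
  have hB : ∀ a, f.edge a ∈ f.edge.finsetCongr A ↔ a ∈ A := by simp
  have hM := f.rverts_iff hB
  rw [← finsum_comp_equiv (f.deco hB hM)]
  refine finsum_congr fun c => ?_
  rw [f.deco_coef, posFactor_deco]
  congr 2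
  exact vec_eq_of_iso (f.comp hB f.map_root (S.root_notIn A) (T.root_notIn _)
    (f.deco_extracted hB hM c))

theorem deltaMinus_vec (T : PreTree d 𝔱 L) : 𝔖.deltaMinus T.vec = 𝔖.preDeltaMinus T := by
  unfold deltaMinus
  rw [vec_eq_single, Finsupp.linearCombination_single, one_smul]
  exact 𝔖.preDeltaMinus_iso (exists_iso_out T).some

theorem deltaPlus_vec (T : PreTree d 𝔱 L) : 𝔖.deltaPlus T.vec = 𝔖.preDeltaPlus T := by
  unfold deltaPlus
  rw [vec_eq_single, Finsupp.linearCombination_single, one_smul]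
  exact 𝔖.preDeltaPlus_iso (exists_iso_out T).some

end TypeSystem

namespace PreTree

variable {d : ℕ} {𝔱 𝔱' 𝔱'' L : Type*}

/-! ### Change of types -/

/-- An isomorphism that respects the new types. -/
def Iso.retype {S T : PreTree d 𝔱 L} (f : Iso S T) {t : S.Edge → 𝔱'} {u : T.Edge → 𝔱'}
    (h : ∀ a, u (f.edge a) = t a) : Iso (S.retype t) (T.retype u) where
  toEquiv := f.toEquiv
  map_root := f.map_root
  map_par := f.map_par
  map_typ v w hvw := by
    obtain rfl : f.edge v = w := Subtype.ext hvw
    exact (h v).symm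
  map_e := f.map_e
  map_n := f.map_n
  map_o := f.map_o

/-- Decorations of a subforest do not depend on the types. -/
def Deco.retypeEquiv (T : PreTree d 𝔱 L) (t : T.Edge → 𝔱') (A : Finset T.Edge) (N : Set T.V) :
    Deco T A N ≃ Deco (T.retype t) A N where
  toFun c := ⟨c.nA, c.ε, c.nA_le, c.nA_supp, c.ε_supp⟩
  invFun c := ⟨c.nA, c.ε, c.nA_le, c.nA_supp, c.ε_supp⟩
  left_inv _ := rfl
  right_inv _ := rfl

variable {T : PreTree d 𝔱 L} {A : Finset T.Edge} {N : Set T.V}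

/-- The decorations of a subforest, on the tree with other types. -/
abbrev Deco.retype (c : Deco T A N) (t : T.Edge → 𝔱') : Deco (T.retype t) A N :=
  Deco.retypeEquiv T t A N c

/-- The edge of the tree that becomes an edge of a component. -/
def compEdge (T : PreTree d 𝔱 L) {A : Finset T.Edge} {ρ : T.V} {hρ : ¬ T.InEdges A ρ}
    {m : T.V → MIdx d} (b : (T.comp A ρ hρ m).Edge) : T.Edge :=
  ⟨b.1.1, T.ne_root_of_comp b.1.2 fun h => b.2 (Subtype.ext h)⟩

/-- The edge of the tree that becomes an edge of the contracted tree. -/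
def contractEdge {q : 𝔱 → L} (c : Deco T A N) (b : (c.contract q).Edge) : T.Edge :=
  ⟨b.1.1, fun h => b.2 (Subtype.ext h)⟩

/-- Contraction commutes with a change of types that preserves the original types. -/
def Deco.contractRetype (c : Deco T A N) (t : T.Edge → 𝔱') {q : 𝔱 → L} {q' : 𝔱' → L}
    (h : ∀ a, q' (t a) = q (T.typ a)) :
    Iso ((c.contract q).retype fun b => t (contractEdge c b)) ((c.retype t).contract q') where
  toEquiv := Equiv.refl _
  map_root := rfl
  map_par _ := rfl
  map_typ v w hvw := by
    obtain rfl : v = w := Subtype.ext hvw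
    rfl
  map_e v w hvw := by
    obtain rfl : v = w := Subtype.ext hvw
    rfl
  map_n _ := rfl
  map_o v := by
    -- Types of contracted edges enter `𝔬` only through `q`, so agreement after `q` suffices.
    refine congrArg₂ (· + ·) rfl (Finset.sum_congr rfl fun a _ => ?_)
    change _ = (_, Finsupp.single (q' (t a)) 1)
    rw [h]
    rfl

end PreTree

/-! ### Weighted sums over extended type maps -/

section Lift

open PreTree

variable {d : ℕ} {Lm Lp : Type*}

/-- Trees with the original types. -/
abbrev BaseTree (d : ℕ) (Lm Lp : Type*) : Type _ := PreTree d (Lm ⊕ Lp) (Lm ⊕ Lp)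

/-- The weight of replacing the type `l` by the extended type `x`. -/
def hatWeight (r : ℝ) (l : Lm ⊕ Lp) (x : ExtTypes Lm Lp) : ℝ :=
  if forgetHat x = l then if IsHat x then r else 1 else 0

/-- The weight of an extended type map. -/
def liftWeight (r : ℝ) (T : BaseTree d Lm Lp) (t : T.Edge → ExtTypes Lm Lp) : ℝ :=
  ∏ a, hatWeight r (T.typ a) (t a)

theorem liftWeight_eq_zero (r : ℝ) {T : BaseTree d Lm Lp} {t : T.Edge → ExtTypes Lm Lp}
    (h : ¬ ∀ a, forgetHat (t a) = T.typ a) : liftWeight r T t = 0 := by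
  push Not at h
  obtain ⟨a, ha⟩ := h
  exact Finset.prod_eq_zero (Finset.mem_univ a) (if_neg ha)

theorem not_isHat_noHat (x : Lm ⊕ Lp) : ¬ IsHat (noHat x) := by
  rcases x with x | x <;> exact id

theorem eq_noHat {x : ExtTypes Lm Lp} (h : ¬ IsHat x) : x = noHat (forgetHat x) := by
  rcases x with (x | x) | x
  · rfl
  · exact absurd trivial h
  · rfl

theorem liftWeight_noHat (r : ℝ) (T : BaseTree d Lm Lp) :
    liftWeight r T (fun a => noHat (T.typ a)) = 1 :=
  Finset.prod_eq_one fun a _ => by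
    rw [hatWeight, if_pos (forgetHat_noHat _), if_neg (not_isHat_noHat _)]

/-- A type contributes to the homogeneity only through `q`. This is why all truncations treat a tree
and its lifts alike. -/
theorem preDegMinus_retype (s : Fin (d + 1) → ℕ) (hom : Lm ⊕ Lp → ℝ) (T : BaseTree d Lm Lp)
    {t : T.Edge → ExtTypes Lm Lp} (h : ∀ a, forgetHat (t a) = T.typ a) :
    (extSystem s hom).preDegMinus (T.retype t) = (baseSystem s hom).preDegMinus T := by
  unfold TypeSystem.preDegMinus
  refine congrArg₂ (· + ·) (Finset.sum_congr rfl fun a _ => ?_) rfl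
  exact congrArg (fun l => hom l - (baseSystem s hom).mdeg (T.e a)) (h a)

theorem preDegPlus_retype (s : Fin (d + 1) → ℕ) (hom : Lm ⊕ Lp → ℝ) (T : BaseTree d Lm Lp)
    {t : T.Edge → ExtTypes Lm Lp} (h : ∀ a, forgetHat (t a) = T.typ a) :
    (extSystem s hom).preDegPlus (T.retype t) = (baseSystem s hom).preDegPlus T :=
  congrArg₂ (· + ·) (preDegMinus_retype s hom T h) rfl

/-- Forgetting hats. -/
def forgetTree : DTree d (ExtTypes Lm Lp) (Lm ⊕ Lp) → DTree d (Lm ⊕ Lp) (Lm ⊕ Lp) :=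
  Quotient.map (fun T => T.retype fun a => forgetHat (T.typ a)) fun S T ⟨f⟩ =>
    ⟨f.retype fun a => by rw [f.typ_edge]⟩

/-- Regarding a tree with original types as a tree with extended types. -/
def hatless : DTree d (Lm ⊕ Lp) (Lm ⊕ Lp) → DTree d (ExtTypes Lm Lp) (Lm ⊕ Lp) :=
  Quotient.map (fun T => T.retype fun a => noHat (T.typ a)) fun S T ⟨f⟩ =>
    ⟨f.retype fun a => by rw [f.typ_edge]⟩

theorem hatless_mk (T : BaseTree d Lm Lp) :
    hatless (Quotient.mk _ T) = Quotient.mk _ (T.retype fun a => noHat (T.typ a)) := rfl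

theorem forgetTree_retype (T : BaseTree d Lm Lp) {t : T.Edge → ExtTypes Lm Lp}
    (h : ∀ a, forgetHat (t a) = T.typ a) :
    forgetTree (Quotient.mk _ (T.retype t)) = Quotient.mk _ T := by
  change Quotient.mk _ (T.retype fun a => forgetHat (t a)) = _
  rw [funext h]
  rfl

theorem forgetTree_hatless (τ : DTree d (Lm ⊕ Lp) (Lm ⊕ Lp)) : forgetTree (hatless τ) = τ := by
  induction τ using Quotient.inductionOn with
  | h T => exact forgetTree_retype T fun a => forgetHat_noHat _

/-- An isomorphism preserves types, and a type without hat is determined by its image under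
`forgetHat`. Hence exactly one lift of a tree lies in the range of `hatless`. -/
theorem eq_noHat_of_mk_eq_hatless {T : BaseTree d Lm Lp} {t : T.Edge → ExtTypes Lm Lp}
    (h : ∀ a, forgetHat (t a) = T.typ a) {τ : DTree d (Lm ⊕ Lp) (Lm ⊕ Lp)}
    (hτ : Quotient.mk _ (T.retype t) = hatless τ) : t = fun a => noHat (T.typ a) := by
  induction τ using Quotient.inductionOn with
  | h S =>
    obtain ⟨f⟩ := Quotient.exact hτ
    funext a
    have h1 : noHat (S.typ (f.edge a)) = t a := f.typ_edge a
    have h2 : ¬ IsHat (t a) := h1 ▸ not_isHat_noHat _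
    rw [eq_noHat h2, h]

section

variable [Fintype Lm] [Fintype Lp] {M : Type*} [AddCommMonoid M] [Module ℝ M]

theorem sum_liftWeight_iso (r : ℝ) (F : DTree d (ExtTypes Lm Lp) (Lm ⊕ Lp) → M)
    {S T : BaseTree d Lm Lp} (f : Iso S T) :
    ∑ t : S.Edge → ExtTypes Lm Lp, liftWeight r S t • F (Quotient.mk _ (S.retype t)) =
      ∑ t : T.Edge → ExtTypes Lm Lp, liftWeight r T t • F (Quotient.mk _ (T.retype t)) := by
  refine Fintype.sum_equiv (f.edge.arrowCongr (Equiv.refl _)) _ _ fun t => ?_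
  have h : ∀ a, (f.edge.arrowCongr (Equiv.refl _)) t (f.edge a) = t a := by simp
  rw [mk_eq_of_iso (f.retype h)]
  congr 1
  unfold liftWeight
  rw [← f.edge.prod_comp]
  simp only [h, f.typ_edge]

/-- Maps that are not lifts have weight zero, so the sum may run over all functions on the edges.
This, together with the product form of the weight, is what makes the sum factor over disjoint
unions of edges; the representative becomes arbitrary as well. -/
theorem liftSum_mk (r : ℝ) (F : DTree d (ExtTypes Lm Lp) (Lm ⊕ Lp) → M) (T : BaseTree d Lm Lp) :
    liftSum r F (Quotient.mk _ T) =
      ∑ t : T.Edge → ExtTypes Lm Lp, liftWeight r T t • F (Quotient.mk _ (T.retype t)) := by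
  rw [← sum_liftWeight_iso r F (exists_iso_out T).some]
  set S := Quotient.out (Quotient.mk (setoid d (Lm ⊕ Lp) (Lm ⊕ Lp)) T)
  change ∑ t : {t : S.Edge → ExtTypes Lm Lp // ∀ a, forgetHat (t a) = S.typ a}, _ = _
  rw [← Finset.sum_filter_of_ne (p := fun t : S.Edge → ExtTypes Lm Lp =>
      ∀ a, forgetHat (t a) = S.typ a), Finset.sum_subtype _ (p := fun t : S.Edge → ExtTypes Lm Lp =>
      ∀ a, forgetHat (t a) = S.typ a) (by simp)]
  · refine Finset.sum_congr rfl fun t _ => ?_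
    congr 1
    unfold liftWeight hatWeight
    simp only [t.2, if_true]
    -- Hatted edges contribute `r` and the others `1`, so the product is `r` to the number of hatted
    -- edges.
    rw [Finset.prod_ite, Finset.prod_const, Finset.prod_const_one, mul_one, Fintype.card_subtype]
  · intro t _ ht
    by_contra h
    rw [liftWeight_eq_zero r h, zero_smul] at ht
    exact ht rfl

theorem shift_vec (r : ℝ) (T : BaseTree d Lm Lp) :
    shift r T.vec = ∑ t : T.Edge → ExtTypes Lm Lp, liftWeight r T t • (T.retype t).vec := by
  rw [vec_eq_single]
  unfold shift
  rw [Finsupp.linearCombination_single, one_smul, liftSum_mk]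
  rfl

theorem sum_liftWeight_eq_zero {r : ℝ} {T : BaseTree d Lm Lp}
    {F : (T.Edge → ExtTypes Lm Lp) → M} (h : ∀ t, (∀ a, forgetHat (t a) = T.typ a) → F t = 0) :
    ∑ t, liftWeight r T t • F t = 0 :=
  Finset.sum_eq_zero fun t _ => by
    by_cases ht : ∀ a, forgetHat (t a) = T.typ a
    · rw [h t ht, smul_zero]
    · rw [liftWeight_eq_zero r ht, zero_smul]

theorem sum_liftWeight_congr {r : ℝ} {T : BaseTree d Lm Lp}
    {F G : (T.Edge → ExtTypes Lm Lp) → M}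
    (h : ∀ t, (∀ a, forgetHat (t a) = T.typ a) → F t = G t) :
    ∑ t, liftWeight r T t • F t = ∑ t, liftWeight r T t • G t :=
  Finset.sum_congr rfl fun t _ => by
    by_cases ht : ∀ a, forgetHat (t a) = T.typ a
    · rw [h t ht]
    · rw [liftWeight_eq_zero r ht, zero_smul, zero_smul]

/-- No negativity is required of the tree: lifting preserves the homogeneity, so a truncated tree
gives zero on both sides. -/
theorem shiftMinus_negGen (r : ℝ) (s : Fin (d + 1) → ℕ) (hom : Lm ⊕ Lp → ℝ)
    (T : BaseTree d Lm Lp) :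
    shiftMinus r s hom ((baseSystem s hom).negGen (Quotient.mk _ T)) =
      ∑ t : T.Edge → ExtTypes Lm Lp,
        liftWeight r T t • (extSystem s hom).negGen (Quotient.mk _ (T.retype t)) := by
  by_cases h : (baseSystem s hom).degMinus (Quotient.mk _ T) < 0
  · rw [TypeSystem.negGen, dif_pos h]
    unfold shiftMinus
    rw [MvPolynomial.aeval_X, liftSum_mk]
  · rw [TypeSystem.negGen, dif_neg h, map_zero]
    refine (sum_liftWeight_eq_zero fun t ht => dif_neg ?_).symm
    rwa [TypeSystem.degMinus_mk, preDegMinus_retype s hom T ht, ← TypeSystem.degMinus_mk]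

/-- The planting edge is not an edge of `T`, so its new type `x` needs a sum of its own. -/
theorem shiftPlus_posGen (r : ℝ) (s : Fin (d + 1) → ℕ) (hom : Lm ⊕ Lp → ℝ) (l : Lm ⊕ Lp)
    (k : MIdx d) (T : BaseTree d Lm Lp) :
    shiftPlus r s hom ((baseSystem s hom).posGen (l, k, Quotient.mk _ T)) =
      ∑ x : ExtTypes Lm Lp, hatWeight r l x • ∑ t : T.Edge → ExtTypes Lm Lp,
        liftWeight r T t • (extSystem s hom).posGen (x, k, Quotient.mk _ (T.retype t)) := by
  by_cases h : 0 < (baseSystem s hom).degPlanted (l, k, Quotient.mk _ T)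
  · rw [TypeSystem.posGen, dif_pos h]
    unfold shiftPlus
    rw [MvPolynomial.aeval_X]
    simp only [Sum.elim_inr, liftSum_mk, hatWeight, ite_smul, zero_smul]
    rw [← Finset.sum_filter, Finset.sum_subtype _ (p := fun x => forgetHat x = l) (by simp)]
  · rw [TypeSystem.posGen, dif_neg h, map_zero]
    refine (Finset.sum_eq_zero fun x _ => ?_).symm
    by_cases hx : forgetHat x = l
    · rw [sum_liftWeight_eq_zero, smul_zero]
      refine fun t ht => dif_neg ?_
      subst hx
      unfold TypeSystem.degPlanted at h ⊢
      rwa [TypeSystem.degPlus_mk, preDegPlus_retype s hom T ht, ← TypeSystem.degPlus_mk]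
    · rw [hatWeight, if_neg hx, zero_smul]

/-- The lift without hats has weight `1` whatever `r` is, including `0`, so the tree can be read off
from it. Injectivity will let `shift` pass through a `finsum` whose support is not known to be
finite. -/
theorem shift_injective (r : ℝ) : Function.Injective (shift (d := d) (Lm := Lm) (Lp := Lp) r) := by
  -- The left inverse discards all trees with hats and restores the original types on the rest.
  let Q : TreeSpace d (ExtTypes Lm Lp) (Lm ⊕ Lp) →ₗ[ℝ] TreeSpace d (Lm ⊕ Lp) (Lm ⊕ Lp) :=
    Finsupp.linearCombination ℝ fun σ =>
      if σ = hatless (forgetTree σ) then Finsupp.single (forgetTree σ) 1 else 0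
  suffices h : Q ∘ₗ shift r = LinearMap.id from
    Function.LeftInverse.injective (g := Q) fun x => LinearMap.congr_fun h x
  refine Finsupp.lhom_ext' fun τ => LinearMap.ext_ring ?_
  induction τ using Quotient.inductionOn with
  | h T =>
    change Q (shift r T.vec) = T.vec
    rw [shift_vec, map_sum]
    have hQ : ∀ t : T.Edge → ExtTypes Lm Lp, Q (T.retype t).vec =
        if (Quotient.mk _ (T.retype t) : DTree d _ _) = hatless (forgetTree (Quotient.mk _ (T.retype t)))
          then Finsupp.single (forgetTree (Quotient.mk _ (T.retype t))) 1 else 0 := fun t => by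
      rw [vec_eq_single, Finsupp.linearCombination_single, one_smul]
    have h0 : ∀ a, forgetHat (noHat (T.typ a)) = T.typ a := fun a => forgetHat_noHat _
    rw [Finset.sum_eq_single fun a => noHat (T.typ a)]
    · rw [map_smul, liftWeight_noHat, one_smul, hQ, forgetTree_retype T h0]
      exact if_pos rfl
    · intro t _ ht
      rw [map_smul, hQ]
      by_cases h : ∀ a, forgetHat (t a) = T.typ a
      · rw [if_neg fun h' => ht (eq_noHat_of_mk_eq_hatless h h'), smul_zero]
      · rw [liftWeight_eq_zero r h, zero_smul]
    · exact fun h => absurd (Finset.mem_univ _) h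

end

end Lift

/-! ### Sums over functions on a disjoint union -/

/-- A function on a disjoint union is a pair of functions, its product weight splits accordingly,
and bilinearity of `B` separates the two sums. `B` will be a tensor product or the tree product. The
`Fintype` instances of the function spaces are arguments, so that the statement fits whichever
instance occurs. -/
theorem sum_weight_split {E E₁ E₂ X M₁ M₂ M₃ : Type*} [Fintype E] [Fintype E₁] [Fintype E₂]
    [Fintype (E → X)] [Fintype (E₁ → X)] [Fintype (E₂ → X)]
    [AddCommMonoid M₁] [AddCommMonoid M₂] [AddCommMonoid M₃] [Module ℝ M₁] [Module ℝ M₂]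
    [Module ℝ M₃] (e : E₁ ⊕ E₂ ≃ E) (w : E → X → ℝ) (B : M₁ →ₗ[ℝ] M₂ →ₗ[ℝ] M₃)
    (F : (E₁ → X) → M₁) (G : (E₂ → X) → M₂) :
    ∑ t : E → X, (∏ a, w a (t a)) •
        B (F fun b => t (e (Sum.inl b))) (G fun b => t (e (Sum.inr b))) =
      B (∑ u : E₁ → X, (∏ b, w (e (Sum.inl b)) (u b)) • F u)
        (∑ u : E₂ → X, (∏ b, w (e (Sum.inr b)) (u b)) • G u) := by
  rw [map_sum]
  simp only [map_sum, LinearMap.sum_apply]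
  rw [Finset.sum_comm, ← Fintype.sum_prod_type', ← (((e.arrowCongr (Equiv.refl X)).symm.trans
    (Equiv.sumArrowEquivProdArrow E₁ E₂ X))).sum_comp]
  refine Finset.sum_congr rfl fun t _ => ?_
  rw [← e.prod_comp, Fintype.prod_sum_type, map_smul, map_smul, LinearMap.smul_apply, smul_smul,
    mul_comm]
  rfl

/-- The version for a finite family of pieces: expanding a product of sums gives a sum over families
of functions, which by currying are functions on the sigma type. -/
theorem sum_weight_sigma {J X R : Type*} {E : J → Type*} [Fintype J] [∀ j, Fintype (E j)]
    [Fintype ((Σ j, E j) → X)] [∀ j, Fintype (E j → X)] [CommSemiring R] [Algebra ℝ R] (w : (Σ j, E j) → X → ℝ) (F : ∀ j, (E j → X) → R) :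
    ∑ t : (Σ j, E j) → X, (∏ a, w a (t a)) • ∏ j, F j (fun b => t ⟨j, b⟩) =
      ∏ j, ∑ u : E j → X, (∏ b, w ⟨j, b⟩ (u b)) • F j u := by
  rw [Finset.prod_univ_sum, Fintype.piFinset_univ, ← (Equiv.piCurry fun (j : J) (_ : E j) => X).sum_comp]
  refine Finset.sum_congr rfl fun t _ => ?_
  rw [Finset.prod_smul, Fintype.prod_sigma]
  rfl

/-- Separates one distinguished edge, the one on which a tree is planted. `H` may depend on both
arguments jointly, so the sums become nested instead of factoring. -/
theorem sum_weight_unit {E X M : Type*} [Fintype E] [Fintype X] [Fintype (E → X)]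
    [Fintype (Unit ⊕ E → X)] [AddCommMonoid M] [Module ℝ M]
    (w : Unit ⊕ E → X → ℝ) (H : X → (E → X) → M) :
    ∑ u : Unit ⊕ E → X, (∏ b, w b (u b)) • H (u (Sum.inl ())) (fun b => u (Sum.inr b)) =
      ∑ x, w (Sum.inl ()) x • ∑ v : E → X, (∏ b, w (Sum.inr b) (v b)) • H x v := by
  simp only [Finset.smul_sum]
  rw [← Fintype.sum_prod_type', ← ((Equiv.sumArrowEquivProdArrow Unit E X).trans
    ((Equiv.funUnique Unit X).prodCongr (Equiv.refl _))).sum_comp]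
  refine Finset.sum_congr rfl fun u _ => ?_
  rw [Fintype.prod_sum_type, Fintype.prod_unique, smul_smul]
  rfl

theorem left_ne_zero_of_smul_tmul {M N : Type*} [AddCommMonoid M] [AddCommMonoid N] [Module ℝ M]
    [Module ℝ N] {a : ℝ} {x : M} {y : N} (h : a • (x ⊗ₜ[ℝ] y) ≠ 0) : x ≠ 0 := by
  rintro rfl
  rw [TensorProduct.zero_tmul, smul_zero] at h
  exact h rfl

theorem right_ne_zero_of_smul_tmul {M N : Type*} [AddCommMonoid M] [AddCommMonoid N] [Module ℝ M]
    [Module ℝ N] {a : ℝ} {x : M} {y : N} (h : a • (x ⊗ₜ[ℝ] y) ≠ 0) : y ≠ 0 := by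
  rintro rfl
  rw [TensorProduct.tmul_zero, smul_zero] at h
  exact h rfl

namespace PreTree

variable {d : ℕ} {𝔱 L : Type*} {T : PreTree d 𝔱 L}

/-! ### Edges of a tree, of its extracted components and of the contraction -/

theorem inEdges_iff_mem {A : Finset T.Edge} (a : T.Edge) : T.InEdges A a.1 ↔ a ∈ A :=
  ⟨fun ⟨_, hb, h⟩ => Subtype.ext h ▸ hb, fun h => ⟨a, h, rfl⟩⟩

theorem top_mem_verts {A : Finset T.Edge} {v : T.V} (h : v ∈ T.verts A) : T.top A v ∈ T.verts A := by
  induction v using T.induct with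
  | h0 => rwa [T.top_root]
  | h1 v hv ih =>
    by_cases hA : T.InEdges A v
    · rw [T.top_of_in hA]
      exact ih (Or.inr ⟨⟨v, hv⟩, (inEdges_iff_mem ⟨v, hv⟩).1 hA, rfl⟩)
    · rwa [T.top_of_notIn hA]

theorem isCompRoot_top {A : Finset T.Edge} {v : T.V} (h : v ∈ T.verts A) :
    T.IsCompRoot A (T.top A v) :=
  ⟨T.top_notIn A v, top_mem_verts h⟩

theorem inEdges_of_top_ne {A : Finset T.Edge} {v : T.V} (h : T.top A v ≠ v) : T.InEdges A v := by
  by_contra h'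
  exact h (T.top_of_notIn h')

theorem top_ne_of_inEdges {A : Finset T.Edge} {v : T.V} (h : T.InEdges A v) : T.top A v ≠ v :=
  fun h' => T.top_notIn A v (h'.symm ▸ h)

theorem compEdge_mem {A : Finset T.Edge} {ρ : T.V} {hρ : ¬ T.InEdges A ρ} {m : T.V → MIdx d}
    (b : (T.comp A ρ hρ m).Edge) : T.compEdge b ∈ A := by
  rw [← inEdges_iff_mem]
  refine inEdges_of_top_ne fun h => b.2 (Subtype.ext ?_)
  exact h.symm.trans b.1.2

theorem top_compEdge {A : Finset T.Edge} {ρ : T.V} {hρ : ¬ T.InEdges A ρ} {m : T.V → MIdx d}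
    (b : (T.comp A ρ hρ m).Edge) : T.top A (T.compEdge b).1 = ρ := b.1.2

theorem exists_compEdge {A : Finset T.Edge} {ρ : T.V} (hρ : ¬ T.InEdges A ρ) (m : T.V → MIdx d)
    {a : T.Edge} (ha : a ∈ A) (h : T.top A a.1 = ρ) :
    ∃ b : (T.comp A ρ hρ m).Edge, T.compEdge b = a := by
  refine ⟨⟨⟨a.1, h⟩, fun h' => top_ne_of_inEdges ((inEdges_iff_mem a).2 ha) ?_⟩, rfl⟩
  exact h.trans (congrArg Subtype.val h').symm

theorem compEdge_injective {A : Finset T.Edge} {ρ : T.V} {hρ : ¬ T.InEdges A ρ}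
    {m : T.V → MIdx d} : Function.Injective (T.compEdge (A := A) (hρ := hρ) (m := m)) :=
  fun _ _ h => Subtype.ext (Subtype.ext (congrArg (fun a => a.1) h))

theorem contractEdge_notMem {A : Finset T.Edge} {N : Set T.V} {c : Deco T A N} {q : 𝔱 → L}
    (b : (c.contract q).Edge) : contractEdge c b ∉ A := by
  rw [← inEdges_iff_mem]
  exact b.1.2

theorem contractEdge_injective {A : Finset T.Edge} {N : Set T.V} {c : Deco T A N} {q : 𝔱 → L} :
    Function.Injective (contractEdge (q := q) c) :=
  fun _ _ h => Subtype.ext (Subtype.ext (congrArg (fun a => a.1) h))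

theorem exists_contractEdge {A : Finset T.Edge} {N : Set T.V} (c : Deco T A N) (q : 𝔱 → L)
    {a : T.Edge} (ha : a ∉ A) : ∃ b : (c.contract q).Edge, contractEdge c b = a :=
  ⟨⟨⟨a.1, by rwa [inEdges_iff_mem]⟩, fun h => a.2 (congrArg Subtype.val h)⟩, rfl⟩

/-- The edges of a tree are those of the extracted components and those of the contraction. -/
def edgeSplitMinus {A : Finset T.Edge} (c : Deco T A (T.verts A)) (q : 𝔱 → L) :
    (Σ ρ : {ρ : T.V // T.IsCompRoot A ρ}, (T.comp A ρ.1 ρ.2.1 c.extracted).Edge) ⊕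
      (c.contract q).Edge ≃ T.Edge :=
  Equiv.ofBijective (Sum.elim (fun x => T.compEdge x.2) (contractEdge c)) <| by
    constructor
    · refine Function.Injective.sumElim ?_ contractEdge_injective ?_
      · rintro ⟨⟨ρ, hρ⟩, b⟩ ⟨⟨σ, hσ⟩, b'⟩ h
        -- The component of an edge is recovered as the `top` of its upper end.
        obtain rfl : ρ = σ := (top_compEdge b).symm.trans
          ((congrArg (fun a => T.top A a.1) h).trans (top_compEdge b'))
        obtain rfl : b = b' := compEdge_injective h
        rfl
      · rintro ⟨ρ, b⟩ b' h
        exact contractEdge_notMem b' (h ▸ compEdge_mem b)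
    · intro a
      by_cases ha : a ∈ A
      · have hr := isCompRoot_top (T := T) (Or.inl ((inEdges_iff_mem a).2 ha))
        obtain ⟨b, hb⟩ := exists_compEdge hr.1 c.extracted ha rfl
        exact ⟨Sum.inl ⟨⟨_, hr⟩, b⟩, hb⟩
      · obtain ⟨b, hb⟩ := exists_contractEdge c q ha
        exact ⟨Sum.inr b, hb⟩

/-! ### Finiteness of the coproducts -/

/-- `nA` is already bounded by the node decoration of the tree, so only a bound on `ε` is missing.
-/
theorem Deco.finite_of_le {A : Finset T.Edge} {N : Set T.V} (K : T.Edge → MIdx d) :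
    {c : Deco T A N | c.ε ≤ K}.Finite := by
  refine Set.Finite.of_injOn (f := fun c => (c.nA, c.ε)) (t := Set.Iic T.n ×ˢ Set.Iic K) ?_ ?_
    ((Set.finite_Iic _).prod (Set.finite_Iic _))
  · exact fun c hc => ⟨c.nA_le, hc⟩
  · exact fun c _ c' _ h => Deco.ext_of (congrArg Prod.fst h) (congrArg Prod.snd h)

theorem le_out (f : T.Edge → MIdx d) (a : T.Edge) : f a ≤ T.out f (T.low a) := by
  unfold out
  exact Finset.single_le_sum (f := f) (fun _ _ => zero_le) (by simp)

end PreTree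

namespace TypeSystem

open PreTree

variable {d : ℕ} {𝔱 L : Type*} (𝔖 : TypeSystem d 𝔱 L)

theorem mdeg_nonneg (k : MIdx d) : 0 ≤ 𝔖.mdeg k := by
  unfold mdeg
  positivity

theorem mdeg_add (k l : MIdx d) : 𝔖.mdeg (k + l) = 𝔖.mdeg k + 𝔖.mdeg l := by
  unfold mdeg
  rw [← Finset.sum_add_distrib]
  refine Finset.sum_congr rfl fun i _ => ?_
  rw [Pi.add_apply]
  push_cast
  ring

theorem mdeg_sum {ι : Type*} (I : Finset ι) (f : ι → MIdx d) :
    𝔖.mdeg (∑ i ∈ I, f i) = ∑ i ∈ I, 𝔖.mdeg (f i) := by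
  induction I using Finset.induction_on with
  | empty => simp [mdeg]
  | insert i I hi ih => rw [Finset.sum_insert hi, Finset.sum_insert hi, mdeg_add, ih]

variable {𝔖} (hs : ∀ i, 0 < 𝔖.s i)

include hs in
-- Positivity of the scaling enters here: a bound on the scaled degree bounds every entry, so
-- homogeneity controls `ε`.
theorem le_mdeg (k : MIdx d) (i : Fin (d + 1)) : (k i : ℝ) ≤ 𝔖.mdeg k := by
  unfold mdeg
  refine le_trans ?_ (Finset.single_le_sum (f := fun i => (𝔖.s i : ℝ) * k i)
    (fun i _ => by positivity) (Finset.mem_univ i))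
  have : (1 : ℝ) ≤ 𝔖.s i := by exact_mod_cast hs i
  nlinarith [(k i).cast_nonneg (α := ℝ)]

variable {T : PreTree d 𝔱 L} {A : Finset T.Edge}

variable (𝔖) in
theorem preDegMinus_comp {ρ : T.V} (hρ : ¬ T.InEdges A ρ) (m : T.V → MIdx d) :
    𝔖.preDegMinus (T.comp A ρ hρ m) =
      (∑ a ∈ A with T.top A a.1 = ρ, (𝔖.hom (𝔖.q (T.typ a)) - 𝔖.mdeg (T.e a))) +
        ∑ v with T.top A v = ρ, 𝔖.mdeg (m v) := by
  refine congrArg₂ (· + ·) ?_ ?_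
  · refine Finset.sum_bij (fun b _ => T.compEdge b) (fun b _ => ?_)
      (fun b _ b' _ h => compEdge_injective h) (fun a ha => ?_) fun b _ => rfl
    · exact Finset.mem_filter.2 ⟨compEdge_mem b, top_compEdge b⟩
    · obtain ⟨b, hb⟩ := exists_compEdge hρ m (Finset.mem_filter.1 ha).1 (Finset.mem_filter.1 ha).2
      exact ⟨b, Finset.mem_univ _, hb⟩
  · refine Finset.sum_bij (fun b _ => b.1) (fun b _ => ?_)
      (fun b _ b' _ h => Subtype.ext h) (fun a ha => ?_) fun b _ => rfl
    · exact (Finset.mem_filter_univ _).2 b.2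
    · exact ⟨⟨a, (Finset.mem_filter.1 ha).2⟩, Finset.mem_univ _, rfl⟩

include hs in
-- The value of `ε` at an edge is added to the node decoration of the component at its lower vertex
-- and raises the homogeneity there. Negativity of all components therefore bounds `ε`.
theorem finite_neg : {c : Deco T A (T.verts A) | ∀ ρ : {ρ : T.V // T.IsCompRoot A ρ},
    𝔖.preDegMinus (T.comp A ρ.1 ρ.2.1 c.extracted) < 0}.Finite := by
  -- The contribution of the edges to the homogeneity of the component at `ρ`. The contribution of
  -- the nodes is nonnegative and must stay below `-D ρ`.
  let D : T.V → ℝ := fun ρ =>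
    ∑ a ∈ A with T.top A a.1 = ρ, (𝔖.hom (𝔖.q (T.typ a)) - 𝔖.mdeg (T.e a))
  refine (Deco.finite_of_le fun a _ => ⌈-D (T.top A (T.low a))⌉₊).subset fun c hc a i => ?_
  by_cases ha : T.low a ∈ T.verts A
  · have h := hc ⟨_, isCompRoot_top ha⟩
    rw [preDegMinus_comp] at h
    have h2 : 𝔖.mdeg (c.extracted (T.low a)) ≤
        ∑ v with T.top A v = T.top A (T.low a), 𝔖.mdeg (c.extracted v) :=
      Finset.single_le_sum (f := fun v => 𝔖.mdeg (c.extracted v)) (fun _ _ => 𝔖.mdeg_nonneg _)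
        (by simp)
    have h3 : (c.ε a i : ℝ) ≤ c.extracted (T.low a) i := by
      have : c.ε a ≤ c.extracted (T.low a) := (le_out c.ε a).trans le_add_self
      exact_mod_cast this i
    have h4 := le_mdeg hs (c.extracted (T.low a)) i
    have h6 : (c.ε a i : ℝ) ≤ ⌈-D (T.top A (T.low a))⌉₊ := by
      linarith [Nat.le_ceil (-D (T.top A (T.low a)))]
    exact_mod_cast h6
  · rw [c.ε_supp a (Or.inr ha)]
    exact Nat.zero_le _

include hs in
-- Here `ε` lowers the homogeneity of the planted trees, so their positivity bounds it.
theorem finite_pos {N : Set T.V} : {c : Deco T A N | ∀ a, a ∉ A ∧ T.low a ∈ N →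
    0 < 𝔖.degPlanted (T.typ a, T.e a + c.ε a, Quotient.mk _ (T.above a))}.Finite := by
  let D : T.Edge → ℝ := fun a =>
    𝔖.hom (𝔖.q (T.typ a)) - 𝔖.mdeg (T.e a) + 𝔖.degPlus (Quotient.mk _ (T.above a))
  refine (Deco.finite_of_le fun a _ => ⌈D a⌉₊).subset fun c hc a i => ?_
  by_cases ha : a ∉ A ∧ T.low a ∈ N
  · have h := hc a ha
    unfold degPlanted at h
    rw [mdeg_add] at h
    have h4 := le_mdeg hs (c.ε a) i
    have h5 : (c.ε a i : ℝ) ≤ ⌈D a⌉₊ := by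
      refine le_trans ?_ (Nat.le_ceil (D a))
      simp only [D]
      linarith
    exact_mod_cast h5
  · rw [c.ε_supp a (by tauto)]
    exact Nat.zero_le _

theorem neg_of_negFactor_ne_zero {c : Deco T A (T.verts A)} (h : 𝔖.negFactor c ≠ 0)
    (ρ : {ρ : T.V // T.IsCompRoot A ρ}) :
    𝔖.preDegMinus (T.comp A ρ.1 ρ.2.1 c.extracted) < 0 := by
  by_contra hρ
  refine h (Finset.prod_eq_zero (Finset.mem_univ ρ) (dif_neg ?_))
  rwa [degMinus_mk]

theorem pos_of_posFactor_ne_zero {N : Set T.V} {c : Deco T A N} (h : 𝔖.posFactor c ≠ 0)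
    (a : T.Edge) (ha : a ∉ A ∧ T.low a ∈ N) :
    0 < 𝔖.degPlanted (T.typ a, T.e a + c.ε a, Quotient.mk _ (T.above a)) := by
  by_contra h'
  refine h (mul_eq_zero_of_right _ (Finset.prod_eq_zero (i := a) (by simpa using ha) (dif_neg h')))

end TypeSystem

namespace PreTree

variable {d : ℕ} {𝔱 L : Type*} {T : PreTree d 𝔱 L} {A : Finset T.Edge}

/-! ### Subtrees at the root -/

/-- The vertex `v` lies above the edge `a`. -/
def IsAbove (T : PreTree d 𝔱 L) (a : T.Edge) (v : T.V) : Prop :=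
  T.top (Finset.univ.erase a) v = a.1

/-- The edge `a` leaves the subtree at the root with edge set `A`. -/
def Leaves (T : PreTree d 𝔱 L) (A : Finset T.Edge) (a : T.Edge) : Prop :=
  a ∉ A ∧ T.low a ∈ T.rverts A

theorem not_isAbove_root (a : T.Edge) : ¬ T.IsAbove a T.root := by
  unfold IsAbove
  rw [T.top_root]
  exact fun h => a.2 h.symm

theorem isAbove_self (a : T.Edge) : T.IsAbove a a.1 :=
  T.top_of_notIn fun h => by simpa using (inEdges_iff_mem a).1 h

/-- Being above `a` means lying in the component with root `a.1` after deletion of `a`, and every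
edge other than `a` keeps its two ends in one component. -/
theorem isAbove_par {a : T.Edge} {v : T.V} (hv : v ≠ T.root) (h : v ≠ a.1) :
    T.IsAbove a (T.par v) ↔ T.IsAbove a v := by
  unfold IsAbove
  rw [T.top_of_in (v := v)]
  exact ⟨⟨v, hv⟩, Finset.mem_erase.2 ⟨fun h' => h (congrArg Subtype.val h'), Finset.mem_univ _⟩, rfl⟩

theorem mem_rverts (hA : T.IsTrunk A) (v : T.V) : v ∈ T.rverts A ↔ v = T.root ∨ T.InEdges A v := by
  unfold rverts verts
  simp only [Set.mem_insert_iff, Set.mem_ofPred_eq]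
  constructor
  · rintro (h | h | ⟨a, ha, rfl⟩)
    · exact Or.inl h
    · exact Or.inr h
    · exact hA a ha
  · rintro (h | h)
    · exact Or.inl h
    · exact Or.inr (Or.inl h)

theorem top_eq_root (hA : T.IsTrunk A) {v : T.V} (hv : v ∈ T.rverts A) : T.top A v = T.root := by
  induction v using T.induct with
  | h0 => exact T.top_root A
  | h1 v h0 ih =>
    have h := ((mem_rverts hA v).1 hv).resolve_left h0
    rw [T.top_of_in h]
    exact ih ((mem_rverts hA _).2 (hA ⟨v, h0⟩ ((inEdges_iff_mem (T := T) ⟨v, h0⟩).1 h)))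

theorem mem_rverts_of_top (hA : T.IsTrunk A) {v : T.V} (hv : T.top A v = T.root) :
    v ∈ T.rverts A := by
  rw [mem_rverts hA]
  by_contra! h
  exact h.1 ((T.top_of_notIn h.2).symm.trans hv)

/-- The path from `v` down to the root passes through `a`. If `v` belonged to the subtree, so would
this whole path, and `a` would be in `A`. -/
theorem notMem_rverts_of_isAbove (hA : T.IsTrunk A) {a : T.Edge} (ha : a ∉ A) {v : T.V}
    (hv : T.IsAbove a v) : v ∉ T.rverts A := by
  rw [mem_rverts hA]
  induction v using T.induct with
  | h0 => exact absurd hv (not_isAbove_root a)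
  | h1 v h0 ih =>
    rintro (h | h)
    · exact h0 h
    · by_cases hva : v = a.1
      · subst hva
        exact ha ((inEdges_iff_mem a).1 h)
      · exact ih ((isAbove_par h0 hva).2 hv)
          (hA ⟨v, h0⟩ ((inEdges_iff_mem (T := T) ⟨v, h0⟩).1 h))

/-- Descend from `v` to the first of the two upper ends `a.1`, `b.1`. It is above the other edge
too; were the edges distinct, its lower vertex would be above that edge as well, hence outside the
subtree, although the edge leaves it. -/
theorem eq_of_isAbove (hA : T.IsTrunk A) {a b : T.Edge} (ha : T.Leaves A a) (hb : T.Leaves A b)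
    {v : T.V} (hva : T.IsAbove a v) (hvb : T.IsAbove b v) : a = b := by
  have key : ∀ {a b : T.Edge}, T.Leaves A a → T.Leaves A b → T.IsAbove b a.1 → a = b := by
    intro a b ha hb h
    by_contra hab
    exact notMem_rverts_of_isAbove hA hb.1
      ((isAbove_par a.2 fun h => hab (Subtype.ext h)).2 h) ha.2
  induction v using T.induct with
  | h0 => exact absurd hva (not_isAbove_root a)
  | h1 v h0 ih =>
    by_cases h : v = a.1
    · exact key ha hb (h ▸ hvb)
    by_cases h' : v = b.1
    · exact (key hb ha (h' ▸ hva)).symm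
    · exact ih ((isAbove_par h0 h).2 hva) ((isAbove_par h0 h').2 hvb)

/-- The path from the root to `v` starts inside the subtree and ends outside, so some edge of it
exits. -/
theorem exists_isAbove {v : T.V} (hv : v ∉ T.rverts A) : ∃ a, T.Leaves A a ∧ T.IsAbove a v := by
  induction v using T.induct with
  | h0 => exact absurd (Or.inl rfl) hv
  | h1 v h0 ih =>
    by_cases h : T.par v ∈ T.rverts A
    · refine ⟨⟨v, h0⟩, ⟨fun hA => hv (Or.inr (Or.inl ?_)), h⟩, isAbove_self _⟩
      exact (inEdges_iff_mem (T := T) ⟨v, h0⟩).2 hA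
    · obtain ⟨a, ha, hva⟩ := ih h
      by_cases h' : v = a.1
      · exact ⟨a, ha, h' ▸ isAbove_self a⟩
      · exact ⟨a, ha, (isAbove_par h0 h').1 hva⟩

theorem mem_rverts_of_mem {a : T.Edge} (ha : a ∈ A) : a.1 ∈ T.rverts A :=
  Or.inr (Or.inl ((inEdges_iff_mem a).2 ha))

theorem isAbove_compEdge {a : T.Edge} (b : (T.above a).Edge) :
    T.IsAbove a (T.compEdge b).1 := b.1.2

theorem compEdge_above_ne {a : T.Edge} (b : (T.above a).Edge) : T.compEdge b ≠ a :=
  (Finset.mem_erase.1 (compEdge_mem b)).1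

/-- The edges of a tree are those of a subtree at the root, those that leave it, and those above
the latter. -/
def edgeSplitPlus (hA : T.IsTrunk A) {N : Set T.V} (c : Deco T A N) :
    c.trunk.Edge ⊕ (Σ a : {a // T.Leaves A a}, Unit ⊕ (T.above a.1).Edge) ≃ T.Edge :=
  Equiv.ofBijective (Sum.elim T.compEdge
      fun x => Sum.elim (fun _ => x.1.1) (fun b => T.compEdge b) x.2) <| by
    -- Every edge of the second summand, the leaving edge included, has its upper end above the
    -- leaving edge. This separates the branches from each other and from the trunk.
    have habove : ∀ x : (Σ a : {a // T.Leaves A a}, Unit ⊕ (T.above a.1).Edge),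
        T.IsAbove x.1.1 (Sum.elim (fun _ => x.1.1) (fun b => T.compEdge b) x.2).1 := by
      rintro ⟨a, _ | b⟩
      · exact isAbove_self a.1
      · exact isAbove_compEdge b
    constructor
    · refine Function.Injective.sumElim compEdge_injective ?_ ?_
      · intro x y h
        have h2 := eq_of_isAbove hA x.1.2 y.1.2 (habove x)
          ((congrArg (fun a => T.IsAbove y.1.1 a.1) h).mpr (habove y))
        obtain ⟨⟨a, ha⟩, x⟩ := x
        obtain ⟨⟨b, hb⟩, y⟩ := y
        obtain rfl : a = b := h2
        rcases x with _ | x <;> rcases y with _ | y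
        · rfl
        · exact absurd h.symm (compEdge_above_ne y)
        · exact absurd h (compEdge_above_ne x)
        · obtain rfl : x = y := compEdge_injective h
          rfl
      · intro b x h
        exact notMem_rverts_of_isAbove hA x.1.2.1 (habove x)
          ((congrArg (fun a => a.1 ∈ T.rverts A) h).mp (mem_rverts_of_mem (compEdge_mem b)))
    · intro a
      by_cases ha : a ∈ A
      · obtain ⟨b, hb⟩ := exists_compEdge (T.root_notIn A) c.extracted ha
          (top_eq_root hA (mem_rverts_of_mem ha))
        exact ⟨Sum.inl b, hb⟩
      · obtain ⟨b, hb, hab⟩ := exists_isAbove (A := A) (v := a.1) fun h =>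
          ha ((inEdges_iff_mem a).1 (((mem_rverts hA _).1 h).resolve_left a.2))
        by_cases h : a = b
        · exact ⟨Sum.inr ⟨⟨b, hb⟩, Sum.inl ()⟩, h.symm⟩
        · obtain ⟨x, hx⟩ := exists_compEdge (A := Finset.univ.erase b) (ρ := b.1)
            (by rintro ⟨b', hb', h'⟩; exact (Finset.mem_erase.1 hb').1 (Subtype.ext h')) T.n
            (Finset.mem_erase.2 ⟨h, Finset.mem_univ a⟩) hab
          exact ⟨Sum.inr ⟨⟨b, hb⟩, Sum.inr x⟩, hx⟩

end PreTree

section Commute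

open PreTree

theorem TypeSystem.posFactor_eq {d : ℕ} {𝔱 L : Type*} (𝔖 : TypeSystem d 𝔱 L) {T : PreTree d 𝔱 L}
    {A : Finset T.Edge} (c : Deco T A (T.rverts A)) :
    𝔖.posFactor c = (∏ v with v ∈ T.rverts A, ∏ i, 𝔖.posX i ^ (T.n v i - c.nA v i)) *
      ∏ a : {a // T.Leaves A a}, 𝔖.posGen (T.typ a.1, T.e a.1 + c.ε a.1,
        Quotient.mk _ (T.above a.1)) := by
  rw [posFactor, Finset.prod_subtype _ (p := T.Leaves A) (by simp [Leaves])]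

variable {d : ℕ} {Lm Lp : Type*} (r : ℝ) {s : Fin (d + 1) → ℕ} (hs : ∀ i, 0 < s i)
  (hom : Lm ⊕ Lp → ℝ)

theorem posFactor_retype {T : BaseTree d Lm Lp} {A : Finset T.Edge} (c : Deco T A (T.rverts A))
    (t : T.Edge → ExtTypes Lm Lp) :
    (extSystem s hom).posFactor (c.retype t) =
      (∏ v with v ∈ T.rverts A, ∏ i, (extSystem s hom).posX i ^ (T.n v i - c.nA v i)) *
        ∏ a : {a // T.Leaves A a}, (extSystem s hom).posGen (t a.1, T.e a.1 + c.ε a.1,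
          Quotient.mk _ ((T.above a.1).retype fun b => t (T.compEdge b))) :=
  TypeSystem.posFactor_eq _ (c.retype t)

variable [Fintype Lm] [Fintype Lp]

/-! ### The shift operator commutes with the coproducts -/

/-- With the subforest and its decorations fixed, a type map is a family of type maps on the
components together with one on the contraction. The first part sums to `shiftMinus` of the product
of the components, the second to `shift` of the contraction. -/
theorem sum_liftWeight_minus {T : BaseTree d Lm Lp} {A : Finset T.Edge}
    (c : Deco T A (T.verts A)) :
    ∑ t, liftWeight r T t • ((extSystem s hom).negFactor (c.retype t) ⊗ₜ[ℝ]
        ((c.retype t).contract forgetHat).vec) =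
      TensorProduct.map (shiftMinus r s hom).toLinearMap (shift r)
        ((baseSystem s hom).negFactor c ⊗ₜ[ℝ] (c.contract id).vec) := by
  have h := sum_weight_split (edgeSplitMinus c id) (fun a => hatWeight r (T.typ a))
    (TensorProduct.mk ℝ (extSystem s hom).NegAlg (TreeSpace d (ExtTypes Lm Lp) (Lm ⊕ Lp)))
    (fun u => ∏ ρ : {ρ : T.V // T.IsCompRoot A ρ}, (extSystem s hom).negGen
      (Quotient.mk _ ((T.comp A ρ.1 ρ.2.1 c.extracted).retype fun b => u ⟨ρ, b⟩)))
    (fun u => ((c.contract id).retype u).vec)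
  rw [TensorProduct.map_tmul, shift_vec, AlgHom.toLinearMap_apply, TypeSystem.negFactor, map_prod]
  simp only [shiftMinus_negGen]
  have h2 := sum_weight_sigma (fun a => hatWeight r (T.typ (edgeSplitMinus c id (Sum.inl a))))
    (fun ρ u => (extSystem s hom).negGen
      (Quotient.mk _ ((T.comp A ρ.1 ρ.2.1 c.extracted).retype u)))
  -- Only for lifts does contraction commute with the change of types, since `𝔬` records types after
  -- `forgetHat`. Other maps have weight zero.
  refine Eq.trans (sum_liftWeight_congr fun t ht => ?_)
    (h.trans (congrArg (fun z => z ⊗ₜ[ℝ] _) h2))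
  rw [← vec_eq_of_iso (c.contractRetype t (q := id) ht)]
  rfl

theorem shiftPlus_posFactor {T : BaseTree d Lm Lp} {A : Finset T.Edge}
    (c : Deco T A (T.rverts A)) :
    shiftPlus r s hom ((baseSystem s hom).posFactor c) =
      (∏ v with v ∈ T.rverts A, ∏ i, (extSystem s hom).posX i ^ (T.n v i - c.nA v i)) *
        ∏ a : {a // T.Leaves A a}, ∑ x : ExtTypes Lm Lp, hatWeight r (T.typ a.1) x •
          ∑ t : (T.above a.1).Edge → ExtTypes Lm Lp, liftWeight r (T.above a.1) t •
            (extSystem s hom).posGen (x, T.e a.1 + c.ε a.1,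
              Quotient.mk _ ((T.above a.1).retype t)) := by
  rw [TypeSystem.posFactor_eq, map_mul, map_prod, map_prod]
  simp only [shiftPlus_posGen, map_prod, map_pow]
  refine congrArg₂ (· * ·) (Finset.prod_congr rfl fun v _ => Finset.prod_congr rfl fun i _ => ?_) rfl
  exact congrArg (· ^ _) (MvPolynomial.aeval_X _ _)

/-- As for the negative coproduct, with three kinds of pieces: the trunk, each leaving edge, and the
branch above it. -/
theorem sum_liftWeight_plus {T : BaseTree d Lm Lp} {A : Finset T.Edge} (hA : T.IsTrunk A)
    (c : Deco T A (T.rverts A)) :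
    ∑ t, liftWeight r T t • ((c.retype t).trunk.vec ⊗ₜ[ℝ] (extSystem s hom).posFactor (c.retype t)) =
      TensorProduct.map (shift r) (shiftPlus r s hom).toLinearMap
        (c.trunk.vec ⊗ₜ[ℝ] (baseSystem s hom).posFactor c) := by
  rw [TensorProduct.map_tmul, shift_vec, AlgHom.toLinearMap_apply, shiftPlus_posFactor]
  simp only [posFactor_retype]
  -- The monomial in the `X_i` does not depend on types; it is absorbed into the bilinear map below.
  generalize (∏ v with v ∈ T.rverts A, ∏ i,
    (extSystem s hom).posX i ^ (T.n v i - c.nA v i)) = P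
  have h := sum_weight_split (edgeSplitPlus hA c) (fun a => hatWeight r (T.typ a))
    ((TensorProduct.mk ℝ (TreeSpace d (ExtTypes Lm Lp) (Lm ⊕ Lp)) (extSystem s hom).PosAlg).compl₂
      (LinearMap.mulLeft ℝ P))
    (fun u => (c.trunk.retype u).vec)
    (fun u => ∏ a : {a // T.Leaves A a}, (extSystem s hom).posGen (u ⟨a, Sum.inl ()⟩,
      T.e a.1 + c.ε a.1, Quotient.mk _ ((T.above a.1).retype fun b => u ⟨a, Sum.inr b⟩)))
  simp only [LinearMap.compl₂_apply, TensorProduct.mk_apply, LinearMap.mulLeft_apply] at h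
  refine h.trans (congrArg (fun z => _ ⊗ₜ[ℝ] (P * z)) ?_)
  have h2 := sum_weight_sigma (fun a => hatWeight r (T.typ (edgeSplitPlus hA c (Sum.inr a))))
    (fun a u => (extSystem s hom).posGen (u (Sum.inl ()),
      T.e a.1 + c.ε a.1, Quotient.mk _ ((T.above a.1).retype fun b => u (Sum.inr b))))
  refine h2.trans (Finset.prod_congr rfl fun a _ => ?_)
  exact sum_weight_unit (fun b => hatWeight r (T.typ (edgeSplitPlus hA c (Sum.inr ⟨a, b⟩))))
      fun x t => (extSystem s hom).posGen (x, T.e a.1 + c.ε a.1,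
        Quotient.mk _ ((T.above a.1).retype t))

include hs in
theorem deltaMinus_shift (x : TreeSpace d (Lm ⊕ Lp) (Lm ⊕ Lp)) :
    (extSystem s hom).deltaMinus (shift r x) =
      TensorProduct.map (shiftMinus r s hom).toLinearMap (shift r)
        ((baseSystem s hom).deltaMinus x) := by
  suffices h : (extSystem s hom).deltaMinus ∘ₗ shift r =
      TensorProduct.map (shiftMinus r s hom).toLinearMap (shift r) ∘ₗ
        (baseSystem s hom).deltaMinus from LinearMap.congr_fun h x
  refine Finsupp.lhom_ext' fun τ => LinearMap.ext_ring ?_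
  induction τ using Quotient.inductionOn with | h T => ?_
  change (extSystem s hom).deltaMinus (shift r T.vec) = TensorProduct.map
    (shiftMinus r s hom).toLinearMap (shift r) ((baseSystem s hom).deltaMinus T.vec)
  rw [shift_vec, map_sum, TypeSystem.deltaMinus_vec, TypeSystem.preDeltaMinus_eq, map_sum]
  simp only [map_smul, TypeSystem.deltaMinus_vec]
  have h1 : ∀ t : T.Edge → ExtTypes Lm Lp, (extSystem s hom).preDeltaMinus (T.retype t) =
      ∑ A : Finset T.Edge, ∑ᶠ c : Deco T A (T.verts A), c.coef •
        ((extSystem s hom).negFactor (c.retype t) ⊗ₜ[ℝ] ((c.retype t).contract forgetHat).vec) := by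
    intro t
    rw [TypeSystem.preDeltaMinus_eq]
    exact Finset.sum_congr rfl fun A _ =>
      (finsum_comp_equiv (Deco.retypeEquiv T t A (T.verts A))).symm
  simp only [h1, Finset.smul_sum]
  rw [Finset.sum_comm]
  refine Finset.sum_congr rfl fun A _ => ?_
  -- A finite set of decorations, independent of the lift `t`, outside of which all summands vanish.
  -- It turns the `finsum`s into finite sums that can be exchanged with the sum over `t`.
  have hfin := TypeSystem.finite_neg (𝔖 := baseSystem s hom) (T := T) (A := A) hs
  have h2 : ∀ t : T.Edge → ExtTypes Lm Lp, (∀ a, forgetHat (t a) = T.typ a) →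
      ∑ᶠ c : Deco T A (T.verts A), c.coef • ((extSystem s hom).negFactor (c.retype t) ⊗ₜ[ℝ]
        ((c.retype t).contract forgetHat).vec) =
      ∑ c ∈ hfin.toFinset, c.coef • ((extSystem s hom).negFactor (c.retype t) ⊗ₜ[ℝ]
        ((c.retype t).contract forgetHat).vec) := by
    intro t ht
    refine finsum_eq_sum_of_support_subset _ fun c hc => ?_
    rw [Set.Finite.coe_toFinset]
    have h3 : (extSystem s hom).negFactor (c.retype t) ≠ 0 := left_ne_zero_of_smul_tmul hc
    intro ρ
    have h4 := TypeSystem.neg_of_negFactor_ne_zero h3 ρ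
    exact (preDegMinus_retype s hom _ fun b => ht (T.compEdge b)).symm.trans_lt h4
  have h5 : ∑ᶠ c : Deco T A (T.verts A), c.coef • ((baseSystem s hom).negFactor c ⊗ₜ[ℝ]
        (c.contract (baseSystem s hom).q).vec) =
      ∑ c ∈ hfin.toFinset, c.coef • ((baseSystem s hom).negFactor c ⊗ₜ[ℝ]
        (c.contract id).vec) := by
    refine finsum_eq_sum_of_support_subset _ fun c hc => ?_
    rw [Set.Finite.coe_toFinset]
    exact TypeSystem.neg_of_negFactor_ne_zero (left_ne_zero_of_smul_tmul hc)
  rw [h5, sum_liftWeight_congr h2, map_sum]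
  simp only [Finset.smul_sum]
  rw [Finset.sum_comm]
  refine Finset.sum_congr rfl fun c _ => ?_
  rw [map_smul, ← sum_liftWeight_minus, Finset.smul_sum]
  exact Finset.sum_congr rfl fun t _ => smul_comm _ _ _

include hs in
theorem deltaPlus_shift (x : TreeSpace d (Lm ⊕ Lp) (Lm ⊕ Lp)) :
    (extSystem s hom).deltaPlus (shift r x) =
      TensorProduct.map (shift r) (shiftPlus r s hom).toLinearMap
        ((baseSystem s hom).deltaPlus x) := by
  suffices h : (extSystem s hom).deltaPlus ∘ₗ shift r =
      TensorProduct.map (shift r) (shiftPlus r s hom).toLinearMap ∘ₗ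
        (baseSystem s hom).deltaPlus from LinearMap.congr_fun h x
  refine Finsupp.lhom_ext' fun τ => LinearMap.ext_ring ?_
  induction τ using Quotient.inductionOn with | h T => ?_
  change (extSystem s hom).deltaPlus (shift r T.vec) = TensorProduct.map (shift r)
    (shiftPlus r s hom).toLinearMap ((baseSystem s hom).deltaPlus T.vec)
  rw [shift_vec, map_sum, TypeSystem.deltaPlus_vec, TypeSystem.preDeltaPlus_eq, map_sum]
  simp only [map_smul, TypeSystem.deltaPlus_vec]
  have h1 : ∀ t : T.Edge → ExtTypes Lm Lp, (extSystem s hom).preDeltaPlus (T.retype t) =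
      ∑ A : {A : Finset T.Edge // T.IsTrunk A}, ∑ᶠ c : Deco T A.1 (T.rverts A.1), c.coef •
        ((c.retype t).trunk.vec ⊗ₜ[ℝ] (extSystem s hom).posFactor (c.retype t)) := by
    intro t
    rw [TypeSystem.preDeltaPlus_eq]
    exact Finset.sum_congr rfl fun A _ =>
      (finsum_comp_equiv (Deco.retypeEquiv T t A.1 (T.rverts A.1))).symm
  simp only [h1, Finset.smul_sum]
  rw [Finset.sum_comm]
  refine Finset.sum_congr rfl fun A _ => ?_
  -- Again one finite set of decorations that serves all lifts; this time it is the right factor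
  -- that vanishes outside.
  have hfin := TypeSystem.finite_pos (𝔖 := baseSystem s hom) (T := T) (A := A.1)
    (N := T.rverts A.1) hs
  have h2 : ∀ t : T.Edge → ExtTypes Lm Lp, (∀ a, forgetHat (t a) = T.typ a) →
      ∑ᶠ c : Deco T A.1 (T.rverts A.1), c.coef •
        ((c.retype t).trunk.vec ⊗ₜ[ℝ] (extSystem s hom).posFactor (c.retype t)) =
      ∑ c ∈ hfin.toFinset, c.coef •
        ((c.retype t).trunk.vec ⊗ₜ[ℝ] (extSystem s hom).posFactor (c.retype t)) := by
    intro t ht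
    refine finsum_eq_sum_of_support_subset _ fun c hc => ?_
    rw [Set.Finite.coe_toFinset]
    have h3 : (extSystem s hom).posFactor (c.retype t) ≠ 0 := right_ne_zero_of_smul_tmul hc
    intro a ha
    have h4 := TypeSystem.pos_of_posFactor_ne_zero h3 a ha
    refine h4.trans_eq ?_
    unfold TypeSystem.degPlanted
    refine congrArg₂ (· + ·) (congrArg (fun l => hom l - _) (ht a)) ?_
    rw [TypeSystem.degPlus_mk, TypeSystem.degPlus_mk]
    exact preDegPlus_retype s hom (T.above a) fun b => ht (T.compEdge b)
  have h5 : ∑ᶠ c : Deco T A.1 (T.rverts A.1), c.coef •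
        (c.trunk.vec ⊗ₜ[ℝ] (baseSystem s hom).posFactor c) =
      ∑ c ∈ hfin.toFinset, c.coef • (c.trunk.vec ⊗ₜ[ℝ] (baseSystem s hom).posFactor c) := by
    refine finsum_eq_sum_of_support_subset _ fun c hc => ?_
    rw [Set.Finite.coe_toFinset]
    exact TypeSystem.pos_of_posFactor_ne_zero (right_ne_zero_of_smul_tmul hc)
  rw [h5, sum_liftWeight_congr h2, map_sum]
  simp only [Finset.smul_sum]
  rw [Finset.sum_comm]
  refine Finset.sum_congr rfl fun c _ => ?_
  rw [map_smul, ← sum_liftWeight_plus r hom A.2, Finset.smul_sum]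
  exact Finset.sum_congr rfl fun t _ => smul_comm _ _ _

end Commute

namespace TypeSystem

open PreTree

variable {d : ℕ} {𝔱 L : Type*} (𝔖 : TypeSystem d 𝔱 L)

/-! ### The homogeneity of contracted trees -/

theorem odeg_add (α β : ODec d L) : 𝔖.odeg (α + β) = 𝔖.odeg α + 𝔖.odeg β := by
  unfold odeg
  rw [Prod.snd_add, Finsupp.sum_add_index' (by simp) (by intros; push_cast; ring), Prod.fst_add]
  simp only [Pi.add_apply, Int.cast_add, mul_add, Finset.sum_add_distrib]
  ring

theorem odeg_zero : 𝔖.odeg 0 = 0 := by simp [odeg]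

theorem odeg_sum {ι : Type*} (I : Finset ι) (f : ι → ODec d L) :
    𝔖.odeg (∑ i ∈ I, f i) = ∑ i ∈ I, 𝔖.odeg (f i) := by
  induction I using Finset.induction_on with
  | empty => exact 𝔖.odeg_zero
  | insert i I hi ih => rw [Finset.sum_insert hi, Finset.sum_insert hi, odeg_add, ih]

theorem odeg_mdeg (k : MIdx d) : 𝔖.odeg ((fun i => (k i : ℤ), 0) : ODec d L) = 𝔖.mdeg k := by
  simp [odeg, mdeg]

theorem odeg_edge (k : MIdx d) (l : L) :
    𝔖.odeg ((fun i => -(k i : ℤ), Finsupp.single l 1) : ODec d L) = 𝔖.hom l - 𝔖.mdeg k := by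
  simp [odeg, mdeg]
  ring

variable {T : PreTree d 𝔱 L} {A : Finset T.Edge}

theorem _root_.PreTree.sum_top {M : Type*} [AddCommMonoid M] (T : PreTree d 𝔱 L)
    (A : Finset T.Edge) {ι : Type*} (I : Finset ι) (g : ι → T.V) (f : ι → M) :
    ∑ v : {v : T.V // ¬ T.InEdges A v}, ∑ i ∈ I with T.top A (g i) = v.1, f i = ∑ i ∈ I, f i := by
  rw [← Finset.sum_fiberwise I
    (fun i => (⟨T.top A (g i), T.top_notIn A _⟩ : {v : T.V // ¬ T.InEdges A v})) f]
  refine Finset.sum_congr rfl fun v _ => Finset.sum_congr ?_ fun _ _ => rfl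
  simp only [Subtype.ext_iff]

theorem _root_.PreTree.sum_mdeg_out (f : T.Edge → MIdx d) :
    ∑ v, 𝔖.mdeg (T.out f v) = ∑ a, 𝔖.mdeg (f a) := by
  unfold out
  simp only [mdeg_sum]
  exact Finset.sum_fiberwise _ _ _

/-- `𝔬` stores exactly what contraction removes: the contracted edges and the extracted `𝔫_A`. It
also stores `π ε_A`, which compensates the `ε_A` added to the remaining edges. -/
theorem preDegPlus_contract (ho : ∀ v, T.o v = 0) {N : Set T.V} (c : Deco T A N) :
    𝔖.preDegPlus (c.contract 𝔖.q) = 𝔖.preDegMinus T := by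
  have h1 : (∑ b : (c.contract 𝔖.q).Edge, (𝔖.hom (𝔖.q ((c.contract 𝔖.q).typ b)) -
      𝔖.mdeg ((c.contract 𝔖.q).e b))) =
      ∑ a with a ∉ A, (𝔖.hom (𝔖.q (T.typ a)) - 𝔖.mdeg (T.e a + c.ε a)) := by
    refine Finset.sum_bij (fun b _ => contractEdge c b) (fun b _ => ?_)
      (fun b _ b' _ h => contractEdge_injective h) (fun a ha => ?_) fun b _ => rfl
    · exact (Finset.mem_filter_univ _).2 (contractEdge_notMem b)
    · obtain ⟨b, hb⟩ := exists_contractEdge c 𝔖.q (Finset.mem_filter.1 ha).2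
      exact ⟨b, Finset.mem_univ _, hb⟩
  have h2 : ∑ v, 𝔖.mdeg ((c.contract 𝔖.q).n v) = ∑ u, 𝔖.mdeg (T.n u - c.nA u) := by
    rw [← T.sum_top A Finset.univ id]
    exact Finset.sum_congr rfl fun v _ => 𝔖.mdeg_sum _ _
  have h3 : ∑ v, 𝔖.odeg ((c.contract 𝔖.q).o v) = ∑ u, 𝔖.mdeg (c.extracted u) +
      ∑ a ∈ A, (𝔖.hom (𝔖.q (T.typ a)) - 𝔖.mdeg (T.e a)) := by
    rw [← T.sum_top A Finset.univ id, ← T.sum_top A A (fun a => a.1), ← Finset.sum_add_distrib]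
    refine Finset.sum_congr rfl fun v _ => ?_
    refine (𝔖.odeg_add _ _).trans ?_
    rw [odeg_sum, odeg_sum]
    simp only [ho, zero_add, odeg_mdeg, odeg_edge, id]
  have h4 : ∑ u, 𝔖.mdeg (T.n u - c.nA u) + ∑ u, 𝔖.mdeg (c.extracted u) =
      ∑ u, 𝔖.mdeg (T.n u) + ∑ a, 𝔖.mdeg (c.ε a) := by
    rw [← T.sum_mdeg_out 𝔖 c.ε]
    rw [← Finset.sum_add_distrib, ← Finset.sum_add_distrib]
    refine Finset.sum_congr rfl fun u _ => ?_
    unfold Deco.extracted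
    rw [mdeg_add, ← add_assoc, ← mdeg_add, tsub_add_cancel_of_le (c.nA_le u)]
  have h5 : ∑ a with a ∉ A, 𝔖.mdeg (c.ε a) = ∑ a, 𝔖.mdeg (c.ε a) := by
    refine Finset.sum_filter_of_ne fun a _ h ha => h ?_
    rw [c.ε_supp a (Or.inl ha)]
    simp [mdeg]
  have h6 : (∑ a with a ∉ A, (𝔖.hom (𝔖.q (T.typ a)) - 𝔖.mdeg (T.e a))) +
      ∑ a ∈ A, (𝔖.hom (𝔖.q (T.typ a)) - 𝔖.mdeg (T.e a)) =
      ∑ a, (𝔖.hom (𝔖.q (T.typ a)) - 𝔖.mdeg (T.e a)) := by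
    rw [add_comm, ← Finset.sum_filter_add_sum_filter_not Finset.univ (· ∈ A)]
    simp
  have h7 : (∑ a with a ∉ A, (𝔖.hom (𝔖.q (T.typ a)) - 𝔖.mdeg (T.e a + c.ε a))) =
      (∑ a with a ∉ A, (𝔖.hom (𝔖.q (T.typ a)) - 𝔖.mdeg (T.e a))) -
        ∑ a with a ∉ A, 𝔖.mdeg (c.ε a) := by
    rw [← Finset.sum_sub_distrib]
    refine Finset.sum_congr rfl fun a _ => ?_
    rw [mdeg_add]
    ring
  unfold preDegPlus preDegMinus
  rw [h1, h2, h3]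
  linarith

/-- Sum the inequality of the rule over all vertices. Every edge occurs once as the edge below a
vertex and once as an edge going up from one, so the `reg` terms telescope to `reg t` and the
homogeneities of the edges remain. Node decorations only help. -/
theorem le_preDegMinus_of_conforms {R : Rule d 𝔱} {reg : 𝔱 → ℝ}
    (hreg : ∀ t, ∀ N ∈ R.R t, reg t - 𝔖.hom (𝔖.q t) ≤ (N.map fun p => reg p.1 - 𝔖.mdeg p.2).sum)
    {t : 𝔱} (hT : T.ConformsAt R t) : reg t - 𝔖.hom (𝔖.q t) ≤ 𝔖.preDegMinus T := by
  have hnode : ∀ v, ((T.nodeType v).map fun p => reg p.1 - 𝔖.mdeg p.2).sum =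
      ∑ a with T.low a = v, (reg (T.typ a) - 𝔖.mdeg (T.e a)) := by
    intro v
    unfold nodeType
    rw [Multiset.map_map]
    rfl
  have h1 := Finset.sum_fiberwise Finset.univ T.low fun a => reg (T.typ a) - 𝔖.mdeg (T.e a)
  rw [Fintype.sum_eq_add_sum_subtype_ne _ T.root] at h1
  have h2 := hreg t _ hT.2
  have h3 : ∑ a : T.Edge, (reg (T.typ a) - 𝔖.hom (𝔖.q (T.typ a))) ≤ ∑ v : {v // v ≠ T.root},
      ∑ a with T.low a = v.1, (reg (T.typ a) - 𝔖.mdeg (T.e a)) :=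
    Finset.sum_le_sum fun a _ => (hreg _ _ (hT.1 a)).trans_eq (hnode a.1)
  rw [hnode] at h2
  rw [Finset.sum_sub_distrib] at h3
  rw [Finset.sum_sub_distrib (s := Finset.univ) (fun a => reg (T.typ a))] at h1
  have h4 : 0 ≤ ∑ v, 𝔖.mdeg (T.n v) := Finset.sum_nonneg fun v _ => 𝔖.mdeg_nonneg _
  unfold preDegMinus
  rw [Finset.sum_sub_distrib]
  linarith

theorem exists_le_degPlus [Finite 𝔱] {R : Rule d 𝔱} (hsub : R.Subcritical 𝔖) :
    ∃ α ≤ (0 : ℝ), ∀ τ ∈ treesEx 𝔖 R, α ≤ 𝔖.degPlus τ := by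
  obtain ⟨reg, hreg⟩ := hsub
  have hreg' : ∀ t, ∀ N ∈ R.R t,
      reg t - 𝔖.hom (𝔖.q t) ≤ (N.map fun p => reg p.1 - 𝔖.mdeg p.2).sum := by
    intro t N hN
    obtain ⟨c, hc, h⟩ := hreg t
    linarith [h N hN]
  -- Finiteness of the set of types makes the bound uniform in the type at the root.
  obtain ⟨α, hα⟩ := (Set.finite_range fun t => reg t - 𝔖.hom (𝔖.q t)).bddBelow
  refine ⟨min α 0, min_le_right _ _, fun τ hτ => ?_⟩
  obtain ⟨t, T, ho, hT, A, c, -, rfl⟩ := Set.mem_iUnion.1 hτ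
  rw [degPlus_mk, preDegPlus_contract 𝔖 ho]
  exact (min_le_left _ _).trans ((hα ⟨t, rfl⟩).trans (𝔖.le_preDegMinus_of_conforms hreg' hT))

end TypeSystem

section Spaces

open PreTree

variable {d : ℕ} {𝔱 L : Type*} (𝔖 : TypeSystem d 𝔱 L) (R : Rule d 𝔱)

theorem TEx_eq_supported : TEx 𝔖 R = Finsupp.supported ℝ ℝ (treesEx 𝔖 R) :=
  (Finsupp.supported_eq_span_single ℝ _).symm

theorem vec_mem_TEx {T : PreTree d 𝔱 L} (h : Quotient.mk _ T ∈ treesEx 𝔖 R) : T.vec ∈ TEx 𝔖 R :=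
  Submodule.subset_span ⟨_, h, rfl⟩

variable {Lm Lp : Type*} {s : Fin (d + 1) → ℕ} {hom : Lm ⊕ Lp → ℝ} {R : Rule d (Lm ⊕ Lp)}
  (hnoise : ∀ Ξ : Lm, R.R (Sum.inl Ξ) = {0})

/-! ### The shift operator and the rules -/

include hnoise in
theorem mem_extRule_iff (x : ExtTypes Lm Lp) (N : Multiset (ExtTypes Lm Lp × MIdx d)) :
    N ∈ (extRule R).R x ↔ N.map (fun p => (forgetHat p.1, p.2)) ∈ R.R (forgetHat x) := by
  have key : ∀ Ξ, N = 0 ↔ N.map (fun p => (forgetHat p.1, p.2)) ∈ R.R (Sum.inl Ξ) := by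
    intro Ξ
    rw [hnoise, Set.mem_singleton_iff, Multiset.map_eq_zero]
  rcases x with (x | x) | x
  · exact key x
  · exact key x
  · exact Iff.rfl

include hnoise in
-- The pullback of `reg` along `forgetHat` works with the same constants.
theorem extRule_subcritical (h : R.Subcritical (baseSystem s hom)) :
    (extRule R).Subcritical (extSystem s hom) := by
  obtain ⟨reg, hreg⟩ := h
  refine ⟨fun x => reg (forgetHat x), fun x => ?_⟩
  obtain ⟨c, hc, h⟩ := hreg (forgetHat x)
  refine ⟨c, hc, fun N hN => ?_⟩
  have := h _ ((mem_extRule_iff hnoise x N).1 hN)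
  rwa [Multiset.map_map] at this

theorem nodeType_retype {T : BaseTree d Lm Lp} {t : T.Edge → ExtTypes Lm Lp}
    (ht : ∀ a, forgetHat (t a) = T.typ a) (v : T.V) :
    ((T.retype t).nodeType v).map (fun p => (forgetHat p.1, p.2)) = T.nodeType v := by
  unfold nodeType
  rw [Multiset.map_map]
  exact Multiset.map_congr rfl fun a _ => Prod.ext (ht a) rfl

include hnoise in
-- The tree is a contraction of a conforming tree `S`, so the lift has to be extended to the
-- contracted edges of `S`. Any extension will do: these edges survive only in `𝔬`, which does not
-- see hats.
theorem retype_mem_treesExAt {T : BaseTree d Lm Lp} {x : ExtTypes Lm Lp}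
    (hT : Quotient.mk _ T ∈ treesExAt (baseSystem s hom) R (forgetHat x))
    {t : T.Edge → ExtTypes Lm Lp} (ht : ∀ a, forgetHat (t a) = T.typ a) :
    Quotient.mk _ (T.retype t) ∈ treesExAt (extSystem s hom) (extRule R) x := by
  obtain ⟨S, ho, hS, A, c, hneg, hτ⟩ := hT
  obtain ⟨f⟩ := Quotient.exact hτ
  obtain ⟨u, hu, hut⟩ : ∃ u : S.Edge → ExtTypes Lm Lp, (∀ a, forgetHat (u a) = S.typ a) ∧
      ∀ a, u (contractEdge c (f.edge a)) = t a := by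
    -- Contracted edges get no hat; the others carry the prescribed type.
    refine ⟨fun a => if h : a ∈ A then noHat (S.typ a) else t (f.edge.symm
      ⟨⟨a.1, by rwa [inEdges_iff_mem]⟩, fun h' => a.2 (congrArg Subtype.val h')⟩), ?_, ?_⟩
    · intro a
      by_cases h : a ∈ A
      · simp only [dif_pos h]
        exact forgetHat_noHat _
      · simp only [dif_neg h]
        rw [ht, ← f.typ_edge, Equiv.apply_symm_apply]
        rfl
    · intro a
      exact (dif_neg (contractEdge_notMem (f.edge a))).trans
        (congrArg t (f.edge.symm_apply_apply a))
  have hconf : (S.retype u).ConformsAt (extRule R) x := by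
    refine ⟨fun a => ?_, ?_⟩
    · rw [mem_extRule_iff hnoise]
      exact (congrArg₂ (fun M l => M ∈ R.R l) (nodeType_retype hu a.1) (hu a)).mpr (hS.1 a)
    · rw [mem_extRule_iff hnoise]
      exact (congrArg (fun M => M ∈ R.R _) (nodeType_retype hu S.root)).mpr hS.2
  have hdeg : ∀ ρ : {ρ : S.V // S.IsCompRoot A ρ}, (extSystem s hom).preDegMinus
      ((S.retype u).comp A ρ.1 ρ.2.1 (c.retype u).extracted) < 0 := by
    intro ρ
    have h := hneg ρ
    rw [← preDegMinus_retype s hom _ fun b => hu (S.compEdge b)] at h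
    exact h
  exact ⟨S.retype u, ho, hconf, A, c.retype u, hdeg, (mk_eq_of_iso (f.retype hut)).trans
    (mk_eq_of_iso (c.contractRetype u hu))⟩

include hnoise in
theorem retype_mem_treesEx {T : BaseTree d Lm Lp}
    (hT : Quotient.mk _ T ∈ treesEx (baseSystem s hom) R)
    {t : T.Edge → ExtTypes Lm Lp} (ht : ∀ a, forgetHat (t a) = T.typ a) :
    Quotient.mk _ (T.retype t) ∈ treesEx (extSystem s hom) (extRule R) := by
  obtain ⟨l, hl⟩ := Set.mem_iUnion.1 hT
  exact Set.mem_iUnion.2 ⟨noHat l,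
    retype_mem_treesExAt hnoise ((forgetHat_noHat l).symm ▸ hl) ht⟩

theorem degPlus_retype_mk (T : BaseTree d Lm Lp) {t : T.Edge → ExtTypes Lm Lp}
    (ht : ∀ a, forgetHat (t a) = T.typ a) :
    (extSystem s hom).degPlus (Quotient.mk _ (T.retype t)) =
      (baseSystem s hom).degPlus (Quotient.mk _ T) := by
  rw [TypeSystem.degPlus_mk, TypeSystem.degPlus_mk, preDegPlus_retype s hom T ht]

variable [Fintype Lm] [Fintype Lp] (r : ℝ)

theorem shift_mem_span {X : Set (DTree d (Lm ⊕ Lp) (Lm ⊕ Lp))}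
    {Y : Set (DTree d (ExtTypes Lm Lp) (Lm ⊕ Lp))}
    (h : ∀ (T : BaseTree d Lm Lp) (t : T.Edge → ExtTypes Lm Lp), Quotient.mk _ T ∈ X →
      (∀ a, forgetHat (t a) = T.typ a) → Quotient.mk _ (T.retype t) ∈ Y)
    {x : TreeSpace d (Lm ⊕ Lp) (Lm ⊕ Lp)}
    (hx : x ∈ Submodule.span ℝ ((fun τ => Finsupp.single τ 1) '' X)) :
    shift r x ∈ Submodule.span ℝ
      ((fun τ => (Finsupp.single τ 1 : TreeSpace d (ExtTypes Lm Lp) (Lm ⊕ Lp))) '' Y) := by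
  refine (Submodule.span_le (p := Submodule.comap (shift r) (Submodule.span ℝ
    ((fun τ => (Finsupp.single τ 1 : TreeSpace d (ExtTypes Lm Lp) (Lm ⊕ Lp))) '' Y)))).2 ?_ hx
  rintro _ ⟨τ, hτ, rfl⟩
  induction τ using Quotient.inductionOn with | h T => ?_
  rw [SetLike.mem_coe, Submodule.mem_comap]
  change shift r T.vec ∈ Submodule.span ℝ
    ((fun τ => (Finsupp.single τ 1 : TreeSpace d (ExtTypes Lm Lp) (Lm ⊕ Lp))) '' Y)
  rw [shift_vec]
  refine Submodule.sum_mem _ fun t _ => ?_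
  by_cases ht : ∀ a, forgetHat (t a) = T.typ a
  · exact Submodule.smul_mem _ _ (Submodule.subset_span ⟨_, h T t hτ ht, rfl⟩)
  · rw [liftWeight_eq_zero r ht, zero_smul]
    exact Submodule.zero_mem _

include hnoise in
theorem shift_mem_TEx {x : TreeSpace d (Lm ⊕ Lp) (Lm ⊕ Lp)} (hx : x ∈ TEx (baseSystem s hom) R) :
    shift r x ∈ TEx (extSystem s hom) (extRule R) :=
  shift_mem_span r (fun _ _ hT ht => retype_mem_treesEx hnoise hT ht) hx

theorem out_o_eq_zero_iff {𝔱 L : Type*} (T : PreTree d 𝔱 L) :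
    (∀ v, (Quotient.out (Quotient.mk (setoid d 𝔱 L) T)).o v = 0) ↔ ∀ v, T.o v = 0 := by
  obtain ⟨f⟩ := exists_iso_out T
  rw [← f.toEquiv.forall_congr_right]
  simp only [f.map_o]

include hnoise in
theorem shift_mem_TReduced {x : TreeSpace d (Lm ⊕ Lp) (Lm ⊕ Lp)}
    (hx : x ∈ TReduced (baseSystem s hom) R) :
    shift r x ∈ TReduced (extSystem s hom) (extRule R) := by
  refine shift_mem_span r (fun T t hT ht => ?_) hx
  exact ⟨retype_mem_treesEx hnoise hT.1 ht,
    (out_o_eq_zero_iff (T.retype t)).2 ((out_o_eq_zero_iff T).1 hT.2)⟩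

/-- Used with three predicates that hats do not affect: having a given homogeneity, having
homogeneity below the truncation level, and being the unit tree. -/
theorem filter_shift {p : DTree d (ExtTypes Lm Lp) (Lm ⊕ Lp) → Prop}
    {p' : DTree d (Lm ⊕ Lp) (Lm ⊕ Lp) → Prop}
    (h : ∀ (T : BaseTree d Lm Lp) (t : T.Edge → ExtTypes Lm Lp),
      (∀ a, forgetHat (t a) = T.typ a) →
        (p (Quotient.mk _ (T.retype t)) ↔ p' (Quotient.mk _ T)))
    (x : TreeSpace d (Lm ⊕ Lp) (Lm ⊕ Lp)) :
    (shift r x).filter p = shift r (x.filter p') := by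
  induction x using Finsupp.induction_linear with
  | zero => rw [map_zero, Finsupp.filter_zero, Finsupp.filter_zero, map_zero]
  | add x y hx hy => rw [map_add, Finsupp.filter_add, hx, hy, Finsupp.filter_add, map_add]
  | single τ a =>
    induction τ using Quotient.inductionOn with | h T => ?_
    have h1 : (Finsupp.single (Quotient.mk _ T) a : TreeSpace d (Lm ⊕ Lp) (Lm ⊕ Lp)) = a • T.vec := by
      rw [vec_eq_single, Finsupp.smul_single, smul_eq_mul, mul_one]
    have h2 : (T.vec).filter p' = if p' (Quotient.mk _ T) then T.vec else 0 := by
      split_ifs with hp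
      · exact Finsupp.filter_single_of_pos _ hp
      · exact Finsupp.filter_single_of_neg _ hp
    have h3 : (shift r T.vec).filter p = if p' (Quotient.mk _ T) then shift r T.vec else 0 := by
      rw [shift_vec, Finsupp.filter_sum]
      simp only [Finsupp.filter_smul]
      split_ifs with hp
      · exact sum_liftWeight_congr fun t ht => Finsupp.filter_single_of_pos _ ((h T t ht).2 hp)
      · exact sum_liftWeight_eq_zero fun t ht =>
          Finsupp.filter_single_of_neg _ fun h' => hp ((h T t ht).1 h')
    rw [h1, map_smul, Finsupp.filter_smul, Finsupp.filter_smul, h2, h3, map_smul]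
    congr 1
    split_ifs <;> simp

end Spaces

namespace PreTree

variable {d : ℕ} {𝔱 L : Type*} {T : PreTree d 𝔱 L} {D : Finset T.Edge}

/-! ### Restriction of extractions to a subtree at the root -/

/-- The subtree at the root with edge set `D` and node decoration `m`. -/
abbrev rootComp (T : PreTree d 𝔱 L) (D : Finset T.Edge) (m : T.V → MIdx d) : PreTree d 𝔱 L :=
  T.comp D T.root (T.root_notIn D) m

variable {m : T.V → MIdx d}

/-- The edges of a subtree at the root that belong to `B`. -/
def restrictEdges (T : PreTree d 𝔱 L) (D : Finset T.Edge) (m : T.V → MIdx d) (B : Finset T.Edge) :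
    Finset (T.rootComp D m).Edge :=
  {b | T.compEdge b ∈ B}

theorem mem_restrictEdges {B : Finset T.Edge} (b : (T.rootComp D m).Edge) :
    b ∈ T.restrictEdges D m B ↔ T.compEdge b ∈ B :=
  Finset.mem_filter_univ _

section

variable (hD : T.IsTrunk D)

include hD in
theorem rootComp_mem (v : (T.rootComp D m).V) : v.1 ∈ T.rverts D := mem_rverts_of_top hD v.2

include hD in
theorem exists_rootComp_edge (m : T.V → MIdx d) {a : T.Edge} (ha : a ∈ D) :
    ∃ b : (T.rootComp D m).Edge, T.compEdge b = a :=
  exists_compEdge _ _ ha (top_eq_root hD (mem_rverts_of_mem ha))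

include hD in
theorem rootComp_par (v : (T.rootComp D m).V) : ((T.rootComp D m).par v).1 = T.par v.1 := by
  rw [comp_par_val]
  unfold stepDown
  rcases (mem_rverts hD v.1).1 (rootComp_mem hD v) with h | h
  · rw [h, T.par_root, ite_self]
  · rw [if_pos h]

include hD in
theorem rootComp_low (b : (T.rootComp D m).Edge) :
    ((T.rootComp D m).low b).1 = T.low (T.compEdge b) :=
  rootComp_par hD b.1

theorem rootComp_inEdges {B : Finset T.Edge} (v : (T.rootComp D m).V) :
    (T.rootComp D m).InEdges (T.restrictEdges D m B) v ↔ T.InEdges B v.1 := by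
  constructor
  · rintro ⟨b, hb, rfl⟩
    exact ⟨T.compEdge b, (mem_restrictEdges b).1 hb, rfl⟩
  · rintro ⟨a, ha, h⟩
    refine ⟨⟨v, fun h' => a.2 (h.trans (congrArg Subtype.val h'))⟩, ?_, rfl⟩
    rw [mem_restrictEdges]
    rwa [show a = T.compEdge (A := D) (m := m) ⟨v, _⟩ from Subtype.ext h] at ha

include hD in
theorem rootComp_top {B : Finset T.Edge} (v : (T.rootComp D m).V) :
    ((T.rootComp D m).top (T.restrictEdges D m B) v).1 = T.top B v.1 := by
  induction v using (T.rootComp D m).induct with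
  | h0 =>
    rw [(T.rootComp D m).top_root]
    exact (T.top_root B).symm
  | h1 v hv ih =>
    by_cases h : T.InEdges B v.1
    · rw [T.top_of_in h, (T.rootComp D m).top_of_in ((rootComp_inEdges v).2 h), ih,
        rootComp_par hD]
    · rw [T.top_of_notIn h, (T.rootComp D m).top_of_notIn fun h' => h ((rootComp_inEdges v).1 h')]

theorem nodeType_rootComp_le (hD : T.IsTrunk D) (v : (T.rootComp D m).V) :
    (T.rootComp D m).nodeType v ≤ T.nodeType v.1 := by
  have h : (T.rootComp D m).nodeType v =
      ((({b | (T.rootComp D m).low b = v} : Finset (T.rootComp D m).Edge).image T.compEdge).val.map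
        fun a => (T.typ a, T.e a)) := by
    rw [Finset.image_val_of_injOn compEdge_injective.injOn, Multiset.map_map]
    rfl
  rw [h]
  refine Multiset.map_le_map (Finset.val_le_iff.2 fun a ha => ?_)
  obtain ⟨b, hb, rfl⟩ := Finset.mem_image.1 ha
  rw [Finset.mem_filter_univ] at hb ⊢
  rw [← rootComp_low hD, hb]

/-- Passing to a subtree shrinks the multiset of edges at each vertex, which normality allows. -/
theorem ConformsAt.rootComp {R : Rule d 𝔱} (hR : R.Normal) {t : 𝔱} (hT : T.ConformsAt R t)
    (hD : T.IsTrunk D) : (T.rootComp D m).ConformsAt R t :=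
  ⟨fun b => hR _ _ (hT.1 (T.compEdge b)) _ (nodeType_rootComp_le hD b.1),
    hR _ _ hT.2 _ (nodeType_rootComp_le hD _)⟩

variable {B : Finset T.Edge} (hB : ∀ a ∈ B, T.low a ∈ T.rverts D → a ∈ D)

include hD hB in
-- Hypothesis `hB` says that `B` never continues upwards out of the subtree. Each component of `B`
-- whose root is in the subtree thus lies in it entirely, and restriction does not cut it.
theorem rootComp_verts (v : (T.rootComp D m).V) :
    v ∈ (T.rootComp D m).verts (T.restrictEdges D m B) ↔ v.1 ∈ T.verts B := by
  unfold verts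
  simp only [Set.mem_ofPred_eq, rootComp_inEdges]
  refine or_congr Iff.rfl ⟨?_, ?_⟩
  · rintro ⟨b, hb, rfl⟩
    exact ⟨T.compEdge b, (mem_restrictEdges b).1 hb, (rootComp_low hD b).symm⟩
  · rintro ⟨a, ha, h⟩
    obtain ⟨b, rfl⟩ := exists_rootComp_edge hD m (hB a ha (h ▸ rootComp_mem hD v))
    exact ⟨b, (mem_restrictEdges b).2 ha, Subtype.ext ((rootComp_low hD b).trans h)⟩

include hB in
-- Climb from the root of the component to `v` along edges of `B`; by `hB` no step leaves the
-- subtree.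
theorem mem_rverts_of_top_mem {v : T.V} (h : T.top B v ∈ T.rverts D) : v ∈ T.rverts D := by
  induction v using T.induct with
  | h0 => exact Or.inl rfl
  | h1 v hv ih =>
    by_cases h' : T.InEdges B v
    · rw [T.top_of_in h'] at h
      exact mem_rverts_of_mem (hB ⟨v, hv⟩ ((inEdges_iff_mem (T := T) ⟨v, hv⟩).1 h') (ih h))
    · rwa [T.top_of_notIn h'] at h

include hD hB in
theorem sum_rootComp_verts {M : Type*} [AddCommMonoid M] (ρ : (T.rootComp D m).V) (f : T.V → M) :
    ∑ v with (T.rootComp D m).top (T.restrictEdges D m B) v = ρ, f v.1 =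
      ∑ v with T.top B v = ρ.1, f v := by
  refine Finset.sum_bij (fun v _ => v.1) (fun v hv => ?_) (fun v _ w _ h => Subtype.ext h)
    (fun v hv => ?_) fun _ _ => rfl
  · rw [Finset.mem_filter_univ] at hv ⊢
    rw [← hv, rootComp_top hD]
  · rw [Finset.mem_filter_univ] at hv
    have h1 : v ∈ T.rverts D := mem_rverts_of_top_mem hB (hv ▸ rootComp_mem hD ρ)
    exact ⟨⟨v, top_eq_root hD h1⟩,
      (Finset.mem_filter_univ _).2 (Subtype.ext ((rootComp_top hD _).trans hv)), rfl⟩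

include hD hB in
theorem sum_rootComp_edges {M : Type*} [AddCommMonoid M] (ρ : (T.rootComp D m).V)
    (f : T.Edge → M) :
    ∑ b ∈ T.restrictEdges D m B with (T.rootComp D m).top (T.restrictEdges D m B) b.1 = ρ,
        f (T.compEdge b) = ∑ a ∈ B with T.top B a.1 = ρ.1, f a := by
  refine Finset.sum_bij (fun b _ => T.compEdge b) (fun b hb => ?_)
    (fun v _ w _ h => compEdge_injective h) (fun a ha => ?_) fun _ _ => rfl
  · rw [Finset.mem_filter] at hb ⊢
    exact ⟨(mem_restrictEdges b).1 hb.1, (rootComp_top hD b.1).symm.trans (congrArg _ hb.2)⟩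
  · rw [Finset.mem_filter] at ha
    have h1 : a.1 ∈ T.rverts D := mem_rverts_of_top_mem hB (ha.2 ▸ rootComp_mem hD ρ)
    obtain ⟨b, rfl⟩ := exists_rootComp_edge hD m
      ((inEdges_iff_mem a).1 (((mem_rverts hD _).1 h1).resolve_left a.2))
    refine ⟨b, ?_, rfl⟩
    rw [Finset.mem_filter]
    exact ⟨(mem_restrictEdges b).2 ha.1, Subtype.ext ((rootComp_top hD _).trans ha.2)⟩

/-- The decoration `𝔫_A` of the restriction to a subtree: it incorporates the values of `ε_A` at
the edges that leave the subtree. -/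
def Deco.restrictN (c : Deco T B (T.verts B)) (D : Finset T.Edge) (v : T.V) : MIdx d :=
  c.nA v + ∑ a with T.low a = v ∧ a ∉ D, c.ε a

/-- Restriction of decorations to a subtree at the root, that preserves the extracted trees. -/
def Deco.restrict (c : Deco T B (T.verts B)) (hm : ∀ v, c.restrictN D v ≤ m v) :
    Deco (T.rootComp D m) (T.restrictEdges D m B)
      ((T.rootComp D m).verts (T.restrictEdges D m B)) where
  nA v := c.restrictN D v.1
  ε b := c.ε (T.compEdge b)
  nA_le v := hm v.1
  nA_supp v hv := by
    rw [rootComp_verts hD hB] at hv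
    unfold restrictN
    rw [c.nA_supp _ hv, zero_add]
    refine Finset.sum_eq_zero fun a ha => c.ε_supp a (Or.inr ?_)
    rwa [(Finset.mem_filter.1 ha).2.1]
  ε_supp b hb := by
    rw [mem_restrictEdges, rootComp_verts hD hB, rootComp_low hD] at hb
    exact c.ε_supp _ hb

/-- The part of `π ε` coming from edges that were cut off has been moved into `nA`, so the sum `𝔫_A
+ π ε_A` is unchanged. -/
theorem Deco.restrict_extracted (c : Deco T B (T.verts B)) (hm : ∀ v, c.restrictN D v ≤ m v)
    (v : (T.rootComp D m).V) : (c.restrict hD hB hm).extracted v = c.extracted v.1 := by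
  have h : (T.rootComp D m).out (c.restrict hD hB hm).ε v =
      ∑ a with T.low a = v.1 ∧ a ∈ D, c.ε a := by
    refine Finset.sum_bij (fun b _ => T.compEdge b) (fun b hb => ?_)
      (fun v _ w _ h => compEdge_injective h) (fun a ha => ?_) fun _ _ => rfl
    · rw [Finset.mem_filter_univ] at hb ⊢
      exact ⟨(rootComp_low hD b).symm.trans (congrArg _ hb), compEdge_mem b⟩
    · rw [Finset.mem_filter_univ] at ha
      obtain ⟨b, rfl⟩ := exists_rootComp_edge hD m ha.2
      exact ⟨b, (Finset.mem_filter_univ _).2 (Subtype.ext ((rootComp_low hD b).trans ha.1)), rfl⟩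
  have h2 : c.extracted v.1 = c.nA v.1 + ((∑ a with T.low a = v.1 ∧ a ∈ D, c.ε a) +
      ∑ a with T.low a = v.1 ∧ a ∉ D, c.ε a) := by
    unfold Deco.extracted PreTree.out
    rw [← Finset.sum_filter_add_sum_filter_not _ (· ∈ D), Finset.filter_filter,
      Finset.filter_filter]
  rw [h2]
  unfold Deco.extracted
  rw [h]
  change c.nA v.1 + _ + _ = _
  abel

theorem preDegMinus_restrict (𝔖 : TypeSystem d 𝔱 L) (c : Deco T B (T.verts B))
    (hm : ∀ v, c.restrictN D v ≤ m v)
    (ρ : {ρ : (T.rootComp D m).V // (T.rootComp D m).IsCompRoot (T.restrictEdges D m B) ρ})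
    (hρ : T.IsCompRoot B ρ.1.1) :
    𝔖.preDegMinus ((T.rootComp D m).comp (T.restrictEdges D m B) ρ.1 ρ.2.1
        (c.restrict hD hB hm).extracted) =
      𝔖.preDegMinus (T.comp B ρ.1.1 hρ.1 c.extracted) := by
  rw [TypeSystem.preDegMinus_comp, TypeSystem.preDegMinus_comp,
    ← sum_rootComp_edges hD hB ρ.1, ← sum_rootComp_verts hD hB ρ.1]
  simp only [Deco.restrict_extracted]
  rfl

end

/-! ### Subtrees at the root of a contraction -/

section Contract

variable {B : Finset T.Edge} (c : Deco T B (T.verts B)) (q : 𝔱 → L)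

/-- The edges of the tree that belong to a subtree at the root of the contraction, or to the
components contracted to one of its vertices. -/
def pullEdges (A : Finset (c.contract q).Edge) : Finset T.Edge :=
  {a | (⟨T.top B a.1, T.top_notIn B _⟩ : (c.contract q).V) ∈ (c.contract q).rverts A}

variable {c q} {A : Finset (c.contract q).Edge}

theorem mem_pullEdges (a : T.Edge) : a ∈ pullEdges c q A ↔
    (⟨T.top B a.1, T.top_notIn B _⟩ : (c.contract q).V) ∈ (c.contract q).rverts A :=
  Finset.mem_filter_univ _

variable (hA : (c.contract q).IsTrunk A)

include hA in
-- An edge of `T` is either contracted, and both ends have the same image, or it is an edge of the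
-- contraction, where `A` is closed towards the root.
theorem pull_par {v : T.V} (hv : v ≠ T.root)
    (h : (⟨T.top B v, T.top_notIn B v⟩ : (c.contract q).V) ∈ (c.contract q).rverts A) :
    (⟨T.top B (T.par v), T.top_notIn B _⟩ : (c.contract q).V) ∈ (c.contract q).rverts A := by
  by_cases hB : T.InEdges B v
  · simpa only [T.top_of_in hB] using h
  · simp only [T.top_of_notIn hB] at h
    rcases (mem_rverts hA _).1 h with h | ⟨a, ha, h⟩
    · exact absurd (congrArg Subtype.val h) hv
    · have h2 := hA a ha
      rw [← mem_rverts hA] at h2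
      have h3 : (c.contract q).low a = ⟨T.top B (T.par v), T.top_notIn B _⟩ :=
        congrArg (c.contract q).par h
      rwa [← h3]

include hA in
theorem isTrunk_pullEdges : T.IsTrunk (pullEdges c q A) := by
  intro a ha
  by_cases h : T.low a = T.root
  · exact Or.inl h
  · refine Or.inr ⟨⟨T.low a, h⟩, ?_, rfl⟩
    exact (mem_pullEdges _).2 (pull_par hA a.2 ((mem_pullEdges a).1 ha))

include hA in
theorem mem_rverts_pullEdges (v : T.V) : v ∈ T.rverts (pullEdges c q A) ↔
    (⟨T.top B v, T.top_notIn B v⟩ : (c.contract q).V) ∈ (c.contract q).rverts A := by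
  rw [mem_rverts (isTrunk_pullEdges hA)]
  by_cases hv : v = T.root
  · subst hv
    simp only [true_or, T.top_root, true_iff]
    exact Or.inl rfl
  · rw [or_iff_right hv]
    exact (inEdges_iff_mem (T := T) ⟨v, hv⟩).trans (mem_pullEdges _)

include hA in
-- Both ends of an edge in `B` have the same image in the contraction, so the preimage consists of
-- whole components. This is the hypothesis `hB` needed for restriction.
theorem mem_pullEdges_of_low {a : T.Edge} (ha : a ∈ B) (h : T.low a ∈ T.rverts (pullEdges c q A)) :
    a ∈ pullEdges c q A := by
  rw [mem_rverts_pullEdges hA] at h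
  rw [mem_pullEdges]
  have h' : T.top B (T.low a) = T.top B a.1 := (T.top_of_in ((inEdges_iff_mem a).2 ha)).symm
  simpa only [h'] using h

/-- A node decoration for which the contraction of the restriction has node decoration `m`. -/
def pullNode (c : Deco T B (T.verts B)) (D : Finset T.Edge) (m : {v // ¬ T.InEdges B v} → MIdx d)
    (v : T.V) : MIdx d :=
  -- The prescribed decoration is placed at the root of each component. After `restrictN` is
  -- subtracted, the sum over the component returns it.
  c.restrictN D v + if h : T.InEdges B v then 0 else m ⟨v, h⟩

theorem restrictN_le_pullNode (D : Finset T.Edge) (m : {v // ¬ T.InEdges B v} → MIdx d) (v : T.V) :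
    c.restrictN D v ≤ pullNode c D m v :=
  le_self_add

theorem sum_pullNode (D : Finset T.Edge) (m : {v // ¬ T.InEdges B v} → MIdx d)
    (v : {v // ¬ T.InEdges B v}) :
    ∑ u with T.top B u = v.1, (pullNode c D m u - c.restrictN D u) = m v := by
  unfold pullNode
  simp only [add_tsub_cancel_left]
  rw [Finset.sum_eq_single v.1, dif_neg v.2]
  · intro u hu huv
    refine dif_pos (inEdges_of_top_ne fun h => huv ?_)
    exact h.symm.trans (Finset.mem_filter.1 hu).2
  · intro h
    exact absurd (T.top_of_notIn v.2) (by simpa using h)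

/-- The restriction of an extraction to a subtree at the root of its contraction. -/
def pullDeco (m : (c.contract q).V → MIdx d) :
    Deco (T.rootComp (pullEdges c q A) (pullNode c (pullEdges c q A) m))
      (T.restrictEdges (pullEdges c q A) (pullNode c (pullEdges c q A) m) B)
      ((T.rootComp (pullEdges c q A) (pullNode c (pullEdges c q A) m)).verts
        (T.restrictEdges (pullEdges c q A) (pullNode c (pullEdges c q A) m) B)) :=
  c.restrict (isTrunk_pullEdges hA) (fun _ ha => mem_pullEdges_of_low hA ha)
    (restrictN_le_pullNode (pullEdges c q A) m)

/-- The vertices of a subtree at the root of a contraction. -/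
def pullEquiv (m : (c.contract q).V → MIdx d) :
    ((c.contract q).rootComp A m).V ≃ ((pullDeco hA m).contract q).V where
  toFun := fun w => ⟨⟨w.1.1, top_eq_root (isTrunk_pullEdges hA) (by
      rw [mem_rverts_pullEdges hA, show (⟨T.top B w.1.1, T.top_notIn B _⟩ :
        (c.contract q).V) = w.1 from Subtype.ext (T.top_of_notIn w.1.2)]
      exact rootComp_mem hA w)⟩,
    fun h => w.1.2 ((rootComp_inEdges _).1 h)⟩
  invFun := fun v => ⟨⟨v.1.1, fun h => v.2 ((rootComp_inEdges _).2 h)⟩,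
    top_eq_root hA (by
      have h := rootComp_mem (isTrunk_pullEdges hA) v.1
      rw [mem_rverts_pullEdges hA, show (⟨T.top B v.1.1, T.top_notIn B _⟩ :
        (c.contract q).V) = ⟨v.1.1, fun h => v.2 ((rootComp_inEdges _).2 h)⟩ from
        Subtype.ext (T.top_of_notIn fun h => v.2 ((rootComp_inEdges _).2 h))] at h
      exact h)⟩
  left_inv := fun _ => rfl
  right_inv := fun _ => rfl

/-- A subtree at the root of a contraction is a contraction. -/
def contractRestrictIso (m : (c.contract q).V → MIdx d) :
    Iso ((c.contract q).rootComp A m) ((pullDeco hA m).contract q) where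
  toEquiv := pullEquiv hA m
  map_root := rfl
  map_par w := by
    refine Subtype.ext (Subtype.ext ?_)
    refine (congrArg Subtype.val (rootComp_par hA w)).trans ?_
    refine Eq.trans ?_ (rootComp_top (isTrunk_pullEdges hA) _).symm
    exact congrArg (T.top B) (rootComp_par (isTrunk_pullEdges hA) (pullEquiv hA m w).1).symm
  map_typ v w h := by
    have h' : v.1.1.1 = w.1.1.1 := congrArg (fun x => x.1.1) h
    exact congrArg T.typ (Subtype.ext h')
  map_e v w h := by
    have h' : v.1.1.1 = w.1.1.1 := congrArg (fun x => x.1.1) h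
    exact congrArg (fun a => T.e a + c.ε a) (Subtype.ext h')
  map_n w := by
    refine (sum_pullNode (c := c) (pullEdges c q A) m w.1).symm.trans ?_
    exact (sum_rootComp_verts (isTrunk_pullEdges hA) (fun _ ha => mem_pullEdges_of_low hA ha)
      (pullEquiv hA m w).1
      fun u => pullNode c (pullEdges c q A) m u - c.restrictN (pullEdges c q A) u).symm
  map_o w := by
    refine congrArg₂ (· + ·) ?_ ?_
    -- `𝔬` sees the node decorations of the restriction only through `extracted`, which restriction
    -- preserves.
    · refine (sum_rootComp_verts (isTrunk_pullEdges hA) (fun _ ha => mem_pullEdges_of_low hA ha)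
        (pullEquiv hA m w).1 fun u => T.o u + (fun i => (c.extracted u i : ℤ), 0)).symm.trans ?_
      refine Finset.sum_congr rfl fun u _ => ?_
      rw [← Deco.restrict_extracted (isTrunk_pullEdges hA)
        (fun _ ha => mem_pullEdges_of_low hA ha) c (restrictN_le_pullNode (pullEdges c q A) m) u]
      rfl
    · exact (sum_rootComp_edges (isTrunk_pullEdges hA) (fun _ ha => mem_pullEdges_of_low hA ha)
        (pullEquiv hA m w).1
        fun a => ((fun i => -(T.e a i : ℤ), Finsupp.single (q (T.typ a)) 1) : ODec d L)).symm

end Contract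

/-- Pull the subtree back to the uncontracted tree and restrict the extraction to it: components and
their homogeneities stay the same, and normality gives conformity. The node decoration `m` is
arbitrary because rules do not constrain it; in $\Delta_+^{ex}$ it contains $\pi\varepsilon_A$ and
need not be below $\mathfrak n$. -/
theorem rootComp_mem_treesExAt {𝔖 : TypeSystem d 𝔱 L} {R : Rule d 𝔱} (hR : R.Normal) {t : 𝔱}
    (hT : Quotient.mk _ T ∈ treesExAt 𝔖 R t) (hD : T.IsTrunk D) (m : T.V → MIdx d) :
    Quotient.mk _ (T.rootComp D m) ∈ treesExAt 𝔖 R t := by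
  obtain ⟨S, ho, hS, B, c, hneg, hτ⟩ := hT
  obtain ⟨f⟩ := Quotient.exact hτ
  have hA : ∀ a, f.edge a ∈ f.edge.finsetCongr D ↔ a ∈ D := by simp
  have hA' : (c.contract 𝔖.q).IsTrunk (f.edge.finsetCongr D) := by
    unfold IsTrunk
    rw [← f.edge.forall_congr_right]
    simp only [hA, f.low_edge, f.inEdges_iff hA, ← f.map_root, f.toEquiv.injective.eq_iff]
    exact hD
  refine ⟨S.rootComp (pullEdges c 𝔖.q (f.edge.finsetCongr D))
    (pullNode c (pullEdges c 𝔖.q (f.edge.finsetCongr D)) fun v => m (f.toEquiv.symm v)),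
    fun v => ho v.1, hS.rootComp hR (isTrunk_pullEdges hA'), _,
    pullDeco hA' fun v => m (f.toEquiv.symm v), fun ρ => ?_, ?_⟩
  · have hρ : S.IsCompRoot B ρ.1.1 := ⟨fun h => ρ.2.1 ((rootComp_inEdges _).2 h),
      (rootComp_verts (isTrunk_pullEdges hA') (fun _ ha => mem_pullEdges_of_low hA' ha) _).1 ρ.2.2⟩
    exact (preDegMinus_restrict _ _ 𝔖 c _ ρ hρ).trans_lt (hneg ⟨_, hρ⟩)
  · exact (mk_eq_of_iso (f.comp hA f.map_root (T.root_notIn D) ((c.contract 𝔖.q).root_notIn _)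
      (m' := fun v => m (f.toEquiv.symm v)) fun v => by simp)).trans
      (mk_eq_of_iso (contractRestrictIso hA' fun v => m (f.toEquiv.symm v)))

end PreTree

section Sector

open PreTree

variable {d : ℕ} {𝔱 L : Type*} {𝔖 : TypeSystem d 𝔱 L} {R : Rule d 𝔱}

/-! ### The structure group and renormalisation -/

/-- Stated for arbitrary linear functionals, since it will be applied to the composition of
`posEval` on the extended side with `shiftPlus`. -/
theorem deltaPlus_mem (hR : R.Normal) (φ : 𝔖.PosAlg →ₗ[ℝ] ℝ) {x : TreeSpace d 𝔱 L}
    (hx : x ∈ TEx 𝔖 R) :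
    TensorProduct.rid ℝ _ (TensorProduct.map LinearMap.id φ (𝔖.deltaPlus x)) ∈ TEx 𝔖 R := by
  let Φ : TreeSpace d 𝔱 L ⊗[ℝ] 𝔖.PosAlg →ₗ[ℝ] TreeSpace d 𝔱 L :=
    (TensorProduct.rid ℝ _).toLinearMap ∘ₗ TensorProduct.map LinearMap.id φ
  suffices h : TEx 𝔖 R ≤ Submodule.comap 𝔖.deltaPlus (Submodule.comap Φ (TEx 𝔖 R)) from h hx
  refine Submodule.span_le.2 ?_
  rintro _ ⟨τ, hτ, rfl⟩
  induction τ using Quotient.inductionOn with | h T => ?_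
  change 𝔖.deltaPlus T.vec ∈ Submodule.comap Φ (TEx 𝔖 R)
  rw [TypeSystem.deltaPlus_vec, TypeSystem.preDeltaPlus_eq]
  refine Submodule.sum_mem _ fun A _ => finsum_induction
    (· ∈ Submodule.comap Φ (TEx 𝔖 R)) (Submodule.zero_mem _)
    (fun _ _ => Submodule.add_mem _) fun c => Submodule.smul_mem _ _ ?_
  change TensorProduct.rid ℝ _ (TensorProduct.map LinearMap.id φ (_ ⊗ₜ[ℝ] _)) ∈ TEx 𝔖 R
  rw [TensorProduct.map_tmul, TensorProduct.rid_tmul]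
  obtain ⟨t, ht⟩ := Set.mem_iUnion.1 hτ
  exact Submodule.smul_mem _ _ (vec_mem_TEx 𝔖 R
    (Set.mem_iUnion.2 ⟨t, rootComp_mem_treesExAt hR ht A.2 c.extracted⟩))

theorem rid_map_map {M M' P P' : Type*} [AddCommMonoid M] [AddCommMonoid M'] [AddCommMonoid P]
    [AddCommMonoid P'] [Module ℝ M] [Module ℝ M'] [Module ℝ P] [Module ℝ P'] (f : M →ₗ[ℝ] M')
    (g : P →ₗ[ℝ] P') (φ : P' →ₗ[ℝ] ℝ) (z : M ⊗[ℝ] P) :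
    TensorProduct.rid ℝ M' (TensorProduct.map LinearMap.id φ (TensorProduct.map f g z)) =
      f (TensorProduct.rid ℝ M (TensorProduct.map LinearMap.id (φ ∘ₗ g) z)) := by
  induction z using TensorProduct.induction_on with
  | zero => simp
  | tmul x y => simp
  | add x y hx hy => simp only [map_add, hx, hy]

theorem lid_map_map {M M' P P' : Type*} [AddCommMonoid M] [AddCommMonoid M'] [AddCommMonoid P]
    [AddCommMonoid P'] [Module ℝ M] [Module ℝ M'] [Module ℝ P] [Module ℝ P'] (f : M →ₗ[ℝ] M')
    (g : P →ₗ[ℝ] P') (φ : P' →ₗ[ℝ] ℝ) (z : P ⊗[ℝ] M) :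
    TensorProduct.lid ℝ M' (TensorProduct.map φ LinearMap.id (TensorProduct.map g f z)) =
      f (TensorProduct.lid ℝ M (TensorProduct.map (φ ∘ₗ g) LinearMap.id z)) := by
  induction z using TensorProduct.induction_on with
  | zero => simp
  | tmul x y => simp
  | add x y hx hy => simp only [map_add, hx, hy]

end Sector

/-! ### The image of the shift operator as a sector, and embedded characters -/

section ShiftSector

open PreTree

variable {d : ℕ} {Lm Lp : Type*} {s : Fin (d + 1) → ℕ} {hom : Lm ⊕ Lp → ℝ}
  {R : Rule d (Lm ⊕ Lp)}

theorem hatless_eq_mk (τ : DTree d (Lm ⊕ Lp) (Lm ⊕ Lp)) :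
    hatless τ = Quotient.mk _ (τ.out.retype fun a => noHat (τ.out.typ a)) := by
  rw [← hatless_mk, Quotient.out_eq]

theorem hatless_mem_treesEx (hnoise : ∀ Ξ : Lm, R.R (Sum.inl Ξ) = {0})
    {τ : DTree d (Lm ⊕ Lp) (Lm ⊕ Lp)} (h : τ ∈ treesEx (baseSystem s hom) R) :
    hatless τ ∈ treesEx (extSystem s hom) (extRule R) := by
  induction τ using Quotient.inductionOn with
  | h T => exact retype_mem_treesEx hnoise h fun a => forgetHat_noHat _

theorem negEval_extendChar_X (g : TMinus (baseSystem s hom) R →ₐ[ℝ] ℝ)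
    (σ : {σ // (extSystem s hom).degMinus σ < 0}) :
    negEval (extSystem s hom) (extRule R) (extendChar s hom R g) (MvPolynomial.X σ) =
      if σ.1 ∈ treesEx (extSystem s hom) (extRule R) then
        if h : ∃ τ : {τ // (baseSystem s hom).degMinus τ < 0},
          τ.1 ∈ treesEx (baseSystem s hom) R ∧ σ.1 = hatless τ.1 then
            negEval (baseSystem s hom) R g (MvPolynomial.X h.choose) else 0
      else 0 := by
  unfold negEval
  rw [MvPolynomial.aeval_X]
  split_ifs with h1 h2
  · refine (MvPolynomial.aeval_X _ σ).trans ?_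
    simp only [← hatless_eq_mk]
    exact dif_pos h2
  · refine (MvPolynomial.aeval_X _ σ).trans ?_
    simp only [← hatless_eq_mk]
    exact dif_neg h2
  · rfl

theorem negEval_X_of_notMem (g : TMinus (baseSystem s hom) R →ₐ[ℝ] ℝ)
    {τ : {τ // (baseSystem s hom).degMinus τ < 0}} (h : τ.1 ∉ treesEx (baseSystem s hom) R) :
    negEval (baseSystem s hom) R g (MvPolynomial.X τ) = 0 := by
  unfold negEval
  rw [MvPolynomial.aeval_X, dif_neg h]

/-- `hatless` has the left inverse `forgetTree`, so the preimage chosen in `extendChar` is `τ`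
itself. If `τ` does not conform, both sides vanish. -/
theorem negEval_extendChar_hatless (hnoise : ∀ Ξ : Lm, R.R (Sum.inl Ξ) = {0})
    (g : TMinus (baseSystem s hom) R →ₐ[ℝ] ℝ) (τ : {τ // (baseSystem s hom).degMinus τ < 0})
    (σ : {σ // (extSystem s hom).degMinus σ < 0}) (h : σ.1 = hatless τ.1) :
    negEval (extSystem s hom) (extRule R) (extendChar s hom R g) (MvPolynomial.X σ) =
      negEval (baseSystem s hom) R g (MvPolynomial.X τ) := by
  have hinj : ∀ τ' : {τ // (baseSystem s hom).degMinus τ < 0}, σ.1 = hatless τ'.1 → τ' = τ :=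
    fun τ' h' => Subtype.ext (by
      rw [← forgetTree_hatless τ'.1, ← h', h, forgetTree_hatless])
  rw [negEval_extendChar_X]
  by_cases hτ : τ.1 ∈ treesEx (baseSystem s hom) R
  · have hex : ∃ τ : {τ // (baseSystem s hom).degMinus τ < 0},
        τ.1 ∈ treesEx (baseSystem s hom) R ∧ σ.1 = hatless τ.1 := ⟨τ, hτ, h⟩
    rw [if_pos (h ▸ hatless_mem_treesEx hnoise hτ), dif_pos hex, hinj _ hex.choose_spec.2]
  · rw [dif_neg, ite_self, negEval_X_of_notMem g hτ]
    rintro ⟨τ', h1, h2⟩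
    exact hτ (hinj τ' h2 ▸ h1)

variable [Fintype Lm] [Fintype Lp] (r : ℝ)

theorem isSector_shift (hs : ∀ i, 0 < s i) (hnoise : ∀ Ξ : Lm, R.R (Sum.inl Ξ) = {0})
    (hnormal : R.Normal) (hsub : R.Subcritical (baseSystem s hom)) :
    IsSector (extSystem s hom) (extRule R) ((TEx (baseSystem s hom) R).map (shift r)) := by
  have hle : (TEx (baseSystem s hom) R).map (shift r) ≤ TEx (extSystem s hom) (extRule R) := by
    rintro _ ⟨x, hx, rfl⟩
    exact shift_mem_TEx hnoise r hx
  refine ⟨hle, ?_, ?_, ?_⟩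
  · rintro _ ⟨x, hx, rfl⟩ β
    rw [filter_shift r (p' := fun τ => (baseSystem s hom).degPlus τ = β)
      fun T t ht => by rw [degPlus_retype_mk T ht]]
    refine Submodule.mem_map_of_mem ?_
    rw [TEx_eq_supported, SetLike.mem_coe, Finsupp.mem_supported] at hx
    rw [TEx_eq_supported, Finsupp.mem_supported]
    refine (Finset.coe_subset.2 ?_).trans hx
    rw [Finsupp.support_filter]
    exact Finset.filter_subset _ _
  · obtain ⟨α, hα, h⟩ := (extSystem s hom).exists_le_degPlus (extRule_subcritical hnoise hsub)
    refine ⟨α, hα, fun x hx τ hτ => h τ ?_⟩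
    have h' := hle hx
    rw [TEx_eq_supported, Finsupp.mem_supported] at h'
    exact h' hτ
  · rintro γ _ ⟨x, hx, rfl⟩
    unfold structGroup
    -- By the coproduct identity `shift` moves to the outside, and what acts on the right factor is
    -- `γ` composed with `shiftPlus`.
    rw [LinearMap.comp_apply, LinearMap.comp_apply, deltaPlus_shift r hs, LinearEquiv.coe_coe,
      rid_map_map]
    exact Submodule.mem_map_of_mem (deltaPlus_mem hnormal _ hx)

/-- The embedded character vanishes on every tree with a hat, so of all lifts only the one without
hats counts, and its weight is `1`. -/
theorem negEval_extendChar_shiftMinus (hnoise : ∀ Ξ : Lm, R.R (Sum.inl Ξ) = {0})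
    (g : TMinus (baseSystem s hom) R →ₐ[ℝ] ℝ) :
    (negEval (extSystem s hom) (extRule R) (extendChar s hom R g)).comp (shiftMinus r s hom) =
      negEval (baseSystem s hom) R g := by
  refine MvPolynomial.algHom_ext fun τ => ?_
  obtain ⟨τ, hτ⟩ := τ
  induction τ using Quotient.inductionOn with | h T => ?_
  have h0 : (baseSystem s hom).negGen (Quotient.mk _ T) = MvPolynomial.X ⟨_, hτ⟩ := dif_pos hτ
  have hσ : ∀ t : T.Edge → ExtTypes Lm Lp, (∀ a, forgetHat (t a) = T.typ a) →
      (extSystem s hom).degMinus (Quotient.mk _ (T.retype t)) < 0 := fun t ht => by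
    rwa [TypeSystem.degMinus_mk, preDegMinus_retype s hom T ht, ← TypeSystem.degMinus_mk]
  rw [AlgHom.comp_apply, ← h0, shiftMinus_negGen, map_sum, h0]
  simp only [map_smul]
  have ht0 : ∀ a, forgetHat (noHat (T.typ a)) = T.typ a := fun a => forgetHat_noHat _
  rw [Finset.sum_eq_single fun a => noHat (T.typ a)]
  · rw [liftWeight_noHat, one_smul, TypeSystem.negGen, dif_pos (hσ _ ht0)]
    exact negEval_extendChar_hatless hnoise g ⟨_, hτ⟩ _ rfl
  · intro t _ hne
    by_cases ht : ∀ a, forgetHat (t a) = T.typ a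
    · rw [TypeSystem.negGen, dif_pos (hσ t ht), negEval_extendChar_X, dif_neg, ite_self, smul_zero]
      rintro ⟨τ', -, h⟩
      exact hne (eq_noHat_of_mk_eq_hatless ht h)
    · rw [liftWeight_eq_zero r ht, zero_smul]
  · exact fun h => absurd (Finset.mem_univ _) h

theorem shift_renorm (hs : ∀ i, 0 < s i) (hnoise : ∀ Ξ : Lm, R.R (Sum.inl Ξ) = {0})
    (g : TMinus (baseSystem s hom) R →ₐ[ℝ] ℝ) (x : TreeSpace d (Lm ⊕ Lp) (Lm ⊕ Lp)) :
    shift r (renorm (baseSystem s hom) R g x) =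
      renorm (extSystem s hom) (extRule R) (extendChar s hom R g) (shift r x) := by
  unfold renorm
  rw [LinearMap.comp_apply, LinearMap.comp_apply, LinearMap.comp_apply, LinearMap.comp_apply,
    deltaMinus_shift r hs, LinearEquiv.coe_coe, LinearEquiv.coe_coe, lid_map_map,
    ← AlgHom.comp_toLinearMap, negEval_extendChar_shiftMinus r hnoise]

end ShiftSector

namespace PreTree

variable {d : ℕ} {𝔱 𝔱' L : Type*}

/-! ### Product, planting and differentiation of isomorphic trees -/

theorem mul_low_inl (S T : PreTree d 𝔱 L) (a : T.Edge) (h : T.low a = T.root) :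
    (mul S T).par (Sum.inr a) = Sum.inl S.root := dif_pos h

theorem mul_low_inr (S T : PreTree d 𝔱 L) (a : T.Edge) (h : T.low a ≠ T.root) :
    (mul S T).par (Sum.inr a) = Sum.inr ⟨T.low a, h⟩ := dif_neg h

/-- The tree product is compatible with isomorphisms. -/
def Iso.mul {S S' T T' : PreTree d 𝔱 L} (f : Iso S S') (g : Iso T T') :
    Iso (S.mul T) (S'.mul T') where
  toEquiv := f.toEquiv.sumCongr g.edge
  map_root := congrArg Sum.inl f.map_root
  map_par := by
    rintro (v | a)
    · exact congrArg Sum.inl (f.map_par v)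
    · change f.toEquiv.sumCongr g.edge ((S.mul T).par (Sum.inr a)) =
        (S'.mul T').par (Sum.inr (g.edge a))
      by_cases h : T.low a = T.root
      · have h' : T'.low (g.edge a) = T'.root := by rw [g.low_edge, h, g.map_root]
        rw [mul_low_inl _ _ _ h, mul_low_inl _ _ _ h', ← f.map_root]
        rfl
      · have h' : T'.low (g.edge a) ≠ T'.root := by rwa [g.low_edge, ← g.ne_root_iff]
        rw [mul_low_inr _ _ _ h, mul_low_inr _ _ _ h']
        exact congrArg Sum.inr (Subtype.ext (g.low_edge a).symm)
  map_typ := by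
    rintro ⟨v | a, hv⟩ ⟨w | b, hw⟩ h
    · exact f.map_typ _ _ (Sum.inl.inj h)
    · exact absurd h Sum.inl_ne_inr
    · exact absurd h Sum.inr_ne_inl
    · obtain rfl : g.edge a = b := Sum.inr.inj h
      exact (g.typ_edge a).symm
  map_e := by
    rintro ⟨v | a, hv⟩ ⟨w | b, hw⟩ h
    · exact f.map_e _ _ (Sum.inl.inj h)
    · exact absurd h Sum.inl_ne_inr
    · exact absurd h Sum.inr_ne_inl
    · obtain rfl : g.edge a = b := Sum.inr.inj h
      exact (g.e_edge a).symm
  map_n := by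
    rintro (v | a)
    · refine congrArg₂ (· + ·) (f.map_n v) ?_
      rw [g.map_n, g.map_root, ← f.map_root]
      simp only [f.toEquiv.injective.eq_iff]
    · exact g.map_n a.1
  map_o := by
    rintro (v | a)
    · refine congrArg₂ (· + ·) (f.map_o v) ?_
      rw [g.map_o, g.map_root, ← f.map_root]
      simp only [f.toEquiv.injective.eq_iff]
    · exact g.map_o a.1

/-- Planting is compatible with isomorphisms. -/
def Iso.plant {S T : PreTree d 𝔱 L} (f : Iso S T) (t : 𝔱) (k : MIdx d) :
    Iso (S.plant t k) (T.plant t k) where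
  toEquiv := f.toEquiv.optionCongr
  map_root := rfl
  map_par := by
    rintro (_ | v)
    · rfl
    · change Option.map f.toEquiv (if v = S.root then none else some (S.par v)) =
        if f.toEquiv v = T.root then none else some (T.par (f.toEquiv v))
      rw [← f.map_root, f.toEquiv.injective.eq_iff, ← f.map_par]
      split_ifs <;> rfl
  map_typ := by
    rintro ⟨_ | v, hv⟩ ⟨_ | w, hw⟩ h
    · exact absurd rfl hv
    · exact absurd rfl hv
    · exact absurd rfl hw
    · obtain rfl : f.toEquiv v = w := Option.some.inj h
      change (if h : v = S.root then t else S.typ ⟨v, h⟩) =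
        if h : f.toEquiv v = T.root then t else T.typ ⟨f.toEquiv v, h⟩
      by_cases h : v = S.root
      · rw [dif_pos h, dif_pos (by rw [h, f.map_root])]
      · rw [dif_neg h, dif_neg ((f.ne_root_iff v).1 h)]
        exact (f.typ_edge ⟨v, h⟩).symm
  map_e := by
    rintro ⟨_ | v, hv⟩ ⟨_ | w, hw⟩ h
    · exact absurd rfl hv
    · exact absurd rfl hv
    · exact absurd rfl hw
    · obtain rfl : f.toEquiv v = w := Option.some.inj h
      change (if h : v = S.root then k else S.e ⟨v, h⟩) =
        if h : f.toEquiv v = T.root then k else T.e ⟨f.toEquiv v, h⟩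
      by_cases h : v = S.root
      · rw [dif_pos h, dif_pos (by rw [h, f.map_root])]
      · rw [dif_neg h, dif_neg ((f.ne_root_iff v).1 h)]
        exact (f.e_edge ⟨v, h⟩).symm
  map_n := by
    rintro (_ | v)
    · rfl
    · exact f.map_n v
  map_o := by
    rintro (_ | v)
    · rfl
    · exact f.map_o v

/-- The same tree with other decorations `𝔫` and `𝔢`. -/
abbrev redecorate (T : PreTree d 𝔱 L) (n : T.V → MIdx d) (e : T.Edge → MIdx d) : PreTree d 𝔱 L :=
  { T with n := n, e := e }

/-- An isomorphism that respects new decorations. -/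
def Iso.redecorate {S T : PreTree d 𝔱 L} (f : Iso S T) {n : S.V → MIdx d} {e : S.Edge → MIdx d}
    {n' : T.V → MIdx d} {e' : T.Edge → MIdx d} (hn : ∀ v, n' (f.toEquiv v) = n v)
    (he : ∀ a, e' (f.edge a) = e a) : Iso (S.redecorate n e) (T.redecorate n' e') where
  toEquiv := f.toEquiv
  map_root := f.map_root
  map_par := f.map_par
  map_typ := f.map_typ
  map_e v w h := by
    obtain rfl : f.edge v = w := Subtype.ext h
    exact (he v).symm
  map_n v := (hn v).symm
  map_o := f.map_o

theorem grad_eq (i : Fin (d + 1)) (T : PreTree d 𝔱 L) :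
    T.grad i = (T.n T.root i : ℝ) •
      (T.redecorate (Function.update T.n T.root (T.n T.root - Pi.single i 1)) T.e).vec +
      ∑ a with T.low a = T.root,
        (T.redecorate T.n (Function.update T.e a (T.e a + Pi.single i 1))).vec := by
  rw [Finset.sum_subtype _ (p := fun a => T.low a = T.root) (by simp)]
  rfl

theorem grad_iso (i : Fin (d + 1)) {S T : PreTree d 𝔱 L} (f : Iso S T) : S.grad i = T.grad i := by
  rw [grad_eq, grad_eq]
  refine congrArg₂ (· + ·) ?_ ?_
  · rw [f.map_n, f.map_root]
    congr 1
    refine vec_eq_of_iso (f.redecorate (fun v => ?_) f.e_edge)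
    rw [← f.map_root]
    by_cases h : v = S.root
    · subst h
      simp
    · rw [Function.update_of_ne h, Function.update_of_ne (fun h' => h (f.toEquiv.injective h')),
        f.map_n]
  · refine Finset.sum_equiv f.edge (fun a => ?_) fun a _ => ?_
    · rw [Finset.mem_filter_univ, Finset.mem_filter_univ, f.low_edge, ← f.map_root,
        f.toEquiv.injective.eq_iff]
    · refine vec_eq_of_iso (f.redecorate (fun v => (f.map_n v).symm) fun b => ?_)
      by_cases h : b = a
      · subst h
        simp
      · rw [Function.update_of_ne h, Function.update_of_ne (fun h' => h (f.edge.injective h')),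
          f.e_edge]

end PreTree

/-! ### Bilinearity of the operations and the edges of products and planted trees -/

section Operations

open PreTree

variable {d : ℕ} {𝔱 𝔱' L : Type*}

/-- The tree product as a bilinear map. -/
def treeMulₗ : TreeSpace d 𝔱 L →ₗ[ℝ] TreeSpace d 𝔱 L →ₗ[ℝ] TreeSpace d 𝔱 L :=
  Finsupp.linearCombination ℝ fun σ => Finsupp.linearCombination ℝ fun τ =>
    (PreTree.mul σ.out τ.out).vec

theorem treeMul_eq (x y : TreeSpace d 𝔱 L) : treeMul x y = treeMulₗ x y := by
  unfold treeMul treeMulₗ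
  rw [Finsupp.linearCombination_apply, Finsupp.sum, Finsupp.sum, LinearMap.sum_apply]
  refine Finset.sum_congr rfl fun σ _ => ?_
  rw [LinearMap.smul_apply, Finsupp.linearCombination_apply, Finsupp.sum, Finsupp.sum,
    Finset.smul_sum]
  simp only [smul_smul]

theorem treeMulₗ_vec (S T : PreTree d 𝔱 L) : treeMulₗ S.vec T.vec = (S.mul T).vec := by
  unfold treeMulₗ
  rw [vec_eq_single S, vec_eq_single T, Finsupp.linearCombination_single, one_smul,
    Finsupp.linearCombination_single, one_smul]
  exact vec_eq_of_iso ((exists_iso_out S).some.mul (exists_iso_out T).some)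

theorem integ_vec (t : 𝔱) (k : MIdx d) (T : PreTree d 𝔱 L) :
    integ t k T.vec = (T.plant t k).vec := by
  unfold integ
  rw [vec_eq_single T, Finsupp.linearCombination_single, one_smul]
  exact vec_eq_of_iso ((exists_iso_out T).some.plant t k)

theorem grad_vec (i : Fin (d + 1)) (T : PreTree d 𝔱 L) :
    _root_.grad i T.vec = T.grad i := by
  unfold _root_.grad
  rw [vec_eq_single T, Finsupp.linearCombination_single, one_smul]
  exact grad_iso i (exists_iso_out T).some

theorem TreeSpace.linearMap_ext {M : Type*} [AddCommMonoid M] [Module ℝ M]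
    {f g : TreeSpace d 𝔱 L →ₗ[ℝ] M} (h : ∀ T : PreTree d 𝔱 L, f T.vec = g T.vec) : f = g := by
  refine Finsupp.lhom_ext' fun τ => LinearMap.ext_ring ?_
  induction τ using Quotient.inductionOn with
  | h T => exact h T

/-- The edges of a product. -/
def mulEdge (S T : PreTree d 𝔱 L) : S.Edge ⊕ T.Edge ≃ (S.mul T).Edge where
  toFun := Sum.elim (fun a => ⟨Sum.inl a.1, fun h => a.2 (Sum.inl.inj h)⟩)
    fun a => ⟨Sum.inr a, Sum.inr_ne_inl⟩
  invFun
    | ⟨Sum.inl v, h⟩ => Sum.inl ⟨v, fun h' => h (congrArg Sum.inl h')⟩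
    | ⟨Sum.inr a, _⟩ => Sum.inr a
  left_inv := by rintro (a | a) <;> rfl
  right_inv := by rintro ⟨v | a, h⟩ <;> rfl

/-- The product commutes with a change of types. -/
def mulRetype (S T : PreTree d 𝔱 L) (t : (S.mul T).Edge → 𝔱') :
    Iso ((S.mul T).retype t) ((S.retype fun a => t (mulEdge S T (Sum.inl a))).mul
      (T.retype fun a => t (mulEdge S T (Sum.inr a)))) where
  toEquiv := Equiv.refl _
  map_root := rfl
  map_par := by rintro (v | a) <;> rfl
  map_typ := by
    rintro v w h
    obtain rfl : v = w := Subtype.ext h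
    obtain ⟨v | a, h⟩ := v <;> rfl
  map_e := by
    rintro v w h
    obtain rfl : v = w := Subtype.ext h
    obtain ⟨v | a, h⟩ := v <;> rfl
  map_n := by rintro (v | a) <;> rfl
  map_o := by rintro (v | a) <;> rfl

/-- The edges of a planted tree. -/
def plantEdge (l : 𝔱) (k : MIdx d) (T : PreTree d 𝔱 L) : Unit ⊕ T.Edge ≃ (T.plant l k).Edge where
  toFun := Sum.elim (fun _ => ⟨some T.root, Option.some_ne_none _⟩)
    fun a => ⟨some a.1, Option.some_ne_none _⟩
  invFun
    | ⟨none, h⟩ => absurd rfl h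
    | ⟨some v, _⟩ => if h : v = T.root then Sum.inl () else Sum.inr ⟨v, h⟩
  left_inv := by
    rintro (a | a)
    · exact dif_pos rfl
    · exact dif_neg a.2
  right_inv := by
    rintro ⟨_ | v, h⟩
    · exact absurd rfl h
    · by_cases hv : v = T.root
      · subst hv
        exact congrArg _ (dif_pos rfl)
      · exact congrArg _ (dif_neg hv)

theorem plant_typ_inl (l : 𝔱) (k : MIdx d) (T : PreTree d 𝔱 L) :
    (T.plant l k).typ (plantEdge l k T (Sum.inl ())) = l := dif_pos rfl

theorem plant_typ_inr (l : 𝔱) (k : MIdx d) (T : PreTree d 𝔱 L) (a : T.Edge) :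
    (T.plant l k).typ (plantEdge l k T (Sum.inr a)) = T.typ a := dif_neg a.2

/-- Planting commutes with a change of types. -/
def plantRetype (l : 𝔱) (k : MIdx d) (T : PreTree d 𝔱 L) (t : (T.plant l k).Edge → 𝔱') :
    Iso ((T.plant l k).retype t) ((T.retype fun a => t (plantEdge l k T (Sum.inr a))).plant
      (t (plantEdge l k T (Sum.inl ()))) k) where
  toEquiv := Equiv.refl _
  map_root := rfl
  map_par := by rintro (_ | v) <;> rfl
  map_typ := by
    rintro v w h
    obtain rfl : v = w := Subtype.ext h
    obtain ⟨x, rfl⟩ := (plantEdge l k T).surjective v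
    obtain _ | a := x
    · exact (plant_typ_inl (t (plantEdge l k T (Sum.inl ()))) k
        (T.retype fun a => t (plantEdge l k T (Sum.inr a)))).symm
    · exact (plant_typ_inr (t (plantEdge l k T (Sum.inl ()))) k
        (T.retype fun a => t (plantEdge l k T (Sum.inr a))) a).symm
  map_e := by
    rintro v w h
    obtain rfl : v = w := Subtype.ext h
    obtain ⟨_ | v, hv⟩ := v
    · exact absurd rfl hv
    · rfl
  map_n := by rintro (_ | v) <;> rfl
  map_o := by rintro (_ | v) <;> rfl

end Operations

section ShiftOperations

open PreTree

variable {d : ℕ} {Lm Lp : Type*}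

/-! ### The shift operator commutes with the operations on trees -/

/-- The unit has no edges, hence nothing to retype. -/
theorem mk_retype_eq_unit_iff (T : BaseTree d Lm Lp) {t : T.Edge → ExtTypes Lm Lp}
    (ht : ∀ a, forgetHat (t a) = T.typ a) :
    (Quotient.mk _ (T.retype t) : DTree d _ _) = unitTree d (ExtTypes Lm Lp) (Lm ⊕ Lp) ↔
      (Quotient.mk _ T : DTree d _ _) = unitTree d (Lm ⊕ Lp) (Lm ⊕ Lp) := by
  have hone : ∀ t : (one d (Lm ⊕ Lp) (Lm ⊕ Lp)).Edge → ExtTypes Lm Lp,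
      (Quotient.mk _ ((one d (Lm ⊕ Lp) (Lm ⊕ Lp)).retype t) : DTree d _ _) =
        unitTree d (ExtTypes Lm Lp) (Lm ⊕ Lp) := fun t =>
    mk_eq_of_iso ⟨Equiv.refl _, rfl, fun _ => rfl, fun v => absurd rfl v.2,
      fun v => absurd rfl v.2, fun _ => rfl, fun _ => rfl⟩
  constructor
  · intro h
    rw [← forgetTree_retype T ht, h, ← hone fun a => absurd rfl a.2]
    exact forgetTree_retype _ fun a => absurd rfl a.2
  · intro h
    obtain ⟨f⟩ := Quotient.exact h
    rw [← hone fun a => t (f.edge.symm a)]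
    exact mk_eq_of_iso (f.retype fun a => by rw [Equiv.symm_apply_apply])

variable [Fintype Lm] [Fintype Lp] (r : ℝ)

theorem shift_treeMul (x y : TreeSpace d (Lm ⊕ Lp) (Lm ⊕ Lp)) :
    shift r (treeMul x y) = treeMul (shift r x) (shift r y) := by
  rw [treeMul_eq, treeMul_eq]
  suffices h : treeMulₗ.compr₂ (shift r) = treeMulₗ.compl₁₂ (shift (d := d) (Lm := Lm) (Lp := Lp) r)
      (shift r) from LinearMap.congr_fun (LinearMap.congr_fun h x) y
  refine TreeSpace.linearMap_ext fun S => TreeSpace.linearMap_ext fun T => ?_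
  rw [LinearMap.compr₂_apply, LinearMap.compl₁₂_apply, treeMulₗ_vec, shift_vec, shift_vec,
    shift_vec]
  refine Eq.trans (Finset.sum_congr rfl fun t _ => ?_)
    (sum_weight_split (mulEdge S T) (fun a => hatWeight r ((S.mul T).typ a)) treeMulₗ
      (fun u => (S.retype u).vec) (fun u => (T.retype u).vec))
  rw [treeMulₗ_vec, vec_eq_of_iso (mulRetype S T t)]
  rfl

theorem shift_integ (l : Lp) (k : MIdx d) (x : TreeSpace d (Lm ⊕ Lp) (Lm ⊕ Lp)) :
    shift r (integ (Sum.inr l) k x) = integ (Sum.inr l) k (shift r x) := by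
  suffices h : shift r ∘ₗ integ (Sum.inr l) k =
      integ (Sum.inr l) k ∘ₗ shift (d := d) (Lm := Lm) (Lp := Lp) r from LinearMap.congr_fun h x
  refine TreeSpace.linearMap_ext fun T => ?_
  rw [LinearMap.comp_apply, LinearMap.comp_apply, integ_vec, shift_vec, shift_vec, map_sum]
  simp only [map_smul, integ_vec]
  set l' : Lm ⊕ Lp := Sum.inr l
  rw [← ((plantEdge l' k T).arrowCongr (Equiv.refl _)).sum_comp]
  have h := sum_weight_unit
    (fun b => hatWeight r ((T.plant l' k).typ (plantEdge l' k T b)))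
    (fun x v => ((T.retype v).plant x k).vec)
  refine Eq.trans (Finset.sum_congr rfl fun u _ => ?_) (h.trans ?_)
  · rw [vec_eq_of_iso (plantRetype l' k T _)]
    unfold liftWeight
    rw [← (plantEdge l' k T).prod_comp]
    simp
  · simp only [plant_typ_inl, plant_typ_inr]
    -- A kernel type has no hatted copy: its only lift is itself, with weight `1`.
    rw [Finset.sum_eq_single (Sum.inr l)]
    · have h1 : hatWeight r l' (Sum.inr l) = 1 := (if_pos rfl).trans (if_neg id)
      rw [h1, one_smul]
      rfl
    · intro x _ hx
      rw [hatWeight, if_neg, zero_smul]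
      intro h2
      rcases x with x | x
      · exact Sum.inl_ne_inr h2
      · exact hx (congrArg Sum.inr (Sum.inr.inj h2))
    · exact fun h => absurd (Finset.mem_univ _) h

/-- Differentiation changes `𝔫` or `𝔢` but neither the edges nor their types, so it can be carried
out inside the sum over lifts. -/
theorem shift_grad (i : Fin (d + 1)) (x : TreeSpace d (Lm ⊕ Lp) (Lm ⊕ Lp)) :
    shift r (_root_.grad i x) = _root_.grad i (shift r x) := by
  suffices h : shift r ∘ₗ _root_.grad i =
      _root_.grad i ∘ₗ shift (d := d) (Lm := Lm) (Lp := Lp) r from LinearMap.congr_fun h x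
  refine TreeSpace.linearMap_ext fun T => ?_
  rw [LinearMap.comp_apply, LinearMap.comp_apply, grad_vec, shift_vec, map_sum, grad_eq, map_add,
    map_smul, map_sum, shift_vec]
  simp only [map_smul, grad_vec, shift_vec]
  change (T.n T.root i : ℝ) • (∑ t : T.Edge → ExtTypes Lm Lp, liftWeight r T t •
      ((T.retype t).redecorate (Function.update T.n T.root (T.n T.root - Pi.single i 1)) T.e).vec) +
    ∑ a with T.low a = T.root, (∑ t : T.Edge → ExtTypes Lm Lp, liftWeight r T t •
      ((T.retype t).redecorate T.n (Function.update T.e a (T.e a + Pi.single i 1))).vec) = _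
  rw [Finset.sum_comm, Finset.smul_sum, ← Finset.sum_add_distrib]
  refine Finset.sum_congr rfl fun t _ => ?_
  rw [grad_eq, smul_add, Finset.smul_sum, smul_comm]
  rfl

theorem shift_unit :
    shift r (Finsupp.single (unitTree d (Lm ⊕ Lp) (Lm ⊕ Lp)) 1) =
      Finsupp.single (unitTree d (ExtTypes Lm Lp) (Lm ⊕ Lp)) 1 := by
  have hE : IsEmpty (one d (Lm ⊕ Lp) (Lm ⊕ Lp)).Edge := ⟨fun a => a.2 rfl⟩
  change shift r (one d (Lm ⊕ Lp) (Lm ⊕ Lp)).vec = (one d (ExtTypes Lm Lp) (Lm ⊕ Lp)).vec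
  rw [shift_vec, Fintype.sum_unique, liftWeight, Finset.univ_eq_empty, Finset.prod_empty, one_smul]
  refine vec_eq_of_iso ⟨Equiv.refl _, rfl, fun _ => rfl, fun v => absurd rfl v.2, fun v => absurd rfl v.2,
    fun _ => rfl, fun _ => rfl⟩

theorem shift_apply_unit (x : TreeSpace d (Lm ⊕ Lp) (Lm ⊕ Lp)) :
    shift r x (unitTree d (ExtTypes Lm Lp) (Lm ⊕ Lp)) = x (unitTree d (Lm ⊕ Lp) (Lm ⊕ Lp)) := by
  -- Opaque predicates leave only the classical decidability instance for `filter`, the one in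
  -- `filter_shift`.
  obtain ⟨p, hp⟩ : ∃ p : DTree d (ExtTypes Lm Lp) (Lm ⊕ Lp) → Prop,
      ∀ σ, p σ ↔ σ = unitTree d (ExtTypes Lm Lp) (Lm ⊕ Lp) := ⟨_, fun _ => Iff.rfl⟩
  obtain ⟨p', hp'⟩ : ∃ p' : DTree d (Lm ⊕ Lp) (Lm ⊕ Lp) → Prop,
      ∀ τ, p' τ ↔ τ = unitTree d (Lm ⊕ Lp) (Lm ⊕ Lp) := ⟨_, fun _ => Iff.rfl⟩
  have h := filter_shift r (p := p) (p' := p')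
    (fun T t ht => by rw [hp, hp', mk_retype_eq_unit_iff T ht]) x
  have h2 : x.filter p' =
      x (unitTree d (Lm ⊕ Lp) (Lm ⊕ Lp)) • Finsupp.single (unitTree d (Lm ⊕ Lp) (Lm ⊕ Lp)) 1 := by
    ext τ
    by_cases h1 : τ = unitTree d (Lm ⊕ Lp) (Lm ⊕ Lp)
    · rw [Finsupp.filter_apply_pos _ _ ((hp' τ).2 h1), h1, Finsupp.smul_apply,
        Finsupp.single_eq_same, smul_eq_mul, mul_one]
    · rw [Finsupp.filter_apply_neg _ _ (fun h' => h1 ((hp' τ).1 h')), Finsupp.smul_apply,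
        Finsupp.single_eq_of_ne h1, smul_zero]
  rw [h2, map_smul, shift_unit] at h
  have h3 := DFunLike.congr_fun h (unitTree d (ExtTypes Lm Lp) (Lm ⊕ Lp))
  rwa [Finsupp.filter_apply_pos _ _ ((hp _).2 rfl), Finsupp.smul_apply, Finsupp.single_eq_same,
    smul_eq_mul, mul_one] at h3

theorem shift_treeProd {k : ℕ} (x : Fin k → TreeSpace d (Lm ⊕ Lp) (Lm ⊕ Lp)) :
    shift r (treeProd x) = treeProd fun l => shift r (x l) := by
  unfold treeProd
  rw [← shift_unit r, show List.ofFn (fun l => shift r (x l)) = (List.ofFn x).map (shift r) from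
    List.ofFn_comp' x (shift r)]
  induction List.ofFn x with
  | nil => rfl
  | cons y l ih => rw [List.foldr_cons, shift_treeMul, ih, List.map_cons, List.foldr_cons]

theorem shift_compSmooth (s : Fin (d + 1) → ℕ) (hom : Lm ⊕ Lp → ℝ) (γ : ℝ) {m : ℕ}
    (F : (Fin m → ℝ) → ℝ) (x : Fin m → TreeSpace d (Lm ⊕ Lp) (Lm ⊕ Lp)) :
    shift r (compSmooth (baseSystem s hom) γ F x) =
      compSmooth (extSystem s hom) γ F fun l => shift r (x l) := by
  unfold compSmooth
  -- The Taylor sum over `k` is a `finsum`, which is zero if its support is infinite. Injectivity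
  -- preserves the support, so no finiteness has to be shown.
  refine ((shift r).toAddMonoidHom.map_finsum_of_injective (shift_injective r) _).trans
    (finsum_congr fun k => ?_)
  rw [LinearMap.toAddMonoidHom_coe, ← filter_shift r
    (p := fun τ => (extSystem s hom).degPlus τ < γ) fun T t ht => by rw [degPlus_retype_mk T ht]]
  congr 1
  rw [map_smul, map_sum]
  congr 1
  refine Finset.sum_congr rfl fun j _ => ?_
  have h : ∀ a : ℝ, shift r (Finsupp.single (unitTree d (Lm ⊕ Lp) (Lm ⊕ Lp)) a) =
      Finsupp.single (unitTree d (ExtTypes Lm Lp) (Lm ⊕ Lp)) a := fun a => by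
    rw [← mul_one a, ← smul_eq_mul, ← Finsupp.smul_single, map_smul, shift_unit,
      Finsupp.smul_single]
  rw [map_smul, shift_treeProd]
  simp only [map_sub, h, shift_apply_unit]

end ShiftOperations

end

theorem mainTheorem8 {d : ℕ} {Lm Lp : Type*} [Fintype Lm] [Fintype Lp]
    (s : Fin (d + 1) → ℕ) (hs : ∀ i, 0 < s i) (hom : Lm ⊕ Lp → ℝ)
    (R : Rule d (Lm ⊕ Lp)) (hnoise : ∀ Ξ : Lm, R.R (Sum.inl Ξ) = {0})
    (hnormal : R.Normal) (hsub : R.Subcritical (baseSystem s hom)) (r : ℝ) :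
    -- `𝒮_r` commutes with both coproducts on `𝒯^ex`
    (∀ x ∈ TEx (baseSystem s hom) R,
      (extSystem s hom).deltaMinus (shift r x) =
        TensorProduct.map (shiftMinus r s hom).toLinearMap (shift r)
          ((baseSystem s hom).deltaMinus x)) ∧
    (∀ x ∈ TEx (baseSystem s hom) R,
      (extSystem s hom).deltaPlus (shift r x) =
        TensorProduct.map (shift r) (shiftPlus r s hom).toLinearMap
          ((baseSystem s hom).deltaPlus x)) ∧
    -- its image is a sector of the extended space
    IsSector (extSystem s hom) (extRule R) ((TEx (baseSystem s hom) R).map (shift r)) ∧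
    -- it commutes with renormalisation
    (∀ g : TMinus (baseSystem s hom) R →ₐ[ℝ] ℝ, ∀ x ∈ TEx (baseSystem s hom) R,
      shift r (renorm (baseSystem s hom) R g x) =
        renorm (extSystem s hom) (extRule R) (extendChar s hom R g) (shift r x)) ∧
    -- it maps the reduced space to the extended reduced space
    (∀ x ∈ TReduced (baseSystem s hom) R,
      shift r x ∈ TReduced (extSystem s hom) (extRule R)) ∧
    -- it is multiplicative under the tree product
    (∀ x y : TreeSpace d (Lm ⊕ Lp) (Lm ⊕ Lp),
      shift r (treeMul x y) = treeMul (shift r x) (shift r y)) ∧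
    -- it commutes with composition with smooth functions
    (∀ (γ : ℝ) (m : ℕ) (F : (Fin m → ℝ) → ℝ), ContDiff ℝ (⊤ : ℕ∞) F →
      ∀ x : Fin m → TreeSpace d (Lm ⊕ Lp) (Lm ⊕ Lp),
        (∀ l, FunctionLike (baseSystem s hom) (x l)) →
        shift r (compSmooth (baseSystem s hom) γ F x) =
          compSmooth (extSystem s hom) γ F fun l => shift r (x l)) ∧
    -- it commutes with integration
    (∀ (t : Lp) (k : MIdx d) (x : TreeSpace d (Lm ⊕ Lp) (Lm ⊕ Lp)),
      shift r (integ (Sum.inr t) k x) = integ (Sum.inr t) k (shift r x)) ∧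
    -- it commutes with differentiation
    (∀ (i : Fin (d + 1)) (x : TreeSpace d (Lm ⊕ Lp) (Lm ⊕ Lp)),
      shift r (grad i x) = grad i (shift r x)) :=
  ⟨fun x _ => deltaMinus_shift r hs hom x, fun x _ => deltaPlus_shift r hs hom x,
    isSector_shift r hs hnoise hnormal hsub, fun g x _ => shift_renorm r hs hnoise g x,
    fun _ hx => shift_mem_TReduced hnoise r hx, shift_treeMul r,
    fun γ _ F _ x _ => shift_compSmooth r s hom γ F x, shift_integ r, shift_grad r⟩
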